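/- Consider the integer linear program $$\min\{c^{\top}x \mid \mathscr{A}x=b,\ x\in\mathbb{Z}_{\ge 0}^{nt}\},\qquad \mathscr{A}=\begin{pmatrix}T^{(1)}&T^{(2)}&\cdots&T^{(n)}\\ D&0&\cdots&0\\ 0&D&\cdots&0\\ \vdots&&\ddots&\vdots\\ 0&0&\cdots&D\end{pmatrix},$$ where $n,t\ge 1$, $r\ge 0$, the top blocks $T^{(1)},\dots,T^{(n)}\in\mathbb{Z}^{r\times t}$ may differ, $D=(1,\dots,1)\in\mathbb{Z}^{1\times t}$, $b\in\mathbb{Z}^{r+n}$ and $c\in\mathbb{Z}^{nt}$. Let $\Delta$ be the largest absolute value of an entry of $\mathscr{A}$, and let $q$ be the sum of the last $n$ entries of $b$. There are a single algorithm and an absolute constant $C$ such that, for every such instance (given by $n,r,t$, the entries of $T^{(1)},\dots,T^{(n)}$, $b$ and $c$), the algorithm outputs an optimal solution, or correctly reports that there is no feasible solution, in time at most $$C\cdot nt\cdot\bigl(n\Delta(n+1+4r)\bigr)^{r}\cdot\max\{1,q\}.$$ Time is the number of steps of a random access machine on integers with uniform cost, in which each addition, subtraction, sign test and (indirect) memory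 access is one step. -/

import Mathlib

open scoped Matrix

/-! ### Random access machines with uniform cost

A program is a finite syntax tree over finitely many integer registers and finitely many integer
arrays. The arithmetic consists of addition and subtraction, the only test is the sign test
`0 < e`, and array cells are addressed indirectly. Every operation costs one step. There is no
multiplication, no division and no bit operation. -/

namespace RAM

/-- The contents of the registers and of the arrays. -/
structure Store where
  reg : ℕ → ℤ
  arr : ℕ → ℤ → ℤ

/-- Arithmetic terms. -/
inductive Term : Type
  | const (z : ℤ)
  | reg (x : ℕ)
  | get (a : ℕ) (i : Term)
  | add (e f : Term)
  | sub (e f : Term)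

/-- The value of a term in a store. -/
def Term.value (s : Store) : Term → ℤ
  | const z => z
  | reg x => s.reg x
  | get a i => s.arr a (i.value s)
  | add e f => e.value s + f.value s
  | sub e f => e.value s - f.value s

/-- The number of operations needed to evaluate a term. -/
def Term.cost : Term → ℕ
  | const _ => 1
  | reg _ => 1
  | get _ i => i.cost + 1
  | add e f => e.cost + f.cost + 1
  | sub e f => e.cost + f.cost + 1

/-- Programs. -/
inductive Program : Type
  | skip
  /-- `x := e` -/
  | assign (x : ℕ) (e : Term)
  /-- `a[i] := e` -/
  | store (a : ℕ) (i e : Term)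
  | seq (p p' : Program)
  /-- `if 0 < e then p else p'` -/
  | ifPos (e : Term) (p p' : Program)
  /-- `while 0 < e do p` -/
  | whilePos (e : Term) (p : Program)

/-- The store after `x := z`. -/
def Store.setReg (s : Store) (x : ℕ) (z : ℤ) : Store :=
  { s with reg := Function.update s.reg x z }

/-- The store after `a[i] := z`. -/
def Store.setArr (s : Store) (a : ℕ) (i z : ℤ) : Store :=
  { s with arr := Function.update s.arr a (Function.update (s.arr a) i z) }

/-- `Runs p s k s'`: started in the store `s`, the program `p` halts after exactly `k` steps, and
the store is then `s'`. -/
inductive Runs : Program → Store → ℕ → Store → Prop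
  | skip (s : Store) : Runs .skip s 1 s
  | assign (s : Store) (x : ℕ) (e : Term) :
      Runs (.assign x e) s (e.cost + 1) (s.setReg x (e.value s))
  | store (s : Store) (a : ℕ) (i e : Term) :
      Runs (.store a i e) s (i.cost + e.cost + 1) (s.setArr a (i.value s) (e.value s))
  | seq {p p' : Program} {s s' s'' : Store} {k k' : ℕ} :
      Runs p s k s' → Runs p' s' k' s'' → Runs (.seq p p') s (k + k') s''
  | ifTrue {e : Term} {p p' : Program} {s s' : Store} {k : ℕ} :
      0 < e.value s → Runs p s k s' → Runs (.ifPos e p p') s (e.cost + 1 + k) s'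
  | ifFalse {e : Term} {p p' : Program} {s s' : Store} {k : ℕ} :
      ¬ 0 < e.value s → Runs p' s k s' → Runs (.ifPos e p p') s (e.cost + 1 + k) s'
  | whileTrue {e : Term} {p : Program} {s s' s'' : Store} {k k' : ℕ} :
      0 < e.value s → Runs p s k s' → Runs (.whilePos e p) s' k' s'' →
      Runs (.whilePos e p) s (e.cost + 1 + k + k') s''
  | whileFalse {e : Term} {p : Program} {s : Store} :
      ¬ 0 < e.value s → Runs (.whilePos e p) s (e.cost + 1) s

end RAM

/-! ### The integer linear program -/

/-- The data of an instance with `n` blocks of `t` variables each and `r` linking constraints.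
The entries `b (Sum.inl k)` form the upper part of the right-hand side, and the entries
`b (Sum.inr i)` are its last `n` entries. -/
structure NFold (n r t : ℕ) where
  T : Fin n → Matrix (Fin r) (Fin t) ℤ
  b : Fin r ⊕ Fin n → ℤ
  c : Fin n × Fin t → ℤ

namespace NFold

variable {n r t : ℕ}

/-- The constraint matrix: the blocks `T 0, …, T (n - 1)` side by side on top, and below them the
block diagonal matrix all of whose diagonal blocks are the all-ones row of length `t`. -/
def matrix (I : NFold n r t) : Matrix (Fin r ⊕ Fin n) (Fin n × Fin t) ℤ :=
  Matrix.fromRows (Matrix.of fun k p => I.T p.1 k p.2)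
    (Matrix.of fun i p => if i = p.1 then 1 else 0)

/-- The largest absolute value of an entry of the constraint matrix. -/
def maxEntry (I : NFold n r t) : ℕ :=
  (Finset.univ : Finset ((Fin r ⊕ Fin n) × (Fin n × Fin t))).sup
    fun p => (I.matrix p.1 p.2).natAbs

/-- The sum of the last `n` entries of the right-hand side. -/
def localSum (I : NFold n r t) : ℤ := ∑ i : Fin n, I.b (Sum.inr i)

/-- Feasible solutions. -/
def IsFeasible (I : NFold n r t) (x : Fin n × Fin t → ℤ) : Prop :=
  I.matrix *ᵥ x = I.b ∧ ∀ p, 0 ≤ x p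

/-- Optimal solutions. -/
def IsOptimal (I : NFold n r t) (x : Fin n × Fin t → ℤ) : Prop :=
  I.IsFeasible x ∧ ∀ y, I.IsFeasible y → I.c ⬝ᵥ x ≤ I.c ⬝ᵥ y

/-- The initial store: registers 0, 1, 2 hold `n`, `r`, `t`; array 0 holds the blocks
`T 0, …, T (n - 1)` one after the other, each row by row; array 1 holds the right-hand side, and
array 2 the objective vector. Everything else is 0. -/
noncomputable def input (I : NFold n r t) : RAM.Store where
  reg x := if x = 0 then n else if x = 1 then r else if x = 2 then t else 0
  arr a :=
    if a = 0 then
      Function.extend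
        (fun p : Fin n × Fin r × Fin t => (((p.1 : ℕ) * r + p.2.1) * t + p.2.2 : ℤ))
        (fun p => I.T p.1 p.2.1 p.2.2) 0
    else if a = 1 then
      Function.extend
        (Sum.elim (fun k : Fin r => ((k : ℕ) : ℤ)) (fun i : Fin n => (r + (i : ℕ) : ℤ))) I.b 0
    else if a = 2 then
      Function.extend (fun p : Fin n × Fin t => ((p.1 : ℕ) * t + p.2 : ℤ)) I.c 0
    else 0

/-- The vector in array 3 of a store, read brick by brick. -/
def output (n t : ℕ) (s : RAM.Store) : Fin n × Fin t → ℤ :=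
  fun p => s.arr 3 ((p.1 : ℕ) * t + p.2)

/-- The final store `s` is a correct answer: register 0 is 0 and the program is infeasible, or
register 0 is 1 and the output vector is an optimal solution. -/
def IsAnswer (I : NFold n r t) (s : RAM.Store) : Prop :=
  (s.reg 0 = 0 ∧ ¬ ∃ x, I.IsFeasible x) ∨ (s.reg 0 = 1 ∧ I.IsOptimal (output n t s))

end NFold

/-! A feasible solution is read as a sequence of q unit steps, each taking one column of one brick;
the local constraints say how often each brick is taken. The order of the bricks is fixed
beforehand, without knowing the solution: a schedule that serves brick i fewer than k·b_i/q + 1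
times in the first k steps (`pickBrick_halts`). Inside a brick the order of the columns is free, and
the Steinitz lemma (`steinitz`) chooses it so that partial sums stay within 2rΔ of the segment to
the brick's total. Summing over the bricks and adding the error of the schedule, at most 2(n-1)Δ,
gives `exists_balanced_choice`: after k steps the upper vector is within ρ = 2Δ(n(r+1)-1) of k/q
times the upper right-hand side. A shortest path computation with q levels, (2ρ+1)^r states per
level and t arcs into each state therefore suffices, and 2ρ+1 ≤ nΔ(n+1+4r) (`state_bounds`).

On the machine, the state with upper vector u at level k is the single integer k + ∑ u_l M^(l+1),
with M = 2Δq+1. An arc is then one subtraction, and the level is the residue mod M. The radius ρ may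
exceed M, so different window points may share a code. This is harmless: `Traced` makes every marked
code the code of some actual path, `Covers` bounds its value by the cost of every path inside the
windows, and a code has to determine its vector only at the target. There both vectors have entries
at most Δq in absolute value, so `eq_zero_of_sum_mul_pow_eq_zero` applies. The two directions are
`Tables.of_isFeasible` (a solution gives a path inside the windows) and `Tables.isFeasible` (a path
to the target gives a solution of the same cost).

Multiplication is repeated addition, driven by the factor whose size the time bound can afford. For
this reason upper entries beyond Δq are rejected first, as they cannot occur in a feasible instance,
and the floors of k·b_l/q are updated through remainders, with at most Δ corrections per step. -/

namespace RAM

/-! ### A calculus for running times of programs -/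

@[simp] theorem Store.reg_setReg (s : Store) (x y : ℕ) (z : ℤ) :
    (s.setReg x z).reg y = if y = x then z else s.reg y := by
  simp [Store.setReg, Function.update_apply]

@[simp] theorem Store.arr_setReg (s : Store) (x : ℕ) (z : ℤ) : (s.setReg x z).arr = s.arr := rfl

@[simp] theorem Store.reg_setArr (s : Store) (a : ℕ) (i z : ℤ) : (s.setArr a i z).reg = s.reg := rfl

@[simp] theorem Store.arr_setArr (s : Store) (a b : ℕ) (i z : ℤ) :
    (s.setArr a i z).arr b = if b = a then Function.update (s.arr a) i z else s.arr b := by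
  simp only [Store.setArr, Function.update_apply]

attribute [simp] Term.value Term.cost

/-- The registers that a program may change. -/
def Program.regs : Program → List ℕ
  | skip => []
  | assign x _ => [x]
  | store _ _ _ => []
  | seq p p' => p.regs ++ p'.regs
  | ifPos _ p p' => p.regs ++ p'.regs
  | whilePos _ p => p.regs

/-- The arrays that a program may change. -/
def Program.arrs : Program → List ℕ
  | skip => []
  | assign _ _ => []
  | store a _ _ => [a]
  | seq p p' => p.arrs ++ p'.arrs
  | ifPos _ p p' => p.arrs ++ p'.arrs
  | whilePos _ p => p.arrs

/-- The two stores agree wherever the program does not write. -/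
structure Agree (p : Program) (s s' : Store) : Prop where
  reg : ∀ x, x ∉ p.regs → s'.reg x = s.reg x
  arr : ∀ a, a ∉ p.arrs → s'.arr a = s.arr a

theorem Agree.refl (p : Program) (s : Store) : Agree p s s := ⟨fun _ _ => rfl, fun _ _ => rfl⟩

theorem Agree.trans {p : Program} {s s' s'' : Store} (h : Agree p s s') (h' : Agree p s' s'') :
    Agree p s s'' :=
  ⟨fun x hx => (h'.reg x hx).trans (h.reg x hx), fun a ha => (h'.arr a ha).trans (h.arr a ha)⟩

theorem Agree.mono {p p' : Program} {s s' : Store} (h : Agree p s s')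
    (hr : p.regs ⊆ p'.regs) (ha : p.arrs ⊆ p'.arrs) : Agree p' s s' :=
  ⟨fun x hx => h.reg x fun h' => hx (hr h'), fun a h' => h.arr a fun h'' => h' (ha h'')⟩

/-- The frame rule: what may change can be read off the program text, so facts about all other
registers and arrays are carried along by `decide`. -/
theorem Runs.agree {p : Program} {s s' : Store} {k : ℕ} (h : Runs p s k s') : Agree p s s' := by
  induction h with
  | skip s => exact Agree.refl _ _
  | assign s x e =>
    refine ⟨fun y hy => ?_, fun _ _ => rfl⟩
    simp only [Program.regs, List.mem_singleton] at hy
    simp [Store.reg_setReg, hy]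
  | store s a i e =>
    refine ⟨fun _ _ => rfl, fun b hb => ?_⟩
    simp only [Program.arrs, List.mem_singleton] at hb
    simp [Store.arr_setArr, hb]
  | seq _ _ h h' =>
    exact (h.mono (by simp [Program.regs]) (by simp [Program.arrs])).trans
      (h'.mono (by simp [Program.regs]) (by simp [Program.arrs]))
  | ifTrue _ _ h => exact h.mono (by simp [Program.regs]) (by simp [Program.arrs])
  | ifFalse _ _ h => exact h.mono (by simp [Program.regs]) (by simp [Program.arrs])
  | whileTrue _ _ _ h h' =>
    exact (h.mono (by simp [Program.regs]) (by simp [Program.arrs])).trans h'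
  | whileFalse _ => exact Agree.refl _ _

/-- Started in `s`, the program `p` halts within `c` steps in a store that satisfies `Q`. -/
def Halts (p : Program) (s : Store) (c : ℕ) (Q : Store → Prop) : Prop :=
  ∃ k s', Runs p s k s' ∧ k ≤ c ∧ Q s'

/-- The frame facts are handed to the new postcondition, so a specification has to mention only what
its program computes. -/
theorem Halts.mono {p : Program} {s : Store} {c c' : ℕ} {Q Q' : Store → Prop}
    (h : Halts p s c Q) (hc : c ≤ c') (hQ : ∀ s', Agree p s s' → Q s' → Q' s') :
    Halts p s c' Q' := by
  obtain ⟨k, s', hr, hk, hq⟩ := h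
  exact ⟨k, s', hr, hk.trans hc, hQ s' hr.agree hq⟩

theorem Halts.skip {s : Store} {c : ℕ} {Q : Store → Prop} (h : Q s) (hc : 1 ≤ c := by first | omega | (simp only [Term.cost]; omega)) :
    Halts .skip s c Q := ⟨1, s, .skip s, hc, h⟩

theorem Halts.assign {s : Store} {c x : ℕ} {e : Term} {Q : Store → Prop}
    (h : Q (s.setReg x (e.value s))) 
    (hc : e.cost + 1 ≤ c := by first | omega | (simp only [Term.cost]; omega)) : Halts (.assign x e) s c Q :=
  ⟨_, _, .assign s x e, hc, h⟩

theorem Halts.store {s : Store} {c a : ℕ} {i e : Term} {Q : Store → Prop}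
    (h : Q (s.setArr a (i.value s) (e.value s))) 
    (hc : i.cost + e.cost + 1 ≤ c := by first | omega | (simp only [Term.cost]; omega)) :
    Halts (.store a i e) s c Q :=
  ⟨_, _, .store s a i e, hc, h⟩

theorem Halts.seq {p p' : Program} {s : Store} {c c₁ c₂ : ℕ} {Q Q₁ : Store → Prop}
    (h : Halts p s c₁ Q₁) (h' : ∀ s₁, Agree p s s₁ → Q₁ s₁ → Halts p' s₁ c₂ Q)
    (hc : c₁ + c₂ ≤ c) : Halts (.seq p p') s c Q := by
  obtain ⟨k, s₁, hr, hk, hq⟩ := h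
  obtain ⟨k', s₂, hr', hk', hq'⟩ := h' s₁ hr.agree hq
  exact ⟨k + k', s₂, .seq hr hr', by omega, hq'⟩

theorem Halts.ifPos {p p' : Program} {e : Term} {s : Store} {c c₁ : ℕ} {Q : Store → Prop}
    (h : 0 < e.value s → Halts p s c₁ Q) (h' : ¬ 0 < e.value s → Halts p' s c₁ Q)
    (hc : e.cost + 1 + c₁ ≤ c) : Halts (.ifPos e p p') s c Q := by
  by_cases he : 0 < e.value s
  · obtain ⟨k, s₁, hr, hk, hq⟩ := h he
    exact ⟨_, s₁, .ifTrue he hr, by omega, hq⟩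
  · obtain ⟨k, s₁, hr, hk, hq⟩ := h' he
    exact ⟨_, s₁, .ifFalse he hr, by omega, hq⟩

theorem Halts.assign_seq {p : Program} {s : Store} {c c' x : ℕ} {e : Term} {Q : Store → Prop}
    (h : Halts p (s.setReg x (e.value s)) c' Q) (hc : e.cost + 1 + c' ≤ c) :
    Halts (.seq (.assign x e) p) s c Q := by
  obtain ⟨k, s₁, hr, hk, hq⟩ := h
  exact ⟨_, s₁, .seq (.assign s x e) hr, by omega, hq⟩

theorem Halts.store_seq {p : Program} {s : Store} {c c' a : ℕ} {i e : Term} {Q : Store → Prop}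
    (h : Halts p (s.setArr a (i.value s) (e.value s)) c' Q) (hc : i.cost + e.cost + 1 + c' ≤ c) :
    Halts (.seq (.store a i e) p) s c Q := by
  obtain ⟨k, s₁, hr, hk, hq⟩ := h
  exact ⟨_, s₁, .seq (.store s a i e) hr, by omega, hq⟩

/-- A loop with `N` further rounds, described by an invariant indexed by the number of rounds
still to come. -/
theorem Halts.whilePos {e : Term} {p : Program} (c : ℕ) (Inv : ℕ → Store → Prop) {N : ℕ}
    {s : Store} {c' : ℕ} {Q : Store → Prop} (h : Inv N s)
    (hpos : ∀ m s₁, Inv (m + 1) s₁ → 0 < e.value s₁ ∧ Halts p s₁ c (Inv m))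
    (hend : ∀ s₁, Inv 0 s₁ → ¬ 0 < e.value s₁ ∧ Q s₁)
    (hc : N * (c + e.cost + 1) + e.cost + 1 ≤ c') : Halts (.whilePos e p) s c' Q := by
  induction N generalizing s c' with
  | zero =>
    obtain ⟨h1, h2⟩ := hend s h
    exact ⟨_, s, .whileFalse h1, by omega, h2⟩
  | succ N ih =>
    obtain ⟨h1, k, s₁, hr, hk, hq⟩ := hpos N s h
    obtain ⟨k', s₂, hr', hk', hq'⟩ := ih hq le_rfl
    exact ⟨_, s₂, .whileTrue h1 hr hr', by linarith, hq'⟩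

/-- `for x = 0, …, (reg y) - 1 do p` -/
def Program.forTo (x y : ℕ) (p : Program) : Program :=
  .seq (.assign x (.const 0))
    (.whilePos (.sub (.reg y) (.reg x)) (.seq p (.assign x (.add (.reg x) (.const 1)))))

theorem Halts.forTo_sum {x y : ℕ} {p : Program} (hx : x ∉ p.regs) (hy : y ∉ p.regs) (hxy : x ≠ y)
    (N : ℕ) (c : ℕ → ℕ) (Inv : ℕ → Store → Prop) {s : Store} {c' : ℕ} {Q : Store → Prop}
    (hN : s.reg y = N) (h0 : Inv 0 (s.setReg x 0))
    (hstep : ∀ i < N, ∀ s₁, Agree (.forTo x y p) s s₁ → s₁.reg x = i → Inv i s₁ →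
      Halts p s₁ (c i) fun s₂ => Inv (i + 1) (s₂.setReg x (i + 1)))
    (hend : ∀ s₁, Agree (.forTo x y p) s s₁ → Inv N s₁ → Q s₁)
    (hc : (∑ i ∈ Finset.range N, (c i + 8)) + 6 ≤ c') : Halts (.forTo x y p) s c' Q := by
  refine Halts.assign_seq (c' := (∑ i ∈ Finset.range N, (c i + 8)) + 4) ?_
    (by simp [Term.cost]; omega)
  set e : Term := .sub (.reg y) (.reg x) with he
  have key : ∀ m i s₁, i + m = N → Agree (.forTo x y p) s s₁ → s₁.reg x = i → Inv i s₁ →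
      Halts (.whilePos e (.seq p (.assign x (.add (.reg x) (.const 1))))) s₁
        ((∑ i ∈ Finset.Ico i N, (c i + 8)) + 4) Q := by
    intro m
    induction m with
    | zero =>
      intro i s₁ hi hag hxi hinv
      obtain rfl : i = N := by omega
      have hyr : s₁.reg y = i := by
        rw [hag.reg y (by simp [Program.forTo, Program.regs, hy, Ne.symm hxy]), hN]
      exact ⟨_, s₁, .whileFalse (by simp [e, Term.value, hxi, hyr]), by simp [e, Term.cost],
        hend s₁ hag hinv⟩
    | succ m ih =>
      intro i s₁ hi hag hxi hinv
      have hyr : s₁.reg y = N := by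
        rw [hag.reg y (by simp [Program.forTo, Program.regs, hy, Ne.symm hxy]), hN]
      obtain ⟨k, s₂, hr, hk, hq⟩ := hstep i (by omega) s₁ hag hxi hinv
      have hx2 : s₂.reg x = i := by rw [hr.agree.reg x hx, hxi]
      have hr3 : Runs (.seq p (.assign x (.add (.reg x) (.const 1)))) s₁ (k + 4)
          (s₂.setReg x (i + 1)) := by
        have := Runs.seq hr (.assign s₂ x (.add (.reg x) (.const 1)))
        simpa [Term.value, Term.cost, hx2] using this
      obtain ⟨k', s₃, hr', hk', hq'⟩ := ih (i + 1) (s₂.setReg x (i + 1)) (by omega)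
        (hag.trans (hr3.agree.mono (by simp [Program.forTo, Program.regs])
          (by simp [Program.forTo, Program.arrs]))) (by simp [Store.reg_setReg]) hq
      refine ⟨_, s₃, .whileTrue ?_ hr3 hr', ?_, hq'⟩
      · simp [e, Term.value, hxi, hyr]; omega
      · rw [Finset.sum_eq_sum_Ico_succ_bot (by omega)]
        simp only [e, Term.cost]
        omega
  have := key N 0 (s.setReg x 0) (by omega)
    ⟨fun z hz => by
      simp [Program.forTo, Program.regs] at hz
      simp [Store.reg_setReg, hz], fun _ _ => rfl⟩ (by simp [Store.reg_setReg]) h0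
  simpa [Term.value] using this

theorem Halts.forTo {x y : ℕ} {p : Program} (N c : ℕ) (Inv : ℕ → Store → Prop)
    {s : Store} {c' : ℕ} {Q : Store → Prop}
    (hN : s.reg y = N) (h0 : Inv 0 (s.setReg x 0))
    (hstep : ∀ i < N, ∀ s₁, Agree (.forTo x y p) s s₁ → s₁.reg x = i → Inv i s₁ →
      Halts p s₁ c fun s₂ => Inv (i + 1) (s₂.setReg x (i + 1)))
    (hend : ∀ s₁, Agree (.forTo x y p) s s₁ → Inv N s₁ → Q s₁)
    (hc : N * (c + 8) + 6 ≤ c')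
    (hx : x ∉ p.regs := by decide) (hy : y ∉ p.regs := by decide) (hxy : x ≠ y := by decide) :
    Halts (.forTo x y p) s c' Q :=
  Halts.forTo_sum hx hy hxy N (fun _ => c) Inv hN h0 hstep hend (by simpa using hc)

/-- `reg 30 := e * f` -/
def Program.mul (e f : Term) : Program :=
  .seq (.assign 31 e) <| .seq (.assign 32 f) <| .seq (.assign 30 (.const 0)) <|
  .seq (.whilePos (.reg 31) <|
    .seq (.assign 30 (.add (.reg 30) (.reg 32))) (.assign 31 (.sub (.reg 31) (.const 1)))) <|
  .whilePos (.sub (.const 0) (.reg 31)) <|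
    .seq (.assign 30 (.sub (.reg 30) (.reg 32))) (.assign 31 (.add (.reg 31) (.const 1)))

/-- One addition or subtraction of Y per unit of |X|: the cost depends on the first factor only, so
Y may be a huge power of the radix. The second term is evaluated after register 31 has been
overwritten, whence the form of `hf`. -/
theorem Halts.mul {e f : Term} {s : Store} {c : ℕ} (X Y : ℤ) (K : ℕ) {Q : Store → Prop}
    (hX : e.value s = X) (hf : f.value (s.setReg 31 X) = Y) (hK : X.natAbs ≤ K)
    (hQ : ∀ s₁, Agree (.mul e f) s s₁ → s₁.reg 30 = X * Y → Q s₁)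
    (hc : 12 * K + 20 + e.cost + f.cost ≤ c) : Halts (.mul e f) s c Q := by
  have main : Halts (.mul e f) s c fun s₁ => s₁.reg 30 = X * Y := by
    refine Halts.assign_seq (c' := c - (e.cost + 1)) ?_ (by omega)
    refine Halts.assign_seq (c' := c - (e.cost + 1) - (f.cost + 1)) ?_ (by omega)
    rw [hX, hf]
    refine Halts.assign_seq (c' := 12 * K + 10) ?_ (by simp only [Term.cost]; omega)
    refine Halts.seq (c₁ := 10 * X.toNat + 2) (c₂ := 12 * (-X).toNat + 8)
      (Q₁ := fun s₁ => s₁.reg 32 = Y ∧ s₁.reg 30 = X.toNat * Y ∧ s₁.reg 31 = X - X.toNat) ?_ ?_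
      (by omega)
    · refine Halts.whilePos 8 (fun m s₁ => m ≤ X.toNat ∧ s₁.reg 32 = Y ∧
        s₁.reg 30 = (X.toNat - m) * Y ∧ s₁.reg 31 = m + (X - X.toNat)) (N := X.toNat) ?_ ?_ ?_
        (by simp only [Term.cost]; omega)
      · simp [Store.reg_setReg, Term.value]
      · rintro m s₁ ⟨h0, h1, h2, h3⟩
        refine ⟨by simp only [Term.value, h3]; push_cast; omega, Halts.assign_seq (c' := 4)
          (Halts.assign ⟨by omega, ?_, ?_, ?_⟩ (by simp [Term.cost])) (by simp [Term.cost])⟩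
        · simp [Store.reg_setReg, h1]
        · simp [Store.reg_setReg, Term.value, h1, h2]; ring
        · simp [Store.reg_setReg, Term.value, h3]; ring
      · rintro s₁ ⟨h0, h1, h2, h3⟩
        refine ⟨by simp only [Term.value, h3]; push_cast; omega, h1, by simpa using h2,
          by simpa using h3⟩
    · rintro s₁ - ⟨h1, h2, h3⟩
      refine Halts.whilePos 8 (fun m s₁ => m ≤ (-X).toNat ∧ s₁.reg 32 = Y ∧
        s₁.reg 30 = X * Y + m * Y ∧ s₁.reg 31 = - m) (N := (-X).toNat) ?_ ?_ ?_
        (by simp only [Term.cost]; omega)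
      · refine ⟨le_rfl, h1, ?_, by omega⟩
        rw [h2, ← add_mul]
        congr 1
        omega
      · rintro m s₁ ⟨h0, h1, h2, h3⟩
        refine ⟨by simp only [Term.value, h3]; push_cast; omega, Halts.assign_seq (c' := 4)
          (Halts.assign ⟨by omega, ?_, ?_, ?_⟩ (by simp [Term.cost])) (by simp [Term.cost])⟩
        · simp [Store.reg_setReg, h1]
        · simp [Store.reg_setReg, Term.value, h1, h2]; ring
        · simp [Store.reg_setReg, Term.value, h3]
      · rintro s₁ ⟨h0, h1, h2, h3⟩
        refine ⟨by simp [Term.value, h3], by simpa using h2⟩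
  exact main.mono le_rfl hQ

theorem Halts.mul_then {e f : Term} {p : Program} {s : Store} {c : ℕ} {Q : Store → Prop}
    (X Y : ℤ) (K : ℕ) (hX : e.value s = X) (hf : f.value (s.setReg 31 X) = Y) (hK : X.natAbs ≤ K)
    (hQ : ∀ s₁, Agree (.mul e f) s s₁ → s₁.reg 30 = X * Y →
      Halts p s₁ (c - (12 * K + 20 + e.cost + f.cost)) Q)
    (hc : 12 * K + 20 + e.cost + f.cost ≤ c := by first | omega | (simp only [Term.cost]; omega)) :
    Halts (.seq (.mul e f) p) s c Q :=
  Halts.seq (Q₁ := fun s₁ => s₁.reg 30 = X * Y)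
    (Halts.mul X Y K hX hf hK (fun _ _ h => h) le_rfl) hQ (by omega)

theorem Halts.assign_then {p : Program} {s : Store} {c x : ℕ} {e : Term} {Q : Store → Prop}
    (h : Halts p (s.setReg x (e.value s)) (c - (e.cost + 1)) Q)
    (hc : e.cost + 1 ≤ c := by first | omega | (simp only [Term.cost]; omega)) : Halts (.seq (.assign x e) p) s c Q :=
  h.assign_seq (by omega)

theorem Halts.store_then {p : Program} {s : Store} {c a : ℕ} {i e : Term} {Q : Store → Prop}
    (h : Halts p (s.setArr a (i.value s) (e.value s)) (c - (i.cost + e.cost + 1)) Q)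
    (hc : i.cost + e.cost + 1 ≤ c := by first | omega | (simp only [Term.cost]; omega)) :
    Halts (.seq (.store a i e) p) s c Q :=
  h.store_seq (by omega)

theorem Halts.then {p p' : Program} {s : Store} {c c₁ : ℕ} {Q Q₁ : Store → Prop}
    (h : Halts p s c₁ Q₁) (h' : ∀ s₁, Agree p s s₁ → Q₁ s₁ → Halts p' s₁ (c - c₁) Q)
    (hc : c₁ ≤ c := by first | omega | (simp only [Term.cost]; omega)) : Halts (.seq p p') s c Q :=
  h.seq h' (by omega)

theorem Halts.ite {p p' : Program} {e : Term} {s : Store} {c : ℕ} {Q : Store → Prop}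
    (h : 0 < e.value s → Halts p s (c - (e.cost + 1)) Q)
    (h' : ¬ 0 < e.value s → Halts p' s (c - (e.cost + 1)) Q)
    (hc : e.cost + 1 ≤ c := by first | omega | (simp only [Term.cost]; omega)) : Halts (.ifPos e p p') s c Q :=
  Halts.ifPos h h' (by omega)

end RAM

/-! ### The Steinitz lemma -/

section Steinitz

variable {ι : Type*} [DecidableEq ι] {d : ℕ}

/-- A fractional selection from `A` of total weight `w` whose weighted vector sum vanishes. -/
structure IsSelection (v : ι → Fin d → ℝ) (A : Finset ι) (w : ℝ) (μ : ι → ℝ) : Prop where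
  nonneg : ∀ a ∈ A, 0 ≤ μ a
  le_one : ∀ a ∈ A, μ a ≤ 1
  sum : ∑ a ∈ A, μ a = w
  vec : ∀ l, ∑ a ∈ A, μ a * v a l = 0

/-- An extra coordinate 1 turns linear dependence in dimension d+1 into an affine relation. -/
theorem exists_affine_relation (v : ι → Fin d → ℝ) (F : Finset ι) (hF : d + 1 < F.card) :
    ∃ τ : ι → ℝ, (∀ a ∉ F, τ a = 0) ∧ (∃ a ∈ F, τ a ≠ 0) ∧ ∑ a ∈ F, τ a = 0 ∧
      ∀ l, ∑ a ∈ F, τ a * v a l = 0 := by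
  let u : F → (Fin d → ℝ) × ℝ := fun a => (v a, 1)
  have hdep : ¬ LinearIndependent ℝ u := fun h => by
    have := h.fintype_card_le_finrank
    simp at this
    omega
  obtain ⟨g, hg, a, ha⟩ := Fintype.not_linearIndependent_iff.1 hdep
  have hext : ∀ f : ι → ℝ, ∑ a ∈ F, (if h : a ∈ F then g ⟨a, h⟩ else 0) * f a
      = ∑ a : F, g a * f a := by
    intro f
    rw [← Finset.sum_coe_sort F]
    exact Finset.sum_congr rfl fun a _ => by simp
  refine ⟨fun a => if h : a ∈ F then g ⟨a, h⟩ else 0, fun a h => by simp [h],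
    ⟨a, a.2, by simpa using ha⟩, ?_, fun l => ?_⟩
  · have := hext fun _ => 1
    simp only [mul_one] at this
    rw [this]
    simpa [u, Prod.snd_sum] using congrArg Prod.snd hg
  · rw [hext fun a => v a l]
    have := congrFun (congrArg Prod.fst hg) l
    simpa [u, Prod.fst_sum] using this

/-- The proof walks towards a vertex of the polytope of selections. If no coordinate is 0, the
fractional coordinates carry ∑ (1 - μ) = d+1 with every summand below 1, so there are more than d+1
of them. An affine relation among their vectors is a direction that preserves weight and vector sum;
following it until a coordinate reaches 0 or 1 leaves fewer fractional coordinates. -/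
theorem IsSelection.exists_zero {v : ι → Fin d → ℝ} {A : Finset ι}
    {μ : ι → ℝ} (hμ : IsSelection v A (A.card - 1 - d) μ) :
    ∃ μ', IsSelection v A (A.card - 1 - d) μ' ∧ ∃ a ∈ A, μ' a = 0 := by
  induction hm : (A.filter fun a => μ a ≠ 0 ∧ μ a ≠ 1).card using Nat.strong_induction_on
    generalizing μ with
  | _ m ih =>
    by_cases hz : ∃ a ∈ A, μ a = 0
    · exact ⟨μ, hμ, hz⟩
    push Not at hz
    set F := A.filter fun a => μ a ≠ 0 ∧ μ a ≠ 1 with hFdef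
    have hFA : F ⊆ A := Finset.filter_subset _ _
    have hF0 : ∀ a ∈ F, 0 < μ a ∧ μ a < 1 := fun a ha => by
      have := (Finset.mem_filter.1 ha).2
      exact ⟨(hμ.nonneg a (hFA ha)).lt_of_ne' this.1, (hμ.le_one a (hFA ha)).lt_of_ne this.2⟩
    have hsum : ∑ a ∈ F, (1 - μ a) = d + 1 := by
      rw [Finset.sum_subset hFA (f := fun a => 1 - μ a)]
      · rw [Finset.sum_sub_distrib, hμ.sum]
        simp
        ring
      · intro a ha haF
        have : μ a = 1 := by
          by_contra h
          exact haF (Finset.mem_filter.2 ⟨ha, hz a ha, h⟩)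
        simp [this]
    have hFne : F.Nonempty := by
      rw [Finset.nonempty_iff_ne_empty]
      rintro h
      rw [h, Finset.sum_empty] at hsum
      have : (0:ℝ) ≤ d := Nat.cast_nonneg d
      linarith
    have hcard : d + 1 < F.card := by
      have : ∑ a ∈ F, (1 - μ a) < ∑ a ∈ F, (1:ℝ) :=
        Finset.sum_lt_sum_of_nonempty hFne fun a ha => by linarith [hF0 a ha]
      rw [hsum] at this
      simp at this
      exact_mod_cast this
    obtain ⟨τ, hτ0, ⟨a₀, ha₀, hτa₀⟩, hτs, hτv⟩ := exists_affine_relation v F hcard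
    -- The distance that coordinate a can travel along τ before it reaches 1 or 0; the minimum is
    -- the first coordinate to stop.
    set room : ι → ℝ := fun a => if 0 < τ a then (1 - μ a) / τ a else μ a / (- τ a) with hroom
    obtain ⟨a₁, ha₁, hmin⟩ := Finset.exists_min_image (F.filter fun a => τ a ≠ 0) room
      ⟨a₀, Finset.mem_filter.2 ⟨ha₀, hτa₀⟩⟩
    obtain ⟨ha₁F, hτa₁⟩ := Finset.mem_filter.1 ha₁
    set x := room a₁ with hx
    have hxpos : 0 ≤ x := by
      simp only [hx, hroom]
      have := hF0 a₁ ha₁F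
      split_ifs with h
      · exact div_nonneg (by linarith) h.le
      · exact div_nonneg this.1.le (by linarith)
    have hbd : ∀ a ∈ F, 0 ≤ μ a + x * τ a ∧ μ a + x * τ a ≤ 1 := by
      intro a ha
      have h0 := hF0 a ha
      rcases lt_trichotomy (τ a) 0 with h | h | h
      · have hle := hmin a (Finset.mem_filter.2 ⟨ha, h.ne⟩)
        have : x ≤ μ a / (- τ a) := by simpa [hroom, h.not_gt] using hle
        rw [le_div_iff₀ (by linarith)] at this
        constructor <;> nlinarith
      · rw [h]; constructor <;> linarith
      · have hle := hmin a (Finset.mem_filter.2 ⟨ha, h.ne'⟩)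
        have : x ≤ (1 - μ a) / τ a := by simpa [hroom, h] using hle
        rw [le_div_iff₀ h] at this
        constructor <;> nlinarith
    have hhit : μ a₁ + x * τ a₁ = 0 ∨ μ a₁ + x * τ a₁ = 1 := by
      simp only [hx, hroom]
      split_ifs with h
      · right; field_simp; ring
      · left; field_simp; ring
    have hsumF : ∀ f : ι → ℝ, ∑ a ∈ A, (μ a + x * τ a) * f a
        = ∑ a ∈ A, μ a * f a + x * ∑ a ∈ F, τ a * f a := by
      intro f
      have : ∑ a ∈ F, τ a * f a = ∑ a ∈ A, τ a * f a :=
        Finset.sum_subset hFA fun a _ h => by simp [hτ0 a h]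
      rw [this, Finset.mul_sum, ← Finset.sum_add_distrib]
      exact Finset.sum_congr rfl fun a _ => by ring
    have hnew : IsSelection v A (A.card - 1 - d) (fun a => μ a + x * τ a) := by
      refine ⟨fun a ha => ?_, fun a ha => ?_, ?_, fun l => ?_⟩
      · by_cases h : a ∈ F
        · exact (hbd a h).1
        · simpa [hτ0 a h] using hμ.nonneg a ha
      · by_cases h : a ∈ F
        · exact (hbd a h).2
        · simpa [hτ0 a h] using hμ.le_one a ha
      · have := hsumF fun _ => 1
        simpa [hτs, hμ.sum] using this
      · simpa [hμ.vec, hτv] using hsumF fun a => v a l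
    refine ih _ ?_ hnew rfl
    rw [← hm]
    refine Finset.card_lt_card (Finset.ssubset_iff_of_subset ?_ |>.2 ⟨a₁, ha₁F, ?_⟩)
    · intro a ha
      obtain ⟨haA, ha'⟩ := Finset.mem_filter.1 ha
      by_contra h
      have h1 : μ a = 1 := by
        by_contra h'
        exact h (Finset.mem_filter.2 ⟨haA, hz a haA, h'⟩)
      exact ha'.2 (by simp [hτ0 a h, h1])
    · intro h
      have := (Finset.mem_filter.1 h).2
      rcases hhit with h' | h'
      · exact this.1 h'
      · exact this.2 h'

/-- A set that is small or carries a fractional selection of weight `|A| - d` has an enumeration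
with short partial sums. -/
theorem exists_list_of_isSelection {v : ι → Fin d → ℝ} {B : ℝ} (hv : ∀ a l, |v a l| ≤ B)
    (hB : 0 ≤ B) (A : Finset ι)
    (h : A.card ≤ d ∨ ∃ μ, IsSelection v A (A.card - d) μ) :
    ∃ L : List ι, L.Nodup ∧ L.toFinset = A ∧
      ∀ k l, |((L.take k).map fun a => v a l).sum| ≤ d * B := by
  induction hm : A.card using Nat.strong_induction_on generalizing A with
  | _ m ih =>
    have hprefix : ∀ (L : List ι) l, |(L.map fun a => v a l).sum| ≤ L.length * B := by
      intro L l
      induction L with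
      | nil => simp
      | cons a L ih =>
        simp only [List.map_cons, List.sum_cons, List.length_cons]
        push_cast
        calc _ ≤ |v a l| + |(L.map fun a => v a l).sum| := abs_add_le _ _
          _ ≤ _ := by linarith [hv a l]
    by_cases hd : A.card ≤ d
    · refine ⟨A.toList, A.nodup_toList, by simp, fun k l => (hprefix _ l).trans ?_⟩
      gcongr
      have : (A.toList.take k).length ≤ A.card := by simp
      exact_mod_cast this.trans hd
    · obtain ⟨μ, hμ⟩ := h.resolve_left hd
      push Not at hd
      have hAd : (0:ℝ) < A.card - d := by
        have : (d:ℝ) < A.card := by exact_mod_cast hd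
        linarith
      have hAd1 : (1:ℝ) ≤ A.card - d := by
        have : (d:ℝ) + 1 ≤ A.card := by exact_mod_cast hd
        linarith
      -- Scaling lowers the weight by one. A vector whose coordinate can then be made 0 is placed
      -- last, and what remains carries a selection of weight one less than before, as the induction
      -- needs.
      have hscale : IsSelection v A (A.card - 1 - d)
          (fun a => (A.card - 1 - d) / (A.card - d) * μ a) := by
        have hc0 : (0:ℝ) ≤ (A.card - 1 - d) / (A.card - d) := div_nonneg (by linarith) hAd.le
        have hc1 : ((A.card:ℝ) - 1 - d) / (A.card - d) ≤ 1 := by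
          rw [div_le_one hAd]; linarith
        refine ⟨fun a ha => mul_nonneg hc0 (hμ.nonneg a ha), fun a ha =>
          mul_le_one₀ hc1 (hμ.nonneg a ha) (hμ.le_one a ha), ?_, fun l => ?_⟩
        · rw [← Finset.mul_sum, hμ.sum]
          field_simp
        · simp only [mul_assoc]
          rw [← Finset.mul_sum, hμ.vec, mul_zero]
      obtain ⟨μ', hμ', a, ha, hza⟩ := hscale.exists_zero
      have hcard := Finset.card_erase_add_one ha
      have herase : IsSelection v (A.erase a) ((A.erase a).card - d) μ' := by
        refine ⟨fun b hb => hμ'.nonneg b (Finset.mem_of_mem_erase hb),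
          fun b hb => hμ'.le_one b (Finset.mem_of_mem_erase hb), ?_, fun l => ?_⟩
        · rw [Finset.sum_erase _ hza, hμ'.sum, ← hcard]
          push_cast; ring
        · rw [Finset.sum_erase _ (by simp [hza]), hμ'.vec]
      obtain ⟨L, hL, hLA, hLs⟩ := ih (A.erase a).card (by omega) (A.erase a) (Or.inr ⟨μ', herase⟩) rfl
      have haL : a ∉ L := by
        rw [← List.mem_toFinset, hLA]; simp
      refine ⟨L ++ [a], ?_, ?_, fun k l => ?_⟩
      · rw [List.nodup_append]
        simp only [List.nodup_singleton, List.mem_singleton, true_and, hL]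
        rintro b hb c rfl rfl
        exact haL hb
      · simp [List.toFinset_append, hLA, Finset.insert_erase ha]
      · by_cases hk : k ≤ L.length
        · rw [List.take_append_of_le_length hk]
          exact hLs k l
        · rw [List.take_of_length_le (by simp; omega)]
          have hLsum : ((L ++ [a]).map fun b => v b l).sum = ∑ b ∈ A, v b l := by
            have h1 : ((L).map fun b => v b l).sum = ∑ b ∈ A.erase a, v b l := by
              rw [← hLA, List.sum_toFinset _ hL]
            rw [List.map_append, List.sum_append, h1]
            simp [Finset.sum_erase_add _ _ ha]
          rw [hLsum]
          -- Subtracting the vanishing weighted sum leaves nonnegative weights of total d, however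
          -- large A is.
          have : ∑ b ∈ A, v b l = ∑ b ∈ A, (1 - μ b) * v b l := by
            simp only [sub_mul, one_mul, Finset.sum_sub_distrib, hμ.vec, sub_zero]
          rw [this]
          calc |∑ b ∈ A, (1 - μ b) * v b l| ≤ ∑ b ∈ A, |(1 - μ b) * v b l| :=
                Finset.abs_sum_le_sum_abs _ _
            _ ≤ ∑ b ∈ A, (1 - μ b) * B := Finset.sum_le_sum fun b hb => by
                have := hμ.le_one b hb
                rw [abs_mul, abs_of_nonneg (by linarith)]
                exact mul_le_mul_of_nonneg_left (hv b l) (by linarith)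
            _ = d * B := by
                rw [← Finset.sum_mul, Finset.sum_sub_distrib, hμ.sum]
                simp

/-- The Steinitz lemma with the constant of Grinberg and Sevastyanov, in the maximum norm. -/
theorem steinitz {v : ι → Fin d → ℝ} {B : ℝ} (hv : ∀ a l, |v a l| ≤ B) (hB : 0 ≤ B)
    (A : Finset ι) (hA : ∀ l, ∑ a ∈ A, v a l = 0) :
    ∃ L : List ι, L.Nodup ∧ L.toFinset = A ∧
      ∀ k l, |((L.take k).map fun a => v a l).sum| ≤ d * B := by
  refine exists_list_of_isSelection hv hB A ?_
  by_cases hd : A.card ≤ d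
  · exact Or.inl hd
  have hAc : (d:ℝ) < A.card := by exact_mod_cast not_le.1 hd
  have hA0 : (0:ℝ) < A.card := lt_of_le_of_lt (Nat.cast_nonneg d) hAc
  refine Or.inr ⟨fun _ => (A.card - d) / A.card, fun a _ => div_nonneg (by linarith) hA0.le,
    fun a _ => ?_, ?_, fun l => ?_⟩
  · rw [div_le_one hA0]
    linarith [(Nat.cast_nonneg d : (0:ℝ) ≤ d)]
  · rw [Finset.sum_const, nsmul_eq_mul]
    field_simp
  · rw [← Finset.mul_sum, hA, mul_zero]

end Steinitz

/-! ### Balanced orderings of a solution -/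

/-- A finite multiset of vectors can be enumerated such that all partial sums stay close to the
segment from `0` to the total sum. -/
theorem exists_balanced_sequence {r t : ℕ} [NeZero t] (v : Fin t → Fin r → ℤ) {Δ : ℕ}
    (hv : ∀ j l, |v j l| ≤ Δ) (y : Fin t → ℕ) :
    ∃ f : ℕ → Fin t, (∀ j, ((Finset.range (∑ j, y j)).filter fun m => f m = j).card = y j) ∧
      ∀ k ≤ ∑ j, y j, ∀ l,
        |((∑ j, y j : ℕ) : ℝ) * ∑ m ∈ Finset.range k, (v (f m) l : ℝ) - k * ∑ j, (v j l : ℝ) * y j|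
          ≤ (∑ j, y j : ℕ) * (2 * r * Δ) := by
  classical
  set b := ∑ j, y j with hb
  let ι := Σ j : Fin t, Fin (y j)
  set S : Fin r → ℝ := fun l => ∑ j, (v j l : ℝ) * y j with hS
  have hcard : (Finset.univ : Finset ι).card = b := by simp [ι, hb]
  have hsum : ∀ g : Fin t → ℝ, ∑ a : ι, g a.1 = ∑ j, g j * y j := by
    intro g
    rw [Fintype.sum_sigma]
    simp [mul_comm]
  have hvR : ∀ j l, |(v j l : ℝ)| ≤ Δ := fun j l => by exact_mod_cast hv j l
  have hSb : ∀ l, |S l| ≤ b * Δ := fun l => by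
    calc |S l| ≤ ∑ j, |(v j l : ℝ) * y j| := Finset.abs_sum_le_sum_abs _ _
      _ ≤ ∑ j, (Δ : ℝ) * y j := Finset.sum_le_sum fun j _ => by
          rw [abs_mul, Nat.abs_cast]
          exact mul_le_mul_of_nonneg_right (hvR j l) (Nat.cast_nonneg _)
      _ = b * Δ := by rw [← Finset.mul_sum, hb]; push_cast; ring
  -- The vectors b·v - S sum to zero and have entries at most 2bΔ. Everything is scaled by the
  -- number b of vectors to avoid dividing by it.
  obtain ⟨L, hL, hLu, hLs⟩ := steinitz (ι := ι) (d := r)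
    (v := fun a l => b * (v a.1 l : ℝ) - S l) (B := b * (2 * Δ)) (fun a l => by
      calc |(b:ℝ) * (v a.1 l : ℝ) - S l| ≤ |(b:ℝ) * (v a.1 l : ℝ)| + |S l| := abs_sub _ _
        _ ≤ b * Δ + b * Δ := by
          rw [abs_mul, Nat.abs_cast]
          exact add_le_add (mul_le_mul_of_nonneg_left (hvR _ _) (Nat.cast_nonneg _)) (hSb l)
        _ = _ := by ring) (by positivity) Finset.univ (fun l => by
      rw [Finset.sum_sub_distrib, ← Finset.mul_sum, hsum fun j => (v j l : ℝ), Finset.sum_const,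
        hcard, nsmul_eq_mul, sub_self])
  have hlen : L.length = b := by
    rw [← List.toFinset_card_of_nodup hL, hLu, hcard]
  let f : ℕ → Fin t := fun m => if h : m < L.length then (L[m]).1 else 0
  have htake : ∀ k ≤ b, (L.take k).map Sigma.fst = (List.range k).map f := by
    intro k hk
    apply List.ext_getElem
    · simp; omega
    · intro m h1 h2
      simp at h1 h2
      simp [f, h1.2]
  have hpre : ∀ k ≤ b, ∀ g : Fin t → ℝ,
      ∑ m ∈ Finset.range k, g (f m) = ((L.take k).map fun a => g a.1).sum := by
    intro k hk g
    have : (L.take k).map (fun a => g a.1) = ((L.take k).map Sigma.fst).map g := by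
      rw [List.map_map]; rfl
    rw [this, htake k hk, List.map_map]
    rw [← List.sum_toFinset _ List.nodup_range]
    exact Finset.sum_congr (by ext; simp) fun _ _ => rfl
  refine ⟨f, fun j => ?_, fun k hk l => ?_⟩
  · have h1 := hpre b le_rfl fun j' => if j' = j then 1 else 0
    rw [List.take_of_length_le hlen.le, ← List.sum_toFinset _ hL, hLu,
      hsum fun j' => if j' = j then 1 else 0] at h1
    have h2 : ((((Finset.range b).filter fun m => f m = j).card : ℕ) : ℝ) = y j := by
      rw [← Finset.sum_boole, h1]
      simp
    exact_mod_cast h2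
  · have h1 := hLs k l
    have h2 := hpre k hk fun j => b * (v j l : ℝ) - S l
    rw [← h2, Finset.sum_sub_distrib, ← Finset.mul_sum, Finset.sum_const, Finset.card_range,
      nsmul_eq_mul] at h1
    refine h1.trans (le_of_eq ?_)
    ring

/-- How often the value `i` occurs among the first `k` terms of a sequence. -/
def occ {α : Type*} [DecidableEq α] (σ : ℕ → α) (i : α) (k : ℕ) : ℕ :=
  ((Finset.range k).filter fun m => σ m = i).card

section occ

variable {α : Type*} [DecidableEq α] (σ : ℕ → α) (i : α)

@[simp] theorem occ_zero : occ σ i 0 = 0 := by simp [occ]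

theorem occ_succ (k : ℕ) : occ σ i (k + 1) = occ σ i k + if σ k = i then 1 else 0 := by
  rw [occ, occ, Finset.range_add_one, Finset.filter_insert]
  split_ifs with h
  · rw [Finset.card_insert_of_notMem (by simp)]
  · rfl

theorem occ_mono {k k' : ℕ} (h : k ≤ k') : occ σ i k ≤ occ σ i k' :=
  Finset.card_le_card (Finset.filter_subset_filter _ (Finset.range_mono h))

theorem sum_occ {n : ℕ} (σ : ℕ → Fin n) (k : ℕ) : ∑ i, occ σ i k = k := by
  induction k with
  | zero => simp
  | succ k ih => simp [occ_succ, Finset.sum_add_distrib, ih]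

/-- Merging sequences according to a schedule. -/
theorem sum_merge {n : ℕ} {β : Type*} {R : Type*} [AddCommMonoid R] (σ : ℕ → Fin n)
    (f : Fin n → ℕ → β) (g : Fin n → β → R) (k : ℕ) :
    ∑ m ∈ Finset.range k, g (σ m) (f (σ m) (occ σ (σ m) m))
      = ∑ i, ∑ m ∈ Finset.range (occ σ i k), g i (f i m) := by
  induction k with
  | zero => simp
  | succ k ih =>
    rw [Finset.sum_range_succ, ih]
    have : ∀ i, ∑ m ∈ Finset.range (occ σ i (k + 1)), g i (f i m)
        = ∑ m ∈ Finset.range (occ σ i k), g i (f i m)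
          + if σ k = i then g i (f i (occ σ i k)) else 0 := by
      intro i
      rw [occ_succ]
      split_ifs with h
      · rw [Finset.sum_range_succ]
      · simp
    rw [Finset.sum_congr rfl fun i _ => this i, Finset.sum_add_distrib]
    simp

end occ

/-- A schedule that never is a full unit ahead of its quota ends with its quotas. -/
theorem occ_eq_of_balanced {n q : ℕ} {β : Fin n → ℕ} (hβ : ∑ i, β i = q) {σ : ℕ → Fin n}
    (hσ : ∀ i, q * occ σ i q < q * β i + q) (i : Fin n) : occ σ i q = β i := by
  have hle : ∀ i, occ σ i q ≤ β i := fun i => by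
    have h := hσ i
    by_contra h'
    push Not at h'
    nlinarith [Nat.mul_le_mul_left q (Nat.succ_le_of_lt h')]
  by_contra hne
  have : ∑ i, occ σ i q < ∑ i, β i :=
    Finset.sum_lt_sum (fun i _ => hle i) ⟨i, Finset.mem_univ i, (hle i).lt_of_ne hne⟩
  rw [sum_occ, hβ] at this
  exact lt_irrefl _ this

/-- If some entry is positive, at most n-1 entries are negative, each at least -q, and the positive
entries balance them. If none is positive, all vanish. -/
theorem sum_abs_le_of_sum_eq_zero {n : ℕ} (hn : 1 ≤ n) {D : Fin n → ℝ} {q : ℝ} (hq : 0 ≤ q)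
    (h0 : ∑ i, D i = 0) (hD : ∀ i, -q ≤ D i) : ∑ i, |D i| ≤ 2 * (n - 1) * q := by
  have hn' : (1:ℝ) ≤ n := by exact_mod_cast hn
  by_cases h : ∃ i, 0 < D i
  · obtain ⟨i₀, hi₀⟩ := h
    have h1 : ∀ i, |D i| ≤ D i + if i = i₀ then 0 else 2 * q := by
      intro i
      split_ifs with hi
      · rw [hi, abs_of_pos hi₀, add_zero]
      · rw [abs_le]; constructor <;> linarith [hD i]
    calc ∑ i, |D i| ≤ ∑ i, (D i + if i = i₀ then 0 else 2 * q) := Finset.sum_le_sum fun i _ => h1 i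
      _ = ∑ i ∈ Finset.univ.erase i₀, 2 * q := by
        rw [Finset.sum_add_distrib, h0, zero_add, ← Finset.sum_erase_add _ _ (Finset.mem_univ i₀)]
        simp only [if_true, add_zero]
        exact Finset.sum_congr rfl fun i hi => by simp [(Finset.mem_erase.1 hi).1]
      _ = _ := by
        rw [Finset.sum_const, Finset.card_erase_of_mem (Finset.mem_univ _), nsmul_eq_mul,
          Finset.card_univ, Fintype.card_fin, Nat.cast_sub hn]
        push_cast; ring
  · push Not at h
    have : ∑ i, |D i| = 0 := by
      rw [Finset.sum_congr rfl fun i _ => abs_of_nonpos (h i), Finset.sum_neg_distrib, h0, neg_zero]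
    rw [this]
    have : (0:ℝ) ≤ n - 1 := by linarith
    positivity

/-- Every choice of columns can be carried out along a balanced schedule such that all partial
sums stay close to the segment from `0` to the total sum. -/
theorem exists_balanced_choice {n r t q : ℕ} [NeZero t] (hn : 1 ≤ n)
    (T : Fin n → Fin r → Fin t → ℤ) {Δ : ℕ} (hT : ∀ i l j, |T i l j| ≤ Δ) (y : Fin n → Fin t → ℕ)
    (hq : ∑ i, ∑ j, y i j = q) {σ : ℕ → Fin n}
    (hσ : 0 < q → ∀ k ≤ q, ∀ i, q * occ σ i k < k * ∑ j, y i j + q) :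
    ∃ js : ℕ → Fin t,
      (∀ i j, ((Finset.range q).filter fun m => σ m = i ∧ js m = j).card = y i j) ∧
      ∀ k ≤ q, ∀ l, |q * ∑ m ∈ Finset.range k, T (σ m) l (js m)
        - k * ∑ i, ∑ j, T i l j * y i j| ≤ q * (2 * Δ * (n * (r + 1) - 1)) := by
  rcases Nat.eq_zero_or_pos q with rfl | hq0
  · have hy : ∀ i j, y i j = 0 := by simpa using hq
    exact ⟨fun _ => 0, fun i j => by simp [hy], fun k hk l => by simp [Nat.le_zero.1 hk]⟩
  replace hσ := hσ hq0
  choose f hf1 hf2 using fun i => exists_balanced_sequence (fun j l => T i l j) (fun j l => hT i l j)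
    (y i)
  have hocc : ∀ i, occ σ i q = ∑ j, y i j := occ_eq_of_balanced hq fun i => hσ q le_rfl i
  -- Step m takes the next unused column of brick σ m in that brick's own Steinitz order; `occ`
  -- counts those already used.
  refine ⟨fun m => f (σ m) (occ σ (σ m) m), fun i j => ?_, fun k hk l => ?_⟩
  · have := sum_merge σ f (fun i' j' => if i' = i ∧ j' = j then 1 else 0) q
    rw [Finset.card_filter, this, Finset.sum_eq_single i]
    · rw [hocc, ← hf1 i j, Finset.card_filter]
      simp [hf1]
    · intro i' _ hi'
      simp [hi']
    · simp
  · have hle : ∀ i, occ σ i k ≤ ∑ j, y i j := fun i => hocc i ▸ occ_mono σ i hk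
    set β : Fin n → ℕ := fun i => ∑ j, y i j with hβ
    set S : Fin n → ℝ := fun i => ∑ j, (T i l j : ℝ) * y i j with hS
    set Pf : Fin n → ℝ := fun i => ∑ m ∈ Finset.range (occ σ i k), (T i l (f i m) : ℝ) with hPf
    have hmerge : (∑ m ∈ Finset.range k, (T (σ m) l (f (σ m) (occ σ (σ m) m)) : ℝ)) = ∑ i, Pf i :=
      sum_merge σ f (fun i j => (T i l j : ℝ)) k
    have hTR : ∀ i j, |(T i l j : ℝ)| ≤ Δ := fun i j => by exact_mod_cast hT i l j
    have hSb : ∀ i, |S i| ≤ β i * Δ := fun i => by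
      calc |S i| ≤ ∑ j, |(T i l j : ℝ) * y i j| := Finset.abs_sum_le_sum_abs _ _
        _ ≤ ∑ j, (Δ : ℝ) * y i j := Finset.sum_le_sum fun j _ => by
            rw [abs_mul, Nat.abs_cast]
            exact mul_le_mul_of_nonneg_right (hTR i j) (Nat.cast_nonneg _)
        _ = β i * Δ := by rw [← Finset.mul_sum, hβ]; push_cast; ring
    set D : Fin n → ℝ := fun i => k * β i - q * occ σ i k with hD
    have hD0 : ∑ i, D i = 0 := by
      simp only [hD]
      rw [Finset.sum_sub_distrib, ← Finset.mul_sum, ← Finset.mul_sum]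
      have h1 : ∑ i, (β i : ℝ) = q := by exact_mod_cast hq
      have h2 : ∑ i, (occ σ i k : ℝ) = k := by exact_mod_cast sum_occ σ k
      rw [h1, h2]; ring
    have hDq : ∀ i, -(q:ℝ) ≤ D i := fun i => by
      have : (q:ℝ) * occ σ i k < k * β i + q := by exact_mod_cast hσ k hk i
      simp only [hD]; linarith
    have habs := sum_abs_le_of_sum_eq_zero hn (Nat.cast_nonneg q) hD0 hDq
    have hbrick : ∀ i, |q * Pf i - k * S i| ≤ q * (2 * r * Δ) + |D i| * Δ := by
      intro i
      -- The Steinitz estimate comes multiplied by β i, which is to be cancelled, so empty bricks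
      -- are treated apart.
      by_cases hb : β i = 0
      · have h1 : occ σ i k = 0 := by have := hle i; simp only [hβ] at hb; omega
        have h2 : S i = 0 := by
          have := hSb i
          rw [hb] at this
          simpa using this
        simp only [hPf, h1, h2]
        simp
        positivity
      · have hb0 : (0:ℝ) < β i := by exact_mod_cast Nat.pos_of_ne_zero hb
        have h1 : |β i * Pf i - occ σ i k * S i| ≤ β i * (2 * r * Δ) := by
          simpa [hPf, hS, hβ] using hf2 i (occ σ i k) (hle i) l
        -- The deviation splits into the Steinitz error inside the brick and the amount D i by which
        -- the schedule is behind or ahead of its quota.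
        have h2 : β i * (q * Pf i - k * S i)
            = q * (β i * Pf i - occ σ i k * S i) - D i * S i := by
          simp only [hD]; ring
        have h3 : β i * |q * Pf i - k * S i| ≤ β i * (q * (2 * r * Δ) + |D i| * Δ) := by
          rw [← abs_of_pos hb0, ← abs_mul, abs_of_pos hb0, h2]
          calc _ ≤ |q * (β i * Pf i - occ σ i k * S i)| + |D i * S i| := abs_sub _ _
            _ ≤ q * (β i * (2 * r * Δ)) + |D i| * (β i * Δ) := by
              rw [abs_mul, abs_mul, Nat.abs_cast]
              exact add_le_add (mul_le_mul_of_nonneg_left h1 (Nat.cast_nonneg _))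
                (mul_le_mul_of_nonneg_left (hSb i) (abs_nonneg _))
            _ = _ := by ring
        exact le_of_mul_le_mul_left h3 hb0
    have hfinal : |(q:ℝ) * ∑ m ∈ Finset.range k, (T (σ m) l (f (σ m) (occ σ (σ m) m)) : ℝ)
        - k * ∑ i, S i| ≤ q * (2 * Δ * (n * (r + 1) - 1)) := by
      rw [hmerge, Finset.mul_sum, Finset.mul_sum, ← Finset.sum_sub_distrib]
      calc _ ≤ ∑ i, |q * Pf i - k * S i| := Finset.abs_sum_le_sum_abs _ _
        _ ≤ ∑ i, (q * (2 * r * Δ) + |D i| * Δ) := Finset.sum_le_sum fun i _ => hbrick i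
        _ = n * (q * (2 * r * Δ)) + (∑ i, |D i|) * Δ := by
          rw [Finset.sum_add_distrib, Finset.sum_mul]; simp
        _ ≤ n * (q * (2 * r * Δ)) + (2 * (n - 1) * q) * Δ :=
          add_le_add_right (mul_le_mul_of_nonneg_right habs (Nat.cast_nonneg _)) _
        _ = _ := by ring
    simp only [hS] at hfinal
    exact_mod_cast hfinal

/-- After division by M, all terms but the lowest digit are multiples of M; that digit is smaller
than M in absolute value, hence 0, and the same argument applies to the remaining digits. -/
theorem eq_zero_of_sum_mul_pow_eq_zero {M : ℤ} {r : ℕ} {u : ℕ → ℤ} (hu : ∀ l < r, |u l| < M)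
    (h : ∑ l ∈ Finset.range r, u l * M ^ (l + 1) = 0) : ∀ l < r, u l = 0 := by
  induction r generalizing u with
  | zero => simp
  | succ r ih =>
    have hM : 0 < M := (abs_nonneg _).trans_lt (hu 0 (by omega))
    have h' : M * (u 0 + ∑ l ∈ Finset.range r, u (l + 1) * M ^ (l + 1)) = 0 := by
      rw [← h, Finset.sum_range_succ', mul_add, Finset.mul_sum, add_comm]
      congr 1
      · exact Finset.sum_congr rfl fun l _ => by ring
      · ring
    have h1 : u 0 + ∑ l ∈ Finset.range r, u (l + 1) * M ^ (l + 1) = 0 :=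
      (mul_eq_zero.1 h').resolve_left hM.ne'
    have hdvd : M ∣ ∑ l ∈ Finset.range r, u (l + 1) * M ^ (l + 1) :=
      Finset.dvd_sum fun l _ => Dvd.dvd.mul_left (dvd_pow_self M (by omega)) _
    have h0 : u 0 = 0 := by
      refine Int.eq_zero_of_abs_lt_dvd (m := M) ?_ (hu 0 (by omega))
      have : u 0 = -∑ l ∈ Finset.range r, u (l + 1) * M ^ (l + 1) := by linarith
      rw [this]
      exact (dvd_neg).2 hdvd
    intro l hl
    rcases l with _ | l
    · exact h0
    · exact ih (u := fun l => u (l + 1)) (fun l hl => hu (l + 1) (by omega))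
        (by rw [h0] at h1; simpa using h1) l (by omega)

/-! ### Invariants of the dynamic program -/

section DynamicProgram

/-- The code of the state reached by the first `k` choices `js` along the schedule `A`. -/
def pathCode (A g : ℤ → ℤ) (js : ℕ → ℕ) (k : ℕ) : ℤ :=
  ∑ m ∈ Finset.range k, (g (A m + js m) + 1)

/-- The cost of the first `k` choices `js` along the schedule `A`. -/
def pathCost (A c : ℤ → ℤ) (js : ℕ → ℕ) (k : ℕ) : ℤ :=
  ∑ m ∈ Finset.range k, c (A m + js m)

/-- Every marked state comes with a choice that leads back to a marked state one level below. -/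
def Traced (M : ℤ) (t : ℕ) (A g c : ℤ → ℤ) (K : ℕ) (mark val : ℤ → ℤ) : Prop :=
  ∀ u, 0 < mark u → ∃ k : ℕ, k ≤ K ∧ u % M = k ∧ (k = 0 → u = 0 ∧ val u = 0) ∧
    ∀ m, k = m + 1 → ∃ j : ℕ, j < t ∧ mark u = j + 1 ∧ 0 < mark (u - g (A m + j) - 1) ∧
      val u = val (u - g (A m + j) - 1) + c (A m + j)

/-- Every path inside the windows ends in a marked state whose value is at most the cost of the
path. -/
def Covers (t : ℕ) (A g c : ℤ → ℤ) (base L : ℤ → ℤ) (len K : ℕ) (mark val : ℤ → ℤ) : Prop :=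
  ∀ js : ℕ → ℕ, (∀ m, js m < t) →
    (∀ k : ℕ, 1 ≤ k → k ≤ K → ∃ idx : ℕ, idx < len ∧ pathCode A g js k = base k + L idx) →
    0 < mark (pathCode A g js K) ∧ val (pathCode A g js K) ≤ pathCost A c js K

/-- The tables during the computation of level `K + 1`, with the transitions in `S` done. -/
structure Level (M : ℤ) (t : ℕ) (g c : ℤ → ℤ) (K : ℕ) (a : ℤ) (mark₀ val₀ mark val : ℤ → ℤ)
    (S : Set (ℤ × ℕ)) : Prop where
  other : ∀ u, u % M ≠ K + 1 → mark u = mark₀ u ∧ val u = val₀ u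
  origin : ∀ u, u % M = K + 1 → 0 < mark u → ∃ j : ℕ, j < t ∧ mark u = j + 1 ∧
    0 < mark₀ (u - g (a + j) - 1) ∧ val u = val₀ (u - g (a + j) - 1) + c (a + j)
  relaxed : ∀ u, ∀ j : ℕ, (u, j) ∈ S → u % M = K + 1 → 0 < mark₀ (u - g (a + j) - 1) →
    0 < mark u ∧ val u ≤ val₀ (u - g (a + j) - 1) + c (a + j)

variable {M : ℤ} {t : ℕ} {A g c : ℤ → ℤ} {K : ℕ} {a : ℤ} {mark₀ val₀ mark val : ℤ → ℤ}
  {S S' : Set (ℤ × ℕ)}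

theorem Level.mono (h : Level M t g c K a mark₀ val₀ mark val S) (hS : S' ⊆ S) :
    Level M t g c K a mark₀ val₀ mark val S' :=
  ⟨h.other, h.origin, fun u j hu => h.relaxed u j (hS hu)⟩

/-- Marked states have residues at most K, so nothing at level K+1 is marked yet. -/
theorem Traced.level (h : Traced M t A g c K mark val) :
    Level M t g c K a mark val mark val ∅ := by
  refine ⟨fun _ _ => ⟨rfl, rfl⟩, fun u hu hm => ?_, fun u j hu => hu.elim⟩
  obtain ⟨k, hk, hk', -⟩ := h u hm
  omega

theorem sub_emod_of_emod_eq_succ {u x : ℤ} (hK : (K:ℤ) + 1 < M) (hu : u % M = K + 1) (hx : M ∣ x) :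
    (u - x - 1) % M = K := by
  obtain ⟨y, rfl⟩ := hx
  have h1 := Int.emod_add_mul_ediv u M
  have : u - M * y - 1 = K + M * (u / M - y) := by rw [mul_sub]; linarith
  rw [this, Int.add_mul_emod_self_left]
  exact Int.emod_eq_of_lt (by omega) (by omega)

/-- Predecessors live at level K, which the filling of level K+1 does not touch. So one pair of
arrays serves for reading and writing. -/
theorem Level.pre_eq (h : Level M t g c K a mark₀ val₀ mark val S) (hK : (K:ℤ) + 1 < M) {u x : ℤ}
    (hu : u % M = K + 1) (hx : M ∣ x) :
    mark (u - x - 1) = mark₀ (u - x - 1) ∧ val (u - x - 1) = val₀ (u - x - 1) :=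
  h.other _ (by rw [sub_emod_of_emod_eq_succ hK hu hx]; omega)

/-- The case of an arc that improves nothing: its source is unmarked, or its end already has a value
that is at least as good. -/
theorem Level.keep (h : Level M t g c K a mark₀ val₀ mark val S) (hK : (K:ℤ) + 1 < M) {u : ℤ} {j : ℕ}
    (hu : u % M = K + 1) (hg : M ∣ g (a + j)) (hS : S' ⊆ insert (u, j) S)
    (hkeep : 0 < mark (u - g (a + j) - 1) →
      0 < mark u ∧ val u ≤ val (u - g (a + j) - 1) + c (a + j)) :
    Level M t g c K a mark₀ val₀ mark val S' := by
  refine ⟨h.other, h.origin, fun u' j' hu' hmod hpre => ?_⟩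
  rcases hS hu' with h' | h'
  · obtain ⟨rfl, rfl⟩ := Prod.mk.inj h'
    obtain ⟨h1, h2⟩ := h.pre_eq hK hu hg
    rw [← h1] at hpre
    rw [← h2]
    exact hkeep hpre
  · exact h.relaxed u' j' h' hmod hpre

/-- The value at u only decreases, so arcs into u that were handled before stay relaxed. -/
theorem Level.update (h : Level M t g c K a mark₀ val₀ mark val S) (hK : (K:ℤ) + 1 < M) {u : ℤ}
    {j : ℕ} (hj : j < t) (hu : u % M = K + 1) (hg : M ∣ g (a + j)) (hS : S' ⊆ insert (u, j) S)
    (hpre : 0 < mark (u - g (a + j) - 1))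
    (hbetter : 0 < mark u → val (u - g (a + j) - 1) + c (a + j) < val u) :
    Level M t g c K a mark₀ val₀ (Function.update mark u (j + 1))
      (Function.update val u (val (u - g (a + j) - 1) + c (a + j))) S' := by
  obtain ⟨h1, h2⟩ := h.pre_eq hK hu hg
  refine ⟨fun u' hu' => ?_, fun u' hmod hm => ?_, fun u' j' hu' hmod hp => ?_⟩
  · have : u' ≠ u := by rintro rfl; exact hu' hu
    simpa [this] using h.other u' hu'
  · by_cases huu : u' = u
    · subst huu
      exact ⟨j, hj, by simp, h1 ▸ hpre, by simp [h2]⟩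
    · simp only [Function.update_of_ne huu] at hm ⊢
      exact h.origin u' hmod hm
  · by_cases huu : u' = u
    · subst huu
      refine ⟨by simp, ?_⟩
      simp only [Function.update_self]
      rcases hS hu' with h' | h'
      · obtain ⟨-, rfl⟩ := Prod.mk.inj h'
        rw [h2]
      · obtain ⟨h3, h4⟩ := h.relaxed u' j' h' hmod hp
        exact (hbetter h3).le.trans h4
    · simp only [Function.update_of_ne huu]
      rcases hS hu' with h' | h'
      · exact absurd (Prod.mk.inj h').1 huu
      · exact h.relaxed u' j' h' hmod hp

/-- A new mark at level K+1 points to an old state of level K. An older mark points to a level below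
its own, and neither end has changed. -/
theorem Level.traced (h : Level M t g c K (A K) mark₀ val₀ mark val S)
    (h₀ : Traced M t A g c K mark₀ val₀) (hK : (K:ℤ) + 1 < M)
    (hg : ∀ m ≤ K, ∀ j : ℕ, j < t → M ∣ g (A m + j)) :
    Traced M t A g c (K + 1) mark val := by
  intro u hm
  by_cases hu : u % M = K + 1
  · obtain ⟨j, hj, h1, h2, h3⟩ := h.origin u hu hm
    refine ⟨K + 1, le_rfl, by simpa using hu, by simp, fun m hmK => ?_⟩
    obtain rfl : m = K := by omega
    obtain ⟨h4, h5⟩ := h.pre_eq hK hu (hg m le_rfl j hj)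
    exact ⟨j, hj, h1, h4 ▸ h2, h5 ▸ h3⟩
  · obtain ⟨h1, h2⟩ := h.other u hu
    obtain ⟨k, hk, hk', hk0, hks⟩ := h₀ u (h1 ▸ hm)
    refine ⟨k, by omega, hk', fun h' => h2 ▸ hk0 h', fun m hkm => ?_⟩
    obtain ⟨j, hj, h3, h4, h5⟩ := hks m hkm
    have hpre := sub_emod_of_emod_eq_succ (K := m) (by omega) (by rw [hk', hkm]; simp)
      (hg m (by omega) j hj)
    obtain ⟨h6, h7⟩ := h.other (u - g (A m + j) - 1) (by rw [hpre]; omega)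
    exact ⟨j, hj, h1 ▸ h3, h6 ▸ h4, by rw [h2, h7, h5]⟩

/-- Induction along the path: the prefix is covered at level K, and the last arc ends in the window,
so it is among the relaxed ones. -/
theorem Level.covers {base L : ℤ → ℤ} {len : ℕ} (h : Level M t g c K (A K) mark₀ val₀ mark val S)
    (h₀ : Covers t A g c base L len K mark₀ val₀)
    (hS : ∀ idx : ℕ, idx < len → ∀ j : ℕ, j < t → (base (K + 1) + L idx, j) ∈ S)
    (hwin : ∀ idx : ℕ, idx < len → (base (K + 1) + L idx) % M = K + 1) :
    Covers t A g c base L len (K + 1) mark val := by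
  intro js hjs hpath
  obtain ⟨h1, h2⟩ := h₀ js hjs fun k hk hk' => hpath k hk (by omega)
  obtain ⟨idx, hidx, hcode⟩ := hpath (K + 1) (by omega) le_rfl
  push_cast at hcode
  have hstep : pathCode A g js (K + 1) = pathCode A g js K + (g (A K + js K) + 1) := by
    simp [pathCode, Finset.sum_range_succ]
  have hcost : pathCost A c js (K + 1) = pathCost A c js K + c (A K + js K) := by
    simp [pathCost, Finset.sum_range_succ]
  have hpre : pathCode A g js (K + 1) - g (A K + js K) - 1 = pathCode A g js K := by
    rw [hstep]; ring
  obtain ⟨h3, h4⟩ := h.relaxed (pathCode A g js (K + 1)) (js K) (hcode ▸ hS idx hidx _ (hjs K))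
    (hcode ▸ hwin idx hidx) (by rw [hpre]; exact h1)
  rw [hpre] at h4
  exact ⟨h3, by rw [hcost]; linarith⟩

end DynamicProgram

/-! ### The largest entry and the screening of the right-hand side -/

namespace NFold.Solver

open RAM

/-- The registers and arrays that hold the instance. -/
structure Instance (n r t : ℕ) (T b c : ℤ → ℤ) (s : Store) : Prop where
  n : s.reg 0 = n
  r : s.reg 1 = r
  t : s.reg 2 = t
  T : s.arr 0 = T
  b : s.arr 1 = b
  c : s.arr 2 = c

theorem Instance.of_agree {n r t : ℕ} {T b c : ℤ → ℤ} {s s' : Store} {p : Program}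
    (h : Instance n r t T b c s) (ag : Agree p s s')
    (hr : 0 ∉ p.regs ∧ 1 ∉ p.regs ∧ 2 ∉ p.regs := by decide)
    (ha : 0 ∉ p.arrs ∧ 1 ∉ p.arrs ∧ 2 ∉ p.arrs := by decide) : Instance n r t T b c s' :=
  ⟨(ag.reg 0 hr.1).trans h.n, (ag.reg 1 hr.2.1).trans h.r, (ag.reg 2 hr.2.2).trans h.t,
    (ag.arr 0 ha.1).trans h.T, (ag.arr 1 ha.2.1).trans h.b, (ag.arr 2 ha.2.2).trans h.c⟩

theorem Instance.setReg {n r t : ℕ} {T b c : ℤ → ℤ} {s : Store} (h : Instance n r t T b c s)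
    {x : ℕ} {z : ℤ} (hx : 2 < x := by decide) : Instance n r t T b c (s.setReg x z) := by
  refine ⟨?_, ?_, ?_, h.T, h.b, h.c⟩ <;> rw [Store.reg_setReg, if_neg (by omega)]
  exacts [h.n, h.r, h.t]

theorem Instance.setArr {n r t : ℕ} {T b c : ℤ → ℤ} {s : Store} (h : Instance n r t T b c s)
    {a : ℕ} {i z : ℤ} (ha : 2 < a := by decide) : Instance n r t T b c (s.setArr a i z) := by
  refine ⟨h.n, h.r, h.t, ?_, ?_, ?_⟩ <;> rw [Store.arr_setArr, if_neg (by omega)]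
  exacts [h.T, h.b, h.c]

/-- `reg 3 := max 1 |T|` -/
def findMax : Program :=
  .seq (.mul (.reg 0) (.reg 1)) <| .seq (.assign 6 (.reg 30)) <|
  .seq (.mul (.reg 6) (.reg 2)) <| .seq (.assign 6 (.reg 30)) <|
  .seq (.assign 3 (.const 1)) <|
  .forTo 20 6 <|
    .seq (.ifPos (.sub (.get 0 (.reg 20)) (.reg 3)) (.assign 3 (.get 0 (.reg 20))) .skip) <|
    .ifPos (.sub (.sub (.const 0) (.get 0 (.reg 20))) (.reg 3))
      (.assign 3 (.sub (.const 0) (.get 0 (.reg 20)))) .skip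

theorem findMax_halts {n r t : ℕ} {T b c : ℤ → ℤ} {s : Store} (h : Instance n r t T b c s) {Δ : ℕ}
    (h1 : 1 ≤ Δ) (hle : ∀ z, |T z| ≤ Δ)
    (hmin : ∀ D : ℤ, 1 ≤ D → (∀ i < n * r * t, |T (i : ℕ)| ≤ D) → Δ ≤ D) :
    Halts findMax s (12 * n + 12 * (n * r) + 50 * (n * r * t) + 60) fun s' => s'.reg 3 = Δ := by
  refine Halts.mul_then n r n (by simp [h.n]) (by simp [h.r]) (by simp) fun s₁ ag₁ h₁ => ?_
  replace h := h.of_agree ag₁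
  refine Halts.assign_then ?_
  refine Halts.mul_then (n * r) t (n * r) (by simp [h₁]) (by simp [h.t])
    (by rw [Int.natAbs_mul]; simp) fun s₂ ag₂ h₂ => ?_
  replace h := h.setReg.of_agree ag₂
  refine Halts.assign_then (Halts.assign_then ?_)
  refine Halts.forTo (n * r * t) 40
    (fun i s₁ => s₁.arr 0 = T ∧ 1 ≤ s₁.reg 3 ∧ s₁.reg 3 ≤ Δ ∧ ∀ i' < i, |T (i' : ℕ)| ≤ s₁.reg 3)
    (by simp [h₂]) (by simp [h.T, h1]) (fun i hi s₃ ag hi₃ ⟨hT, h3, h4, h5⟩ => ?_)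
    (fun s₃ ag ⟨hT, h3, h4, h5⟩ => le_antisymm h4 (hmin _ h3 h5)) (by simp only [Term.cost]; omega)
  have hTi := abs_le.1 (hle i)
  refine Halts.then (c₁ := 12) (Q₁ := fun s₄ => 1 ≤ s₄.reg 3 ∧ s₄.reg 3 ≤ Δ ∧
    s₃.reg 3 ≤ s₄.reg 3 ∧ T i ≤ s₄.reg 3) ?_ ?_
  · refine Halts.ite (fun hp => Halts.assign ?_) (fun hp => Halts.skip ?_)
    · simp [hi₃, hT] at hp ⊢; omega
    · simp [hi₃, hT] at hp ⊢; omega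
  · rintro s₄ ag₄ ⟨h6, h7, h8, h9⟩
    have hT' : s₄.arr 0 = T := (ag₄.arr 0 (by decide)).trans hT
    have hi₄ : s₄.reg 20 = i := (ag₄.reg 20 (by decide)).trans hi₃
    have key : ∀ D : ℤ, s₄.reg 3 ≤ D → -D ≤ T i → ∀ i' < i + 1, |T (i' : ℕ)| ≤ D := by
      intro D hD hD' i' hi'
      rcases Nat.lt_succ_iff_lt_or_eq.1 hi' with hi' | rfl
      · exact (h5 i' hi').trans (by omega)
      · exact abs_le.2 ⟨hD', by omega⟩
    refine Halts.ite (fun hp => Halts.assign ?_) (fun hp => Halts.skip ?_)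
    · simp [hi₄, hT', -Order.lt_add_one_iff] at hp ⊢
      exact ⟨by omega, by omega, key _ (by omega) (by omega)⟩
    · simp [hi₄, hT', -Order.lt_add_one_iff] at hp ⊢
      exact ⟨by omega, by omega, key _ (by omega) (by omega)⟩

/-- `reg 4` becomes the sum of the local right-hand sides, `reg 13` the product of `reg 3` and
`reg 4`, and `reg 5` becomes positive if a local right-hand side is negative or the absolute
value of an upper one exceeds `reg 13`. -/
def checkRhs : Program :=
  .seq (.assign 4 (.const 0)) <| .seq (.assign 5 (.const 0)) <|
  .seq (.forTo 20 0 <|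
    .seq (.assign 4 (.add (.reg 4) (.get 1 (.add (.reg 1) (.reg 20))))) <|
    .ifPos (.sub (.const 0) (.get 1 (.add (.reg 1) (.reg 20)))) (.assign 5 (.const 1)) .skip) <|
  .seq (.mul (.reg 3) (.reg 4)) <| .seq (.assign 13 (.reg 30)) <|
  .forTo 21 1 <|
    .seq (.ifPos (.sub (.get 1 (.reg 21)) (.reg 13)) (.assign 5 (.const 1)) .skip) <|
    .ifPos (.sub (.sub (.const 0) (.get 1 (.reg 21))) (.reg 13)) (.assign 5 (.const 1)) .skip

theorem checkRhs_halts {n r t : ℕ} {T b c : ℤ → ℤ} {s : Store} (h : Instance n r t T b c s) {Δ : ℕ}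
    (hΔ : s.reg 3 = Δ) :
    Halts checkRhs s (40 * n + 12 * Δ + 60 * r + 60) fun s' =>
      s'.reg 4 = ∑ i ∈ Finset.range n, b (r + i) ∧ s'.reg 13 = Δ * s'.reg 4 ∧
      (0 < s'.reg 5 ↔ (∃ i < n, b (r + (i : ℕ)) < 0) ∨
        ∃ l < r, s'.reg 13 < |b (l : ℕ)|) := by
  refine Halts.assign_then (Halts.assign_then ?_)
  refine Halts.then (c₁ := 40 * n + 6) (Q₁ := fun s₁ =>
    s₁.reg 4 = ∑ i ∈ Finset.range n, b (r + i) ∧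
      (0 < s₁.reg 5 ↔ ∃ i < n, b (r + (i : ℕ)) < 0)) ?_ ?_
  · refine Halts.forTo n 32
      (fun i s₁ => s₁.reg 4 = ∑ i ∈ Finset.range i, b (r + i) ∧
        (0 < s₁.reg 5 ↔ ∃ i' < i, b (r + (i' : ℕ)) < 0)) (by simp [h.n]) (by simp)
      (fun i hi s₁ ag hi₁ ⟨h1, h2⟩ => ?_) (fun _ _ h => h) (by omega)
    replace h : Instance n r t T b c s₁ := h.setReg.setReg.of_agree ag
    refine Halts.assign_then (Halts.ite (fun hp => Halts.assign ?_) (fun hp => Halts.skip ?_))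
    · simp [h.b, h.r, hi₁] at hp ⊢
      exact ⟨by rw [h1, Finset.sum_range_succ], i, by omega, hp⟩
    · simp [h.b, h.r, hi₁, -Order.lt_add_one_iff] at hp ⊢
      refine ⟨by rw [h1, Finset.sum_range_succ], h2.trans ⟨?_, ?_⟩⟩
      · rintro ⟨i', hi', h'⟩; exact ⟨i', by omega, h'⟩
      · rintro ⟨i', hi', h'⟩
        refine ⟨i', ?_, h'⟩
        rcases Nat.lt_succ_iff_lt_or_eq.1 hi' with hi' | rfl
        · exact hi'
        · omega
  · rintro s₁ ag₁ ⟨h4, h5⟩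
    replace h : Instance n r t T b c s₁ := h.setReg.setReg.of_agree ag₁
    -- Δ drives the repeated addition, because at this point the sum in register 4 may still be
    -- negative or of uncontrolled size.
    refine Halts.mul_then Δ (s₁.reg 4) Δ ?_ (by simp) (by simp) fun s₂ ag₂ h₂ => ?_
    · simpa [hΔ] using ag₁.reg 3 (by decide)
    replace h := h.of_agree ag₂
    refine Halts.assign_then ?_
    have h4' := ag₂.reg 4 (by decide)
    have h5' := ag₂.reg 5 (by decide)
    rw [← h4'] at h4 h₂
    rw [← h5'] at h5
    refine Halts.forTo r 36
      (fun l s₃ => s₃.reg 4 = s₂.reg 4 ∧ s₃.reg 13 = Δ * s₂.reg 4 ∧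
        (0 < s₃.reg 5 ↔ (∃ i < n, b (r + (i : ℕ)) < 0) ∨
        ∃ l' < l, Δ * s₂.reg 4 < |b (l' : ℕ)|)) (by simp [h.r]) (by simp [h₂, h5])
      (fun l hl s₃ ag hl₃ ⟨h6, h7, h8⟩ => ?_) (fun s₃ _ ⟨h6, h7, h8⟩ => ?_)
      (by simp only [Term.cost]; omega)
    · replace h : Instance n r t T b c s₃ := h.setReg.of_agree ag
      have key : ∀ z : ℤ, (0 < z ↔ 0 < s₃.reg 5 ∨ Δ * s₂.reg 4 < |b l|) → (0 < z ↔
          (∃ i < n, b (r + (i : ℕ)) < 0) ∨ ∃ l' < l + 1, Δ * s₂.reg 4 < |b (l' : ℕ)|) := by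
        intro z hz
        rw [hz, h8, or_assoc]
        refine or_congr_right ⟨?_, ?_⟩
        · rintro (⟨l', hl', h'⟩ | h')
          exacts [⟨l', by omega, h'⟩, ⟨l, by omega, h'⟩]
        · rintro ⟨l', hl', h'⟩
          rcases Nat.lt_succ_iff_lt_or_eq.1 hl' with hl' | rfl
          exacts [Or.inl ⟨l', hl', h'⟩, Or.inr h']
      refine Halts.then (c₁ := 12) (Q₁ := fun s₄ => s₄.reg 4 = s₂.reg 4 ∧ s₄.reg 13 = Δ * s₂.reg 4
        ∧ (0 < s₄.reg 5 ↔ 0 < s₃.reg 5 ∨ Δ * s₂.reg 4 < b l)) ?_ ?_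
      · refine Halts.ite (fun hp => Halts.assign ?_) (fun hp => Halts.skip ?_)
        · simp [h.b, hl₃, h7] at hp ⊢
          exact ⟨h6, Or.inr hp⟩
        · simp [h.b, hl₃, h7] at hp ⊢
          exact ⟨h6, fun h' => absurd h' (by omega)⟩
      · rintro s₄ ag₄ ⟨h9, h10, h11⟩
        replace h := h.of_agree ag₄
        have hl₄ : s₄.reg 21 = l := (ag₄.reg 21 (by decide)).trans hl₃
        refine Halts.ite (fun hp => Halts.assign ?_) (fun hp => Halts.skip ?_)
        · simp only [Term.value, h.b, hl₄, h10] at hp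
          refine ⟨by simpa using h9, by simpa using h10, key _ ?_⟩
          simp [lt_abs]
          right; right; omega
        · simp only [Term.value, h.b, hl₄, h10] at hp
          refine ⟨by simpa using h9, by simpa using h10, key _ ?_⟩
          simp only [Store.reg_setReg]
          rw [if_neg (by decide), h11, lt_abs]
          constructor
          · rintro (h' | h')
            exacts [Or.inl h', Or.inr (Or.inl h')]
          · rintro (h' | h' | h')
            exacts [Or.inl h', Or.inr h', by omega]
    · rw [h6, h7]
      exact ⟨h4, rfl, h8⟩

end NFold.Solver

/-! ### Radix, target code and column codes -/

namespace NFold.Solver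

open RAM

/-- The window radius goes to `reg 7`, the window width to `reg 8`, the radix `M` to `reg 9`, the
powers of the radix to array 4, their sum to `reg 15`, and the code of the target to `reg 12`. -/
def setRadix : Program :=
  .seq (.mul (.reg 0) (.add (.reg 1) (.const 1))) <|
  .seq (.mul (.reg 3) (.sub (.reg 30) (.const 1))) <|
  .seq (.assign 7 (.add (.reg 30) (.reg 30))) <|
  .seq (.assign 8 (.add (.add (.reg 7) (.reg 7)) (.const 1))) <|
  .seq (.assign 9 (.add (.add (.reg 13) (.reg 13)) (.const 1))) <|
  .seq (.assign 14 (.reg 9)) <| .seq (.assign 15 (.const 0)) <| .seq (.assign 12 (.reg 4)) <|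
  .forTo 21 1 <|
    .seq (.store 4 (.reg 21) (.reg 14)) <|
    .seq (.assign 15 (.add (.reg 15) (.reg 14))) <|
    .seq (.mul (.get 1 (.reg 21)) (.reg 14)) <|
    .seq (.assign 12 (.add (.reg 12) (.reg 30))) <|
    .seq (.mul (.reg 9) (.reg 14)) <|
    .assign 14 (.reg 30)

theorem setRadix_halts {n r t : ℕ} {T b c : ℤ → ℤ} {s : Store} (h : Instance n r t T b c s)
    {Δ q : ℕ} (hΔ : s.reg 3 = Δ) (hq : s.reg 4 = q) (hΔq : s.reg 13 = Δ * q)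
    (hb : ∀ l < r, |b (l : ℕ)| ≤ Δ * q) {M : ℤ} (hM : M = 2 * Δ * q + 1) :
    Halts setRadix s (12 * n + 12 * Δ + 36 * (r * (Δ * q)) + 120 * r + 120) fun s' =>
      s'.reg 7 = 2 * Δ * (n * (r + 1) - 1) ∧ s'.reg 8 = 2 * s'.reg 7 + 1 ∧ s'.reg 9 = M ∧
      s'.reg 15 = ∑ l ∈ Finset.range r, M ^ (l + 1) ∧
      s'.reg 12 = q + ∑ l ∈ Finset.range r, b l * M ^ (l + 1) ∧
      ∀ l < r, s'.arr 4 (l : ℕ) = M ^ (l + 1) := by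
  refine Halts.mul_then n (r + 1) n (by simp [h.n]) (by simp [h.r]) (by simp) fun s₁ ag₁ h₁ => ?_
  replace h := h.of_agree ag₁
  refine Halts.mul_then Δ (n * (r + 1) - 1) Δ (by simpa [hΔ] using ag₁.reg 3 (by decide))
    (by simp [h₁]) (by simp) fun s₂ ag₂ h₂ => ?_
  replace h := h.of_agree ag₂
  have hq₂ : s₂.reg 4 = q := (ag₂.reg 4 (by decide)).trans ((ag₁.reg 4 (by decide)).trans hq)
  have h13 : s₂.reg 13 = Δ * q :=
    (ag₂.reg 13 (by decide)).trans ((ag₁.reg 13 (by decide)).trans hΔq)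
  refine Halts.assign_then (Halts.assign_then (Halts.assign_then (Halts.assign_then
    (Halts.assign_then (Halts.assign_then ?_)))))
  refine Halts.forTo r (36 * (Δ * q) + 90)
    (fun i s₁ => s₁.reg 14 = M ^ (i + 1) ∧ s₁.reg 15 = ∑ l ∈ Finset.range i, M ^ (l + 1) ∧
      s₁.reg 12 = q + ∑ l ∈ Finset.range i, b l * M ^ (l + 1) ∧
      ∀ l < i, s₁.arr 4 (l : ℕ) = M ^ (l + 1))
    (by simp [h.r]) ?_
    (fun i hi s₃ ag hi₃ ⟨h3, h4, h5, h6⟩ => ?_)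
    (fun s₃ ag ⟨h3, h4, h5, h6⟩ => ⟨?_, ?_, ?_, h4, h5, h6⟩) (by
      simp only [Term.cost, mul_add, ← mul_assoc]
      have : r * 36 * Δ * q = 36 * r * Δ * q := by ring
      omega)
  · simp [h13, hq₂, hM]; ring
  · have hT : Instance n r t T b c s₃ :=
      h.setReg.setReg.setReg.setReg.setReg.setReg.of_agree ag
    have h9 : s₃.reg 9 = M := by
      rw [ag.reg 9 (by decide), hM]; simp [h13]; ring
    refine Halts.store_then (Halts.assign_then ?_)
    -- The screening bounds |b i| by Δq. This product and the next one, driven by M = 2Δq+1, thus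
    -- cost a number of steps linear in Δq and independent of the power of M.
    refine Halts.mul_then (b i) (M ^ (i + 1)) (Δ * q) (by simp [hT.b, hi₃]) (by simp [h3])
      (by have := hb i hi; zify; exact this) fun s₄ ag₄ h₄ => ?_
    refine Halts.assign_then ?_
    refine Halts.mul_then M (M ^ (i + 1)) (2 * (Δ * q) + 1) ?_ ?_
      (by rw [hM]; zify; rw [abs_of_nonneg (by positivity)]; apply le_of_eq; ring)
      fun s₅ ag₅ h₅ => ?_
    · simpa [h9] using ag₄.reg 9 (by decide)
    · simpa [h3] using ag₄.reg 14 (by decide)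
    refine Halts.assign ?_
    have e15 := (ag₅.reg 15 (by decide)).trans ((Store.reg_setReg _ _ _ _).trans
      (ag₄.reg 15 (by decide)))
    have e12 := ag₅.reg 12 (by decide)
    have e12' := ag₄.reg 12 (by decide)
    have e4 := (ag₅.arr 4 (by decide)).trans (ag₄.arr 4 (by decide))
    simp at e15 e12 e12' e4 ⊢
    refine ⟨by rw [h₅]; ring, by rw [e15, h4, h3, Finset.sum_range_succ], ?_, ?_⟩
    · rw [e12, e12', h5, h₄, Finset.sum_range_succ]; ring
    · intro l hl
      rw [e4, hi₃]
      by_cases hli : l = i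
      · subst hli; simp [h3]
      · rw [Function.update_of_ne (by exact_mod_cast hli)]
        exact h6 l (by omega)
  · rw [ag.reg 7 (by decide)]; simp [h₂]; ring
  · rw [ag.reg 7 (by decide), ag.reg 8 (by decide)]; simp [h₂]; ring
  · rw [ag.reg 9 (by decide)]; simp [h13, hM]; ring

/-- The codes of the columns go to array 5. -/
def setColumns : Program :=
  .seq (.mul (.reg 1) (.reg 2)) <| .seq (.assign 16 (.reg 30)) <|
  .seq (.assign 25 (.const 0)) <| .seq (.assign 26 (.const 0)) <|
  .forTo 20 0 <|
    .seq (.forTo 22 2 <|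
      .seq (.assign 27 (.add (.reg 26) (.reg 22))) <| .seq (.assign 28 (.const 0)) <|
      .seq (.forTo 21 1 <|
        .seq (.mul (.get 0 (.reg 27)) (.get 4 (.reg 21))) <|
        .seq (.assign 28 (.add (.reg 28) (.reg 30))) <|
        .assign 27 (.add (.reg 27) (.reg 2))) <|
      .seq (.store 5 (.reg 25) (.reg 28)) <|
      .assign 25 (.add (.reg 25) (.const 1))) <|
    .assign 26 (.add (.reg 26) (.reg 16))

theorem setColumns_halts {n r t : ℕ} {T b c : ℤ → ℤ} {s : Store} (h : Instance n r t T b c s)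
    {Δ : ℕ} {M : ℤ} (hT : ∀ z, |T z| ≤ Δ) (hP : ∀ l < r, s.arr 4 (l : ℕ) = M ^ (l + 1)) :
    Halts setColumns s (12 * r + n * (t * (r * (12 * Δ + 50) + 50) + 50) + 50) fun s' =>
      ∀ i < n, ∀ j < t, s'.arr 5 ((i : ℕ) * t + (j : ℕ))
        = ∑ l ∈ Finset.range r, T ((i * r + l) * t + j) * M ^ (l + 1) := by
  refine Halts.mul_then r t r (by simp [h.r]) (by simp [h.t]) (by simp) fun s₁ ag₁ h₁ => ?_
  replace h := h.of_agree ag₁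
  replace hP : ∀ l < r, s₁.arr 4 (l : ℕ) = M ^ (l + 1) := by rwa [ag₁.arr 4 (by decide)]
  refine Halts.assign_then (Halts.assign_then (Halts.assign_then ?_))
  refine Halts.forTo n (t * (r * (12 * Δ + 50) + 50) + 20)
    (fun i s₂ => s₂.reg 25 = i * t ∧ s₂.reg 26 = i * (r * t) ∧ ∀ i' < n, ∀ j < t, i' * t + j < i * t →
      s₂.arr 5 ((i' : ℕ) * t + (j : ℕ))
        = ∑ l ∈ Finset.range r, T ((i' * r + l) * t + j) * M ^ (l + 1))
    (by simp [h.n]) (by simp) (fun i hi s₂ ag₂ hi₂ ⟨h25, h26, h5⟩ => ?_)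
    (fun s₂ ag ⟨h25, h26, h5⟩ i hi j hj => h5 i hi j hj (by nlinarith)) ?_
  · replace h : Instance n r t T b c s₂ := h.setReg.setReg.setReg.of_agree ag₂
    replace hP : ∀ l < r, s₂.arr 4 (l : ℕ) = M ^ (l + 1) := by
      rw [ag₂.arr 4 (by decide)]; simpa using hP
    have h16 : s₂.reg 16 = r * t := by rw [ag₂.reg 16 (by decide)]; simp [h₁]
    refine Halts.then (c₁ := t * (r * (12 * Δ + 50) + 50) + 6) (Q₁ := fun s₃ =>
      s₃.reg 25 = i * t + t ∧ ∀ i' < n, ∀ j < t, i' * t + j < i * t + t →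
      s₃.arr 5 ((i' : ℕ) * t + (j : ℕ))
        = ∑ l ∈ Finset.range r, T ((i' * r + l) * t + j) * M ^ (l + 1)) ?_ ?_
    · refine Halts.forTo t (r * (12 * Δ + 50) + 40)
        (fun j s₃ => s₃.reg 25 = i * t + j ∧ ∀ i' < n, ∀ j' < t, i' * t + j' < i * t + j →
          s₃.arr 5 ((i' : ℕ) * t + (j' : ℕ))
            = ∑ l ∈ Finset.range r, T ((i' * r + l) * t + j') * M ^ (l + 1))
        h.t (by simpa [h25] using h5) (fun j hj s₃ ag₃ hj₃ ⟨h25', h5'⟩ => ?_)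
        (fun _ _ h => h) ?_
      · replace h := h.of_agree ag₃
        replace hP : ∀ l < r, s₃.arr 4 (l : ℕ) = M ^ (l + 1) := by
          rwa [ag₃.arr 4 (by decide)]
        replace h26 := (ag₃.reg 26 (by decide)).trans h26
        refine Halts.assign_then (Halts.assign_then ?_)
        refine Halts.then (c₁ := r * (12 * Δ + 50) + 6) (Q₁ := fun s₄ =>
          s₄.reg 28 = ∑ l ∈ Finset.range r, T ((i * r + l) * t + j) * M ^ (l + 1)) ?_ ?_
        · refine Halts.forTo r (12 * Δ + 40)
            (fun l s₄ => s₄.reg 28 = ∑ l ∈ Finset.range l, T ((i * r + l) * t + j) * M ^ (l + 1) ∧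
              s₄.reg 27 = (i * r + l) * t + j) (by simp [h.r])
            (by simp [h26, hj₃]; ring) (fun l hl s₄ ag₄ hl₄ ⟨h28, h27⟩ => ?_)
            (fun _ _ h => h.1) (by ring_nf; omega)
          replace h : Instance n r t T b c s₄ := h.setReg.setReg.of_agree ag₄
          replace hP : ∀ l < r, s₄.arr 4 (l : ℕ) = M ^ (l + 1) := by
            rw [ag₄.arr 4 (by decide)]; simpa using hP
          refine Halts.mul_then (T ((i * r + l) * t + j)) (M ^ (l + 1)) Δ (by simp [h27, h.T])
            (by simp [hl₄, hP l hl]) (by have := hT ((i * r + l) * t + j); zify; exact this)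
            fun s₅ ag₅ h₅ => ?_
          refine Halts.assign_then (Halts.assign ?_)
          have e28 := ag₅.reg 28 (by decide)
          have e27 := ag₅.reg 27 (by decide)
          have e2 := ag₅.reg 2 (by decide)
          simp [e28, e27, e2, h.t, h27, h28, h₅, Finset.sum_range_succ]
          ring
        · intro s₄ ag₄ h28
          refine Halts.store_then (Halts.assign ?_)
          have e25 := ag₄.reg 25 (by decide)
          have e5 := ag₄.arr 5 (by decide)
          simp at e25 e5
          simp [e25, e5, h25', h28, -Order.lt_add_one_iff]
          refine ⟨by ring, fun i' hi' j' hj' hlt => ?_⟩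
          -- Cells filled earlier survive, since a position determines brick and column.
          by_cases heq : i' * t + j' = i * t + j
          · have hii : i' = i := by
              have := congrArg (· / t) heq
              simpa [Nat.add_div_of_dvd_right, Nat.mul_add_div, mul_comm,
                Nat.mul_div_cancel_left, Nat.div_eq_of_lt, hj, hj', (show 0 < t by omega)] using this
            subst hii
            have hjj : j' = j := by omega
            subst hjj
            simp
          · rw [Function.update_of_ne (by exact_mod_cast heq)]
            exact h5' i' hi' j' hj' (by omega)
      · ring_nf; omega
    · rintro s₃ ag₃ ⟨h25', h5'⟩
      refine Halts.assign ?_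
      have e26 := ag₃.reg 26 (by decide)
      have e16 := ag₃.reg 16 (by decide)
      simp [e26, e16, h25', h16, h26]
      refine ⟨by ring, by ring, fun i' hi' j hj hlt => h5' i' hi' j hj (by linarith)⟩
  · simp only [Term.cost]
    have : n * (t * (r * (12 * Δ + 50) + 50) + 20 + 8) + 22 * n
      = n * (t * (r * (12 * Δ + 50) + 50) + 50) := by ring
    omega

end NFold.Solver

/-! ### Enumeration of the window -/

namespace NFold.Solver

open RAM

/-- The codes of the vectors of a box around the origin go to array 6, their number to `reg 10`. -/
def setWindow : Program :=
  .seq (.mul (.reg 7) (.reg 15)) <|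
  .seq (.store 6 (.const 0) (.sub (.const 0) (.reg 30))) <|
  .seq (.assign 10 (.const 1)) <|
  .forTo 21 1 <|
    .seq (.mul (.reg 8) (.reg 10)) <| .seq (.assign 34 (.reg 30)) <| .seq (.assign 33 (.reg 10)) <|
    .whilePos (.sub (.reg 34) (.reg 10)) <|
      .seq (.store 6 (.reg 10) (.add (.get 6 (.sub (.reg 10) (.reg 33))) (.get 4 (.reg 21)))) <|
      .assign 10 (.add (.reg 10) (.const 1))

/-- The list starts with the corner whose coordinates are all -ρ, and each coordinate extends it
w-fold: a new entry is the one w^l places earlier plus M^(l+1). Only that every box point occurs is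
recorded; repeated codes would do no harm. -/
theorem setWindow_halts {n r t : ℕ} {T b c : ℤ → ℤ} {s : Store} (h : Instance n r t T b c s)
    {ρ w : ℕ} {M : ℤ} (hρ : s.reg 7 = ρ) (hw : s.reg 8 = w)
    (h15 : s.reg 15 = ∑ l ∈ Finset.range r, M ^ (l + 1)) (hw2 : r = 0 ∨ 2 ≤ w)
    (hP : ∀ l < r, s.arr 4 (l : ℕ) = M ^ (l + 1)) :
    Halts setWindow s (12 * ρ + 240 * w ^ r + 60) fun s' =>
      s'.reg 10 = (w ^ r : ℕ) ∧ (∀ idx < w ^ r, M ∣ s'.arr 6 (idx : ℕ)) ∧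
      ∀ a : ℕ → ℕ, (∀ l < r, a l < w) → ∃ idx : ℕ, idx < w ^ r ∧
        s'.arr 6 idx = ∑ l ∈ Finset.range r, ((a l : ℤ) - ρ) * M ^ (l + 1) := by
  refine Halts.mul_then ρ (∑ l ∈ Finset.range r, M ^ (l + 1)) ρ (by simpa using hρ)
    (by simpa using h15) (by simp) fun s₁ ag₁ h₁ => ?_
  replace h := h.of_agree ag₁
  replace hP : ∀ l < r, s₁.arr 4 (l : ℕ) = M ^ (l + 1) := by rwa [ag₁.arr 4 (by decide)]
  replace hw := (ag₁.reg 8 (by decide)).trans hw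
  refine Halts.store_then (Halts.assign_then ?_)
  set B : ℤ := -(ρ * ∑ l ∈ Finset.range r, M ^ (l + 1)) with hB
  -- The coordinate costs grow geometrically because w ≥ 2, so the last one dominates.
  have hsum : ∑ l ∈ Finset.range r, (12 * w + 20 * w ^ (l + 1) + 50 + 8) ≤ 200 * w ^ r := by
    rcases hw2 with rfl | hw2
    · simp
    · have h1 : ∀ r : ℕ, ∑ l ∈ Finset.range r, w ^ (l + 1) ≤ 2 * w ^ r := by
        intro r
        induction r with
        | zero => simp
        | succ r ih =>
          rw [Finset.sum_range_succ, pow_succ]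
          nlinarith [Nat.mul_le_mul_left (w ^ r) hw2]
      calc _ ≤ ∑ l ∈ Finset.range r, 100 * w ^ (l + 1) := Finset.sum_le_sum fun l _ => by
            have h2 : w * 1 ≤ w ^ (l + 1) := by
              rw [pow_succ']; exact Nat.mul_le_mul_left _ (Nat.one_le_pow _ _ (by omega))
            omega
        _ ≤ _ := by rw [← Finset.mul_sum]; linarith [h1 r]
  refine Halts.forTo_sum (by decide) (by decide) (by decide) r
    (fun l => 12 * w + 20 * w ^ (l + 1) + 50)
    (fun l s₁ => s₁.reg 10 = (w ^ l : ℕ) ∧ (∀ idx < w ^ l, M ∣ s₁.arr 6 (idx : ℕ)) ∧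
      ∀ a : ℕ → ℕ, (∀ l' < l, a l' < w) → ∃ idx : ℕ, idx < w ^ l ∧
        s₁.arr 6 idx = B + ∑ l' ∈ Finset.range l, a l' * M ^ (l' + 1))
    (by simp [h.r]) ?_ (fun l hl s₂ ag₂ hl₂ ⟨h10, hd, hc⟩ => ?_)
    (fun s₂ ag ⟨h10, hd, hc⟩ => ⟨h10, hd, fun a ha => ?_⟩) (by simp only [Term.cost]; omega)
  · have : s₁.reg 30 = -B := by rw [h₁, hB, neg_neg]
    simp [this]
    rw [hB, dvd_neg]
    exact Dvd.dvd.mul_left (Finset.dvd_sum fun l _ => dvd_pow_self M (by omega)) _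
  · replace h : Instance n r t T b c s₂ := h.setArr.setReg.of_agree ag₂
    replace hP : s₂.arr 4 l = M ^ (l + 1) := by
      rw [ag₂.arr 4 (by decide)]; simpa using hP l hl
    replace hw : s₂.reg 8 = w := by rw [ag₂.reg 8 (by decide)]; simpa using hw
    refine Halts.mul_then w (w ^ l : ℕ) w (by simpa using hw) (by simpa using h10) (by simp)
      fun s₃ ag₃ h₃ => ?_
    refine Halts.assign_then (Halts.assign_then ?_)
    have hwl : w * w ^ l = w ^ (l + 1) := (pow_succ' w l).symm
    have hwpos : 1 ≤ w := by omega
    have hcur : 0 < w ^ l := Nat.pow_pos hwpos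
    have hcur' : w ^ l ≤ w ^ (l + 1) := Nat.pow_le_pow_right hwpos (by omega)
    have e10 := (ag₃.reg 10 (by decide)).trans h10
    have e6 := ag₃.arr 6 (by decide)
    have e4 := ag₃.arr 4 (by decide)
    have e21 := (ag₃.reg 21 (by decide)).trans hl₂
    have h₃' : s₃.reg 30 = (w ^ (l + 1) : ℕ) := by rw [h₃, ← hwl]; push_cast; ring
    refine Halts.whilePos 16 (fun m s₄ => ∃ p, p + m = w ^ (l + 1) ∧ w ^ l ≤ p ∧ s₄.reg 10 = p ∧
        s₄.reg 33 = (w ^ l : ℕ) ∧ s₄.reg 34 = (w ^ (l + 1) : ℕ) ∧ s₄.reg 21 = l ∧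
        s₄.arr 4 l = M ^ (l + 1) ∧ (∀ idx < w ^ l, s₄.arr 6 (idx : ℕ) = s₂.arr 6 (idx : ℕ)) ∧
        ∀ idx < p, w ^ l ≤ idx → s₄.arr 6 (idx : ℕ) = s₄.arr 6 (idx - (w ^ l : ℕ)) + M ^ (l + 1))
      (N := w ^ (l + 1) - w ^ l) ?_ ?_ ?_ (by simp only [Term.cost]; omega)
    · refine ⟨w ^ l, by omega, le_rfl, by simpa using e10, by simpa using e10, by simpa using h₃',
        by simpa using e21, by simp [e4, hP], by simp [e6], fun idx h1 h2 => by omega⟩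
    · rintro m s₄ ⟨p, hp1, hp2, h10', h33, h34, h21, h4, h6, h7⟩
      refine ⟨by simp only [Term.value, h34, h10']; omega, Halts.store_then (Halts.assign ?_)⟩
      refine ⟨p + 1, by omega, by omega, by simpa using h10', by simpa using h33,
        by simpa using h34, by simpa using h21, by simpa using h4, fun idx hidx => ?_,
        fun idx hidx hidx' => ?_⟩
      · simp [h10']
        rw [Function.update_of_ne (by have : idx ≠ p := by omega
                                      exact_mod_cast this)]
        exact h6 idx hidx
      -- The cell that is copied lies strictly before the write position p, so the write does not
      -- affect it.
      · have hne : ((idx : ℕ) : ℤ) - (w ^ l : ℕ) ≠ p := by omega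
        simp only [Store.arr_setReg, Store.arr_setArr, if_true, Term.value, h10', h33, h21, h4]
        rw [Function.update_of_ne hne]
        by_cases hip : idx = p
        · subst hip
          rw [Function.update_self]
        · rw [Function.update_of_ne (by exact_mod_cast hip)]
          exact h7 idx (by omega) hidx'
    · rintro s₄ ⟨p, hp1, hp2, h10', h33, h34, h21, h4, h6, h7⟩
      obtain rfl : p = w ^ (l + 1) := by omega
      refine ⟨by simp [h34, h10'], ?_⟩
      have key : ∀ a i₀ : ℕ, i₀ < w ^ l → i₀ + a * w ^ l < w ^ (l + 1) →
          s₄.arr 6 (i₀ + a * w ^ l : ℕ) = s₂.arr 6 i₀ + a * M ^ (l + 1) := by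
        intro a i₀ hi₀ hlt
        induction a with
        | zero => simpa using h6 i₀ hi₀
        | succ a ih =>
          have e : i₀ + (a + 1) * w ^ l = (i₀ + a * w ^ l) + w ^ l := by ring
          rw [h7 _ hlt (by rw [e]; omega)]
          have e' : ((i₀ + (a + 1) * w ^ l : ℕ) : ℤ) - (w ^ l : ℕ) = (i₀ + a * w ^ l : ℕ) := by
            push_cast; ring
          rw [e', ih (by rw [e] at hlt; omega)]
          push_cast; ring
      refine ⟨by simpa using h10', fun idx hidx => ?_, fun a ha => ?_⟩
      · have e : idx = idx % w ^ l + idx / w ^ l * w ^ l := by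
          rw [mul_comm]; exact (Nat.mod_add_div _ _).symm
        simp only [Store.arr_setReg]
        rw [e, key _ _ (Nat.mod_lt _ hcur) (by rwa [← e])]
        exact dvd_add (hd _ (Nat.mod_lt _ hcur))
          (Dvd.dvd.mul_left (dvd_pow_self M (by omega)) _)
      · obtain ⟨i₀, hi₀, hi₀'⟩ := hc a fun l' hl' => ha l' (by omega)
        have hal := ha l (by omega)
        have hlt : i₀ + a l * w ^ l < w ^ (l + 1) := by
          calc i₀ + a l * w ^ l < w ^ l + a l * w ^ l := by omega
            _ = (a l + 1) * w ^ l := by ring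
            _ ≤ w * w ^ l := Nat.mul_le_mul_right _ hal
            _ = _ := hwl
        refine ⟨_, hlt, ?_⟩
        simp only [Store.arr_setReg]
        rw [key _ _ hi₀ hlt, hi₀', Finset.sum_range_succ]
        ring
  · obtain ⟨idx, hidx, hidx'⟩ := hc a ha
    refine ⟨idx, hidx, ?_⟩
    rw [hidx', hB, Finset.mul_sum, ← Finset.sum_neg_distrib, ← Finset.sum_add_distrib]
    exact Finset.sum_congr rfl fun l _ => by ring

end NFold.Solver

/-! ### One level of the dynamic program -/

namespace NFold.Solver

open RAM

/-- The registers and arrays that the dynamic program reads. -/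
structure Ready (n r t : ℕ) (T b c : ℤ → ℤ) (q len : ℕ) (P G L : ℤ → ℤ) (s : Store) : Prop
    extends Instance n r t T b c s where
  q : s.reg 4 = q
  len : s.reg 10 = len
  P : s.arr 4 = P
  G : s.arr 5 = G
  L : s.arr 6 = L

section Ready

variable {n r t : ℕ} {T b c : ℤ → ℤ} {q len : ℕ} {P G L : ℤ → ℤ} {s s' : Store}

theorem Ready.of_agree {p : Program} (h : Ready n r t T b c q len P G L s) (ag : Agree p s s')
    (hr : 0 ∉ p.regs ∧ 1 ∉ p.regs ∧ 2 ∉ p.regs := by decide)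
    (ha : 0 ∉ p.arrs ∧ 1 ∉ p.arrs ∧ 2 ∉ p.arrs := by decide)
    (hr' : 4 ∉ p.regs ∧ 10 ∉ p.regs := by decide)
    (ha' : 4 ∉ p.arrs ∧ 5 ∉ p.arrs ∧ 6 ∉ p.arrs := by decide) :
    Ready n r t T b c q len P G L s' :=
  ⟨h.toInstance.of_agree ag hr ha, (ag.reg 4 hr'.1).trans h.q, (ag.reg 10 hr'.2).trans h.len,
    (ag.arr 4 ha'.1).trans h.P, (ag.arr 5 ha'.2.1).trans h.G, (ag.arr 6 ha'.2.2).trans h.L⟩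

theorem Ready.setReg (h : Ready n r t T b c q len P G L s) {x : ℕ} {z : ℤ}
    (hx : 2 < x ∧ x ≠ 4 ∧ x ≠ 10 := by decide) : Ready n r t T b c q len P G L (s.setReg x z) := by
  refine ⟨h.toInstance.setReg hx.1, ?_, ?_, h.P, h.G, h.L⟩ <;>
    rw [Store.reg_setReg, if_neg (by omega)]
  exacts [h.q, h.len]

theorem Ready.setArr (h : Ready n r t T b c q len P G L s) {a : ℕ} {i z : ℤ}
    (ha : 6 < a := by decide) : Ready n r t T b c q len P G L (s.setArr a i z) := by
  refine ⟨h.toInstance.setArr (by omega), h.q, h.len, ?_, ?_, ?_⟩ <;>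
    rw [Store.arr_setArr, if_neg (by omega)]
  exacts [h.P, h.G, h.L]

/-- The deficits in array 9 grow by the quotas, a brick with positive deficit is chosen, and
its offset goes to `reg 36` and to the schedule in array 10. -/
def pickBrick : Program :=
  .seq (.assign 26 (.const 0)) <|
  .seq (.forTo 20 0 <|
    .seq (.store 9 (.reg 20) (.add (.get 9 (.reg 20)) (.get 1 (.add (.reg 1) (.reg 20))))) <|
    .seq (.ifPos (.get 9 (.reg 20))
      (.seq (.assign 27 (.reg 20)) (.assign 36 (.reg 26))) .skip) <|
    .assign 26 (.add (.reg 26) (.reg 2))) <|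
  .seq (.store 9 (.reg 27) (.sub (.get 9 (.reg 27)) (.reg 4))) <|
  .store 10 (.reg 23) (.reg 36)

/-- The deficit of brick i after k steps is k·b_i - q·occ_i. Charging q only to a brick whose grown
deficit is positive keeps that deficit above -q, which is the balance condition; the positive sum
`h0` provides such a brick. -/
theorem pickBrick_halts (h : Ready n r t T b c q len P G L s)
    (h0 : 0 < ∑ i ∈ Finset.range n, (s.arr 9 i + b (r + i))) :
    Halts pickBrick s (40 * n + 40) fun s' => ∃ i₀ < n, 0 < s.arr 9 i₀ + b (r + (i₀ : ℕ)) ∧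
      s'.reg 36 = i₀ * t ∧ s'.arr 10 = Function.update (s.arr 10) (s.reg 23) (i₀ * t) ∧
      ∀ i < n, s'.arr 9 (i : ℕ) = s.arr 9 i + b (r + i) - if i = i₀ then q else 0 := by
  refine Halts.assign_then ?_
  refine Halts.then (c₁ := 40 * n + 6) (Q₁ := fun s₁ => ∃ i₀ : ℕ, i₀ < n ∧
      0 < s.arr 9 i₀ + b (r + i₀) ∧ s₁.reg 27 = i₀ ∧ s₁.reg 36 = i₀ * t ∧
      ∀ i < n, s₁.arr 9 (i : ℕ) = s.arr 9 i + b (r + i)) ?_ ?_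
  · refine Halts.forTo n 32
      (fun i s₁ => s₁.reg 26 = i * t ∧ (∀ i' < i, s₁.arr 9 (i' : ℕ) = s.arr 9 i' + b (r + i')) ∧
        (∀ i' : ℕ, i ≤ i' → s₁.arr 9 i' = s.arr 9 i') ∧
        ((∃ i' : ℕ, i' < i ∧ 0 < s.arr 9 i' + b (r + i')) → ∃ i₀ : ℕ, i₀ < n ∧
          0 < s.arr 9 i₀ + b (r + i₀) ∧ s₁.reg 27 = i₀ ∧ s₁.reg 36 = i₀ * t))
      (by simp [h.n]) (by simp) (fun i hi s₁ ag hi₁ ⟨h1, h2, h3, h4⟩ => ?_)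
      (fun s₁ _ ⟨h1, h2, h3, h4⟩ => ?_) (by omega)
    · replace h : Ready n r t T b c q len P G L s₁ := h.setReg.of_agree ag
      refine Halts.store_then (Halts.then (c₁ := 10) (Q₁ := fun s₂ =>
        ((∃ i' : ℕ, i' < i + 1 ∧ 0 < s.arr 9 i' + b (r + i')) → ∃ i₀ : ℕ, i₀ < n ∧
          0 < s.arr 9 i₀ + b (r + i₀) ∧ s₂.reg 27 = i₀ ∧ s₂.reg 36 = i₀ * t)) ?_ ?_)
      · refine Halts.ite (fun hp => Halts.assign_then (Halts.assign ?_)) (fun hp => Halts.skip ?_)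
        · simp [hi₁, h.b, h.r, h3] at hp
          exact fun _ => ⟨i, hi, hp, by simp [hi₁], by simp [h1]⟩
        · simp [hi₁, h.b, h.r, h3] at hp
          rintro ⟨i', hi', hpos⟩
          refine h4 ⟨i', ?_, hpos⟩
          rcases Nat.lt_succ_iff_lt_or_eq.1 hi' with hi' | rfl
          · exact hi'
          · omega
      · intro s₂ ag₂ h4'
        refine Halts.assign ?_
        have e26 := ag₂.reg 26 (by decide)
        have e2 := ag₂.reg 2 (by decide)
        have e9 := ag₂.arr 9 (by decide)
        simp [hi₁, h.b, h.r, h3] at e9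
        refine ⟨by simp [e26, e2, h1, h.t]; ring, fun i' hi' => ?_, fun i' hi' => ?_,
          by simpa using h4'⟩
        · simp only [Store.arr_setReg, e9]
          rcases Nat.lt_succ_iff_lt_or_eq.1 hi' with hi' | rfl
          · rw [Function.update_of_ne (by exact_mod_cast hi'.ne)]
            exact h2 i' hi'
          · simp
        · simp only [Store.arr_setReg, e9]
          rw [Function.update_of_ne (by have : i' ≠ i := by omega
                                        exact_mod_cast this)]
          exact h3 i' (by omega)
    · obtain ⟨i, hi, hpos⟩ := Finset.exists_lt_of_sum_lt
        (s := Finset.range n) (f := fun _ => (0:ℤ)) (by simpa using h0)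
      obtain ⟨i₀, h5, h6, h7, h8⟩ := h4 ⟨i, Finset.mem_range.1 hi, hpos⟩
      exact ⟨i₀, h5, h6, h7, h8, h2⟩
  · rintro s₁ ag₁ ⟨i₀, h1, h2, h3, h4, h5⟩
    replace h : Ready n r t T b c q len P G L s₁ := h.setReg.of_agree ag₁
    refine Halts.store_then (Halts.store ?_)
    have e10 := ag₁.arr 10 (by decide)
    have e23 := ag₁.reg 23 (by decide)
    simp at e10 e23
    refine ⟨i₀, h1, h2, by simpa using h4, by simp [e10, e23, h4], fun i hi => ?_⟩
    by_cases hii : i = i₀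
    · subst hii; simp [h3, h.q, h5 i hi]
    · simp [h3, hii, h5 i hi]

/-- The remainders in array 11 and the window position in `reg 11` advance by one step. -/
def advance : Program :=
  .forTo 21 1 <|
    .seq (.assign 37 (.add (.get 11 (.reg 21)) (.get 1 (.reg 21)))) <|
    .seq (.whilePos (.add (.sub (.reg 37) (.reg 4)) (.const 1)) <|
      .seq (.assign 37 (.sub (.reg 37) (.reg 4))) <|
      .assign 11 (.add (.reg 11) (.get 4 (.reg 21)))) <|
    .seq (.whilePos (.sub (.const 0) (.reg 37)) <|
      .seq (.assign 37 (.add (.reg 37) (.reg 4))) <|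
      .assign 11 (.sub (.reg 11) (.get 4 (.reg 21)))) <|
    .store 11 (.reg 21) (.reg 37)

/-- Division with remainder is done incrementally: since |b l| ≤ Δq, the floor of k·b_l/q moves by
at most Δ per step, and so do the corrections of the remainder. -/
theorem advance_halts (h : Ready n r t T b c q len P G L s) (hq : 0 < q) {Δ k : ℕ}
    (hb : ∀ l < r, |b (l : ℕ)| ≤ Δ * q) (he : ∀ l < r, s.arr 11 (l : ℕ) = k * b l % q) :
    Halts advance s (r * (20 * Δ + 60) + 10) fun s' =>
      (∀ l < r, s'.arr 11 (l : ℕ) = (k + 1) * b l % q) ∧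
      s'.reg 11 = s.reg 11 + ∑ l ∈ Finset.range r, ((k + 1) * b l / q - k * b l / q) * P l := by
  have hq' : (0:ℤ) < q := by exact_mod_cast hq
  refine Halts.forTo r (20 * Δ + 50)
    (fun i s₁ => (∀ l < i, s₁.arr 11 (l : ℕ) = (k + 1) * b l % q) ∧
      (∀ l < r, i ≤ l → s₁.arr 11 (l : ℕ) = k * b l % q) ∧
      s₁.reg 11 = s.reg 11 + ∑ l ∈ Finset.range i, ((k + 1) * b l / q - k * b l / q) * P l)
    h.r (by simpa using he) (fun i hi s₁ ag hi₁ ⟨h1, h2, h3⟩ => ?_)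
    (fun s₁ _ ⟨h1, h2, h3⟩ => ⟨h1, h3⟩) (by ring_nf; omega)
  replace h := h.of_agree ag
  refine Halts.assign_then ?_
  set x : ℤ := k * b i % q + b i with hx
  set d : ℤ := x / q with hd
  set e : ℤ := x % q with he'
  have hxde : x = e + d * q := by rw [hd, he', mul_comm]; exact (Int.emod_add_mul_ediv x q).symm
  have he0 : 0 ≤ e := Int.emod_nonneg _ hq'.ne'
  have heq : e < q := Int.emod_lt_of_pos _ hq'
  have hbi := abs_le.1 (hb i hi)
  have hr0 : 0 ≤ (k * b i) % (q:ℤ) := Int.emod_nonneg _ hq'.ne'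
  have hrq : (k * b i) % (q:ℤ) < q := Int.emod_lt_of_pos _ hq'
  have hdΔ : d ≤ Δ := by
    by_contra hlt
    push Not at hlt
    have : ((Δ:ℤ) + 1) * q ≤ d * q := mul_le_mul_of_nonneg_right hlt hq'.le
    linarith
  have hdΔ' : -d ≤ Δ := by
    by_contra hlt
    push Not at hlt
    have : d * q ≤ (-(Δ:ℤ) - 1) * q := mul_le_mul_of_nonneg_right (by linarith) hq'.le
    linarith
  have hstep : (k + 1) * b i / q = k * b i / q + d ∧ (k + 1) * b i % q = e := by
    have e1 : (k + 1) * b i = x + q * (k * b i / q) := by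
      have := Int.emod_add_mul_ediv (k * b i) q
      rw [hx]; linarith
    rw [e1, Int.add_mul_ediv_left _ _ hq'.ne', Int.add_mul_emod_self_left]
    exact ⟨by rw [hd]; ring, rfl⟩
  set B := s₁.reg 11 with hB
  -- The two correction loops run `d.toNat` and `(-d).toNat` times. At most one of these is nonzero,
  -- so both signs of d are covered without a case split.
  refine Halts.then (c₁ := 20 * d.toNat + 6) (Q₁ := fun s₂ => s₂.reg 37 = e + (d - d.toNat) * q ∧
    s₂.reg 11 = B + d.toNat * P i) ?_ ?_
  · refine Halts.whilePos 10 (fun m s₂ => m ≤ d.toNat ∧ s₂.reg 4 = q ∧ s₂.reg 21 = i ∧ s₂.arr 4 = P ∧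
      s₂.reg 37 = e + (d - d.toNat + m) * q ∧ s₂.reg 11 = B + (d.toNat - m) * P i)
      (N := d.toNat) ?_ ?_ ?_ (by simp only [Term.cost]; omega)
    · refine ⟨le_rfl, by simpa using h.q, by simpa using hi₁, by simpa using h.P, ?_,
        by simp [hB]⟩
      simp only [Store.reg_setReg, if_true, Term.value, hi₁, h2 i hi le_rfl, h.b]
      rw [← hx, hxde]; ring
    · rintro m s₂ ⟨g1, g2, g3, g4, g5, g6⟩
      have hd0 : (d.toNat : ℤ) = d := by omega
      refine ⟨?_, Halts.assign_then (Halts.assign ⟨by omega, by simpa using g2, by simpa using g3,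
        by simpa using g4, ?_, ?_⟩)⟩
      · simp only [Term.value, g5, g2, hd0]
        push_cast
        nlinarith [mul_nonneg (Nat.cast_nonneg (α := ℤ) m) hq'.le]
      · simp [g5, g2]; ring
      · simp [g6, g3, g4]; ring
    · rintro s₂ ⟨g1, g2, g3, g4, g5, g6⟩
      refine ⟨?_, by simpa using g5, by simpa using g6⟩
      have : (d - d.toNat) * (q:ℤ) ≤ 0 := mul_nonpos_of_nonpos_of_nonneg (by omega) hq'.le
      simp only [Term.value, g5, g2]
      push_cast
      rw [add_zero]
      linarith
  rintro s₂ ag₂ ⟨g1, g2⟩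
  refine Halts.then (c₁ := 20 * (-d).toNat + 6) (Q₁ := fun s₂ => s₂.reg 37 = e ∧
    s₂.reg 11 = B + d * P i) ?_ ?_
  · replace h : Ready n r t T b c q len P G L s₂ := h.setReg.of_agree ag₂
    refine Halts.whilePos 10 (fun m s₂ => m ≤ (-d).toNat ∧ s₂.reg 4 = q ∧ s₂.reg 21 = i ∧
      s₂.arr 4 = P ∧ s₂.reg 37 = e - m * q ∧ s₂.reg 11 = B + (d + m) * P i)
      (N := (-d).toNat) ?_ ?_ ?_ (by simp only [Term.cost]; omega)
    · have hdd : d - d.toNat = -((-d).toNat : ℤ) := by omega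
      refine ⟨le_rfl, h.q, ?_, h.P, by rw [g1, hdd]; ring, ?_⟩
      · simpa [hi₁] using ag₂.reg 21 (by decide)
      · rw [g2]; congr 2; omega
    · rintro m s₂ ⟨g1, g2, g3, g4, g5, g6⟩
      refine ⟨?_, Halts.assign_then (Halts.assign ⟨by omega, by simpa using g2, by simpa using g3,
        by simpa using g4, ?_, ?_⟩)⟩
      · simp only [Term.value, g5]
        push_cast
        nlinarith [mul_nonneg (Nat.cast_nonneg (α := ℤ) m) hq'.le]
      · simp [g5, g2]; ring
      · simp [g6, g3, g4]; ring
    · rintro s₂ ⟨g1, g2, g3, g4, g5, g6⟩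
      refine ⟨?_, by simpa using g5, by simpa using g6⟩
      simp only [Term.value, g5]
      simp [he0]
  · rintro s₃ ag₃ ⟨g3, g4⟩
    refine Halts.store ?_
    have e11 := (ag₃.arr 11 (by decide)).trans (ag₂.arr 11 (by decide))
    have e21 := (ag₃.reg 21 (by decide)).trans (ag₂.reg 21 (by decide))
    simp [hi₁] at e11 e21
    refine ⟨fun l hl => ?_, fun l hl hil => ?_, ?_⟩
    · simp only [Store.arr_setReg, Store.arr_setArr, if_true, e11, e21, Term.value, g3]
      rcases Nat.lt_succ_iff_lt_or_eq.1 hl with hl | rfl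
      · rw [Function.update_of_ne (by exact_mod_cast hl.ne)]
        exact h1 l hl
      · rw [Function.update_self, hstep.2]
    · simp only [Store.arr_setReg, Store.arr_setArr, if_true, e11, e21, Term.value, g3]
      rw [Function.update_of_ne (by have : l ≠ i := by omega
                                    exact_mod_cast this)]
      exact h2 l hl (by omega)
    · simp [g4, h3, Finset.sum_range_succ, hstep.1]
      ring

/-- All transitions into the current window. -/
def fillLevel : Program :=
  .forTo 24 10 <|
    .seq (.assign 28 (.add (.reg 11) (.get 6 (.reg 24)))) <|
    .forTo 22 2 <|
      .seq (.assign 38 (.add (.reg 36) (.reg 22))) <|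
      .seq (.assign 29 (.sub (.sub (.reg 28) (.get 5 (.reg 38))) (.const 1))) <|
      .ifPos (.get 7 (.reg 29))
        (.seq (.assign 35 (.add (.get 8 (.reg 29)) (.get 2 (.reg 38)))) <|
          .ifPos (.get 7 (.reg 28))
            (.ifPos (.sub (.get 8 (.reg 28)) (.reg 35))
              (.seq (.store 7 (.reg 28) (.add (.reg 22) (.const 1))) <|
                .store 8 (.reg 28) (.reg 35)) .skip)
            (.seq (.store 7 (.reg 28) (.add (.reg 22) (.const 1))) <|
              .store 8 (.reg 28) (.reg 35)))
        .skip

theorem fillLevel_halts (h : Ready n r t T b c q len P G L s) {M a β : ℤ} {K : ℕ}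
    (hK : (K:ℤ) + 1 < M) (h36 : s.reg 36 = a) (h11 : s.reg 11 = β)
    (hwin : ∀ idx : ℕ, idx < len → (β + L idx) % M = K + 1)
    (hG : ∀ j : ℕ, j < t → M ∣ G (a + j))
    (hlev : Level M t G c K a (s.arr 7) (s.arr 8) (s.arr 7) (s.arr 8) ∅) :
    Halts fillLevel s (len * (50 * t + 30) + 10) fun s' =>
      Level M t G c K a (s.arr 7) (s.arr 8) (s'.arr 7) (s'.arr 8)
        {p | ∃ idx : ℕ, idx < len ∧ p.1 = β + L idx ∧ p.2 < t} := by
  refine Halts.forTo len (50 * t + 20) (fun i s₁ =>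
    Level M t G c K a (s.arr 7) (s.arr 8) (s₁.arr 7) (s₁.arr 8)
      {p | ∃ idx : ℕ, idx < i ∧ p.1 = β + L idx ∧ p.2 < t}) h.len
    (hlev.mono (by rintro p ⟨idx, h, -⟩; omega)) (fun i hi s₁ ag hi₁ hlev₁ => ?_)
    (fun _ _ h => h) (by ring_nf; omega)
  replace h := h.of_agree ag
  replace h36 := (ag.reg 36 (by decide)).trans h36
  replace h11 := (ag.reg 11 (by decide)).trans h11
  refine Halts.assign_then ?_
  set u := β + L i with hu
  refine Halts.forTo t 42 (fun j s₂ =>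
    Level M t G c K a (s.arr 7) (s.arr 8) (s₂.arr 7) (s₂.arr 8)
      {p | (∃ idx : ℕ, idx < i ∧ p.1 = β + L idx ∧ p.2 < t) ∨ p.1 = u ∧ p.2 < j}) (by simp [h.t])
    (hlev₁.mono (by rintro p (h | ⟨-, h⟩); exacts [h, by omega]))
    (fun j hj s₂ ag₂ hj₂ hlev₂ => ?_) (fun s₂ _ hlev₂ => hlev₂.mono ?_)
    (by simp only [Term.cost]; omega)
  · have h28 : s₂.reg 28 = u := by rw [ag₂.reg 28 (by decide)]; simp [h11, h.L, hi₁, hu]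
    replace h36 : s₂.reg 36 = a := by rw [ag₂.reg 36 (by decide)]; simpa using h36
    replace h : Ready n r t T b c q len P G L s₂ := h.setReg.of_agree ag₂
    have hS : {p : ℤ × ℕ | (∃ idx : ℕ, idx < i ∧ p.1 = β + L idx ∧ p.2 < t) ∨ p.1 = u ∧ p.2 < j + 1}
        ⊆ insert (u, j) {p | (∃ idx : ℕ, idx < i ∧ p.1 = β + L idx ∧ p.2 < t) ∨
          p.1 = u ∧ p.2 < j} := by
      rintro p (h | ⟨h1, h2⟩)
      · exact Or.inr (Or.inl h)
      · rcases Nat.lt_succ_iff_lt_or_eq.1 h2 with h2 | h2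
        · exact Or.inr (Or.inr ⟨h1, h2⟩)
        · exact Or.inl (Prod.ext h1 h2)
    -- The branches of the program are these two cases: an arc is used if its end is unmarked or
    -- strictly improves, and is dropped otherwise.
    have keep := fun hkeep => hlev₂.keep hK (hwin i hi) (hG j hj) hS hkeep
    have upd := fun hpre hbetter => hlev₂.update hK hj (hwin i hi) (hG j hj) hS hpre hbetter
    simp only [← hu] at keep upd
    refine Halts.assign_then (Halts.assign_then (Halts.ite (fun h1 => Halts.assign_then
      (Halts.ite (fun h2 => Halts.ite (fun h3 => Halts.store_then (Halts.store ?_))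
        (fun h3 => Halts.skip ?_)) (fun h2 => Halts.store_then (Halts.store ?_))))
      (fun h1 => Halts.skip ?_)))
    · simp [h36, hj₂, h28, h.G, h.c, -Order.lt_add_one_iff] at h1 h2 h3 ⊢
      exact upd h1 fun _ => h3
    · simp [h36, hj₂, h28, h.G, h.c, -Order.lt_add_one_iff] at h1 h2 h3 ⊢
      exact keep fun _ => ⟨h2, h3⟩
    · simp [h36, hj₂, h28, h.G, h.c, -Order.lt_add_one_iff] at h1 h2 ⊢
      exact upd h1 fun h' => absurd h' (by omega)
    · simp [h36, hj₂, h28, h.G, -Order.lt_add_one_iff] at h1 ⊢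
      exact keep fun h' => absurd h' (by omega)
  · rintro p ⟨idx, h1, h2, h3⟩
    rcases Nat.lt_succ_iff_lt_or_eq.1 h1 with h1 | rfl
    · exact Or.inl ⟨idx, h1, h2, h3⟩
    · exact Or.inr ⟨h2, h3⟩

end Ready

end NFold.Solver

/-! ### The full dynamic program and the reconstruction of a path -/

section DynamicProgram

theorem occ_congr {α : Type*} [DecidableEq α] {σ σ' : ℕ → α} {k : ℕ} (h : ∀ m < k, σ m = σ' m)
    (i : α) : occ σ i k = occ σ' i k := by
  rw [occ, occ]
  congr 1
  exact Finset.filter_congr fun m hm => by rw [h m (Finset.mem_range.1 hm)]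

variable {M : ℤ} {t : ℕ} {A A' g c : ℤ → ℤ} {K : ℕ} {mark val : ℤ → ℤ}

/-- Tables up to level K consult the schedule only before step K, so they survive the writing of its
next entry. -/
theorem Traced.congr (h : Traced M t A g c K mark val) (hA : ∀ m < K, A (m : ℕ) = A' m) :
    Traced M t A' g c K mark val := by
  intro u hu
  obtain ⟨k, hk, h1, h2, h3⟩ := h u hu
  refine ⟨k, hk, h1, h2, fun m hm => ?_⟩
  rw [← hA m (by omega)]
  exact h3 m hm

theorem pathCode_congr {k : ℕ} (hA : ∀ m < k, A (m : ℕ) = A' m) (js : ℕ → ℕ) :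
    pathCode A g js k = pathCode A' g js k :=
  Finset.sum_congr rfl fun m hm => by rw [hA m (Finset.mem_range.1 hm)]

theorem pathCost_congr {k : ℕ} (hA : ∀ m < k, A (m : ℕ) = A' m) (js : ℕ → ℕ) :
    pathCost A c js k = pathCost A' c js k :=
  Finset.sum_congr rfl fun m hm => by rw [hA m (Finset.mem_range.1 hm)]

theorem Covers.congr {base L : ℤ → ℤ} {len : ℕ} (h : Covers t A g c base L len K mark val)
    (hA : ∀ m < K, A (m : ℕ) = A' m) : Covers t A' g c base L len K mark val := by
  intro js hjs hwin
  rw [← pathCode_congr hA, ← pathCost_congr hA]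
  refine h js hjs fun k hk hk' => ?_
  rw [pathCode_congr fun m hm => hA m (by omega)]
  exact hwin k hk hk'

end DynamicProgram

namespace NFold.Solver

open RAM

/-- The dynamic program: marks go to array 7, values to array 8, the schedule to array 10. -/
def fillTables : Program :=
  .seq (.store 7 (.const 0) (.const 1)) <| .seq (.assign 11 (.const 0)) <|
  .forTo 23 4 <|
    .seq (.assign 11 (.add (.reg 11) (.const 1))) <| .seq pickBrick <| .seq advance fillLevel

/-- The code of the grid point below the point `k / q * b`, at level `k`. -/
def centre (r q : ℕ) (b P : ℤ → ℤ) (k : ℤ) : ℤ := k + ∑ l ∈ Finset.range r, k * b l / q * P l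

variable {n r t : ℕ} {T b c : ℤ → ℤ} {q len : ℕ} {P G L : ℤ → ℤ} {s s' : Store}

theorem fillTables_halts (h : Ready n r t T b c q len P G L s) (ht : 1 ≤ t) {M : ℤ} (hM : q < M)
    {Δ : ℕ} (hsum : ∑ i ∈ Finset.range n, b (r + i) = q) (hb0 : ∀ i < n, 0 ≤ b (r + (i : ℕ)))
    (hb : ∀ l < r, |b (l : ℕ)| ≤ Δ * q) (hP : ∀ l < r, M ∣ P (l : ℕ))
    (hL : ∀ idx < len, M ∣ L (idx : ℕ)) (hG : ∀ i < n, ∀ j < t, M ∣ G ((i : ℕ) * t + (j : ℕ)))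
    (h7 : s.arr 7 = 0) (h8 : s.arr 8 = 0) (h9 : s.arr 9 = 0) (h11 : s.arr 11 = 0) :
    Halts fillTables s (q * (40 * n + r * (20 * Δ + 60) + len * (50 * t + 30) + 80) + 20) fun s' =>
      (∀ m < q, ∃ i < n, s'.arr 10 (m : ℕ) = (i : ℕ) * t) ∧
      (0 < q → ∀ k ≤ q, ∀ i < n, q * (occ (fun m : ℕ => s'.arr 10 m) ((i : ℕ) * t : ℤ) k : ℤ)
        < k * b (r + (i : ℕ)) + q) ∧
      Traced M t (s'.arr 10) G c q (s'.arr 7) (s'.arr 8) ∧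
      Covers t (s'.arr 10) G c (centre r q b P) L len q (s'.arr 7) (s'.arr 8) := by
  have ht' : (t:ℤ) ≠ 0 := by exact_mod_cast (by omega : t ≠ 0)
  refine Halts.store_then (Halts.assign_then ?_)
  -- Before the first round the strict balance inequality reads 0 < q, hence the alternative q = 0
  -- in the invariant. The deficits sum to 0, so after adding the quotas they sum to q > 0, and a
  -- brick can be chosen.
  refine Halts.forTo q (40 * n + r * (20 * Δ + 60) + len * (50 * t + 30) + 70) (fun k s₁ =>
      (∀ m < k, ∃ i < n, s₁.arr 10 (m : ℕ) = (i : ℕ) * t) ∧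
      (∀ k' ≤ k, ∀ i < n, q * (occ (fun m : ℕ => s₁.arr 10 m) ((i : ℕ) * t : ℤ) k' : ℤ)
        < k' * b (r + (i : ℕ)) + q ∨ q = 0) ∧
      (∀ i < n, s₁.arr 9 (i : ℕ)
        = k * b (r + i) - q * occ (fun m : ℕ => s₁.arr 10 m) ((i : ℕ) * t : ℤ) k) ∧
      ∑ i ∈ Finset.range n, s₁.arr 9 i = 0 ∧
      (∀ l < r, s₁.arr 11 (l : ℕ) = k * b l % q) ∧ s₁.reg 11 = centre r q b P k ∧
      Traced M t (s₁.arr 10) G c k (s₁.arr 7) (s₁.arr 8) ∧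
      Covers t (s₁.arr 10) G c (centre r q b P) L len k (s₁.arr 7) (s₁.arr 8))
    (by simp [h.q]) ?_ (fun k hk s₁ ag hk₁ ⟨i1, i2, i3, i4, i5, i6, i7, i8⟩ => ?_)
    (fun s₁ _ ⟨i1, i2, i3, i4, i5, i6, i7, i8⟩ => ⟨i1, ?_, i7, i8⟩) (by
      simp only [Term.cost]; ring_nf; omega)
  · refine ⟨by simp, fun k' hk' i hi => ?_, by simp [h9], by simp [h9], by simp [h11],
      by simp [centre], ?_, ?_⟩
    · rw [Nat.le_zero.1 hk']
      rcases Nat.eq_zero_or_pos q with h | h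
      · exact Or.inr h
      · exact Or.inl (by simpa using h)
    · intro u hu
      obtain rfl : u = 0 := by
        by_contra hne
        simp [h7, hne] at hu
      exact ⟨0, le_rfl, by simp, by simp [h8], by omega⟩
    · intro js _ _
      simp [pathCode, pathCost, h8]
  · replace h : Ready n r t T b c q len P G L s₁ := h.setArr.setReg.of_agree ag
    have hq : 0 < q := by omega
    have hcentre : ∀ z : ℤ, M ∣ centre r q b P z - z := fun z => by
      rw [centre, add_sub_cancel_left]
      exact Finset.dvd_sum fun l hl => (hP l (Finset.mem_range.1 hl)).mul_left _
    refine Halts.assign_then ?_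
    refine Halts.then (pickBrick_halts h.setReg (by
      simp only [Store.arr_setReg]
      rw [Finset.sum_add_distrib, i4, hsum]; exact_mod_cast (by omega : 0 < 0 + q))) ?_
    rintro s₂ ag₂ ⟨i₀, hi₀, hpos, h36, h10, h9⟩
    simp [hk₁] at hpos h10 h9
    replace h : Ready n r t T b c q len P G L s₂ := h.setReg.of_agree ag₂
    have e11 := ag₂.arr 11 (by decide)
    simp at e11
    refine Halts.then (advance_halts h hq hb (k := k) (by rwa [e11])) ?_
    rintro s₃ ag₃ ⟨h11, hr11⟩
    replace h : Ready n r t T b c q len P G L s₃ := h.of_agree ag₃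
    have e7 := (ag₃.arr 7 (by decide)).trans (ag₂.arr 7 (by decide))
    have e8 := (ag₃.arr 8 (by decide)).trans (ag₂.arr 8 (by decide))
    have e9 := (ag₃.arr 9 (by decide))
    have e10 := (ag₃.arr 10 (by decide)).trans h10
    have e36 := (ag₃.reg 36 (by decide)).trans h36
    have er := ag₂.reg 11 (by decide)
    simp at e7 e8 er
    have hc : s₃.reg 11 = centre r q b P (k + 1) := by
      rw [hr11, er, i6, centre, centre]
      simp only [sub_mul]
      rw [Finset.sum_sub_distrib]
      ring
    have hA : ∀ m < k, s₁.arr 10 (m : ℕ) = s₃.arr 10 m := fun m hm => by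
      rw [e10, Function.update_of_ne (by exact_mod_cast hm.ne)]
    have hAk : s₃.arr 10 k = i₀ * t := by rw [e10, Function.update_self]
    replace i7 := i7.congr hA
    replace i8 := i8.congr hA
    rw [← e7, ← e8] at i7 i8
    -- Apart from the level, centre and offset contribute multiples of M; the level is its own
    -- residue because q < M.
    have hwin : ∀ idx : ℕ, idx < len → (centre r q b P (k + 1) + L idx) % M = k + 1 := by
      intro idx hidx
      obtain ⟨y, hy⟩ := dvd_add (hcentre (k + 1)) (hL idx hidx)
      have : centre r q b P (k + 1) + L idx = (k + 1) + M * y := by rw [← hy]; ring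
      rw [this, Int.add_mul_emod_self_left]
      exact Int.emod_eq_of_lt (by omega) (by omega)
    have hA' : ∀ m ≤ k, ∃ i < n, s₃.arr 10 (m : ℕ) = (i : ℕ) * t := by
      intro m hm
      rcases hm.lt_or_eq with hm | rfl
      · rw [← hA m hm]; exact i1 m hm
      · exact ⟨i₀, hi₀, hAk⟩
    have hGA : ∀ m ≤ k, ∀ j : ℕ, j < t → M ∣ G (s₃.arr 10 m + j) := by
      intro m hm j hj
      obtain ⟨i, hi, hi'⟩ := hA' m hm
      rw [hi']
      exact hG i hi j hj
    refine (fillLevel_halts h (M := M) (K := k) (by omega) (e36.trans hAk.symm) hc hwin (hGA k le_rfl)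
      i7.level).mono (by simp only [Term.cost]; omega) fun s₄ ag₄ hlev => ?_
    have f9 := ag₄.arr 9 (by decide)
    have f10 := ag₄.arr 10 (by decide)
    have f11 := ag₄.arr 11 (by decide)
    have fr := ag₄.reg 11 (by decide)
    have hocc : ∀ i < n, occ (fun m : ℕ => s₃.arr 10 m) ((i : ℕ) * t : ℤ) (k + 1)
        = occ (fun m : ℕ => s₁.arr 10 m) ((i : ℕ) * t : ℤ) k + if i = i₀ then 1 else 0 := by
      intro i hi
      rw [occ_succ, occ_congr (σ' := fun m : ℕ => s₁.arr 10 m) fun m hm => (hA m hm).symm]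
      congr 1
      simp only [hAk, mul_eq_mul_right_iff, ht', or_false, Nat.cast_inj, eq_comm]
    simp only [Store.arr_setReg, f9, f10, f11, e9]
    refine ⟨fun m hm => hA' m (by omega), fun k' hk' i hi => Or.inl ?_, fun i hi => ?_, ?_,
      by exact_mod_cast h11, ?_, hlev.traced i7 (by omega) hGA, hlev.covers i8 ?_ hwin⟩
    · rcases Nat.le_succ_iff.1 hk' with hk' | rfl
      · rw [occ_congr (σ' := fun m : ℕ => s₁.arr 10 m) fun m hm => (hA m (by omega)).symm]
        exact (i2 k' hk' i hi).resolve_right hq.ne'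
      · rw [hocc i hi]
        have h1 := (i2 k le_rfl i hi).resolve_right hq.ne'
        have h2 := hb0 i hi
        split_ifs with hii
        · subst hii
          rw [i3 i hi] at hpos
          push_cast; linarith
        · push_cast; linarith
    · rw [h9 i hi, hocc i hi, i3 i hi]
      split_ifs <;> (push_cast; ring)
    · rw [Finset.sum_congr rfl fun i hi => h9 i (Finset.mem_range.1 hi), Finset.sum_sub_distrib,
        Finset.sum_add_distrib, i4, hsum]
      simp [hi₀]
    · simp [fr, hc]
    · rintro idx hidx j hj
      exact ⟨idx, hidx, rfl, hj⟩
  · intro hq k hk i hi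
    exact (i2 k hk i hi).resolve_right (by omega)

/-- If the target in `reg 12` is marked, follow the marks back, count the choices in array 3 and
set `reg 0` to 1. Otherwise set `reg 0` to 0. -/
def traceBack : Program :=
  .ifPos (.get 7 (.reg 12))
    (.seq (.assign 28 (.reg 12)) <| .seq (.assign 39 (.reg 4)) <|
      .seq (.whilePos (.reg 39) <|
        .seq (.assign 39 (.sub (.reg 39) (.const 1))) <|
        .seq (.assign 38
          (.sub (.add (.get 10 (.reg 39)) (.get 7 (.reg 28))) (.const 1))) <|
        .seq (.store 3 (.reg 38) (.add (.get 3 (.reg 38)) (.const 1))) <|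
        .assign 28 (.sub (.sub (.reg 28) (.get 5 (.reg 38))) (.const 1))) <|
      .assign 0 (.const 1))
    (.assign 0 (.const 0))

/-- The residue of the target puts it at level q, so q back steps end at level 0, where `Traced`
leaves only code 0 with value 0. A mark is the column index plus one, as 0 means unmarked. -/
theorem traceBack_halts (h : Ready n r t T b c q len P G L s) {M Z : ℤ} {A : ℤ → ℤ} (ht : 1 ≤ t)
    (hZ : s.reg 12 = Z) (hZM : Z % M = q) (hM : q < M)
    (hG : ∀ m < q, ∀ j : ℕ, j < t → M ∣ G (A (m : ℕ) + j)) (hA : s.arr 10 = A) (h3 : s.arr 3 = 0)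
    (htr : Traced M t A G c q (s.arr 7) (s.arr 8)) :
    Halts traceBack s (50 * q + 40) fun s' =>
      (s'.reg 0 = 0 ∧ ¬ 0 < s.arr 7 Z) ∨ (s'.reg 0 = 1 ∧ 0 < s.arr 7 Z ∧ ∃ js : ℕ → ℕ,
        (∀ m, js m < t) ∧ pathCode A G js q = Z ∧ pathCost A c js q = s.arr 8 Z ∧
        ∀ z, s'.arr 3 z = ∑ m ∈ Finset.range q, if A m + js m = z then 1 else 0) := by
  refine Halts.ite (fun hp => ?_) (fun hp => Halts.assign (Or.inl ⟨by simp, by simpa [hZ] using hp⟩))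
  simp [hZ] at hp
  refine Halts.assign_then (Halts.assign_then ?_)
  refine Halts.then (c₁ := 50 * q + 10) (Q₁ := fun s' => ∃ js : ℕ → ℕ,
        (∀ m, js m < t) ∧ pathCode A G js q = Z ∧ pathCost A c js q = s.arr 8 Z ∧
        ∀ z, s'.arr 3 z = ∑ m ∈ Finset.range q, if A m + js m = z then 1 else 0) ?_
      (fun s₁ _ hQ => Halts.assign (Or.inr ⟨by simp, hp, by simpa using hQ⟩))
  refine Halts.whilePos 40 (fun k s₁ => k ≤ q ∧ s₁.reg 39 = k ∧ s₁.arr 5 = G ∧ s₁.arr 10 = A ∧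
      s₁.arr 7 = s.arr 7 ∧ 0 < s.arr 7 (s₁.reg 28) ∧ s₁.reg 28 % M = k ∧ ∃ js : ℕ → ℕ,
        (∀ m, js m < t) ∧ s₁.reg 28 + ∑ m ∈ Finset.Ico k q, (G (A m + js m) + 1) = Z ∧
        s.arr 8 (s₁.reg 28) + ∑ m ∈ Finset.Ico k q, c (A m + js m) = s.arr 8 Z ∧
        ∀ z, s₁.arr 3 z = ∑ m ∈ Finset.Ico k q, if A m + js m = z then 1 else 0) (N := q)
      ?_ ?_ ?_ (by simp only [Term.cost]; omega)
  · refine ⟨le_rfl, by simp [h.q], by simp [h.G], by simp [hA], by simp, by simpa [hZ] using hp,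
      by simpa [hZ] using hZM, fun _ => 0, fun _ => ht, by simp [hZ], by simp [hZ], by simp [h3]⟩
  · rintro k s₁ ⟨g0, g1, g2, g3, g4, g5, g6, js, hjs, g7, g8, g9⟩
    obtain ⟨k', hk', hmod, -, hpre⟩ := htr _ g5
    obtain ⟨j, hj, hmark, hpos, hval⟩ := hpre k (by rw [g6] at hmod; exact_mod_cast hmod.symm)
    refine ⟨by simp only [Term.value, g1]; push_cast; omega, Halts.assign_then (Halts.assign_then
      (Halts.store_then (Halts.assign ?_)))⟩
    -- The path is assembled backwards. Its entries below k are still arbitrary, and the invariant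
    -- speaks only of steps from k to q-1.
    set js' := Function.update js k j with hjs'
    have hIco : ∀ f : ℕ → ℕ → ℤ, ∑ m ∈ Finset.Ico k q, f m (js' m)
        = f k j + ∑ m ∈ Finset.Ico (k + 1) q, f m (js m) := by
      intro f
      rw [Finset.sum_eq_sum_Ico_succ_bot (by omega), hjs', Function.update_self]
      congr 1
      refine Finset.sum_congr rfl fun m hm => ?_
      rw [Function.update_of_ne (by have := Finset.mem_Ico.1 hm; omega)]
    have hu : s₁.reg 28 - G (A k + j) - 1 + (G (A k + j) + 1) = s₁.reg 28 := by ring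
    have h38 : A k + (j + 1) - 1 = A k + j := by ring
    simp [g1, g2, g3, g4, hmark, h38, -Finset.sum_boole]
    refine ⟨by omega, hpos, ?_, js', fun m => ?_, ?_, ?_, fun z => ?_⟩
    · exact sub_emod_of_emod_eq_succ (by omega) (by simpa using g6) (hG k (by omega) j hj)
    · by_cases hm : m = k
      · subst hm; simpa [hjs'] using hj
      · simpa [hjs', hm] using hjs m
    · rw [hIco fun m j => G (A m + j) + 1, ← g7]; ring
    · rw [hIco fun m j => c (A m + j), ← g8, hval]; ring
    · rw [hIco fun m j => if A m + j = z then 1 else 0]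
      by_cases hz : z = A k + j
      · subst hz; simp [g9, -Finset.sum_boole]; ring
      · simp [hz, Ne.symm hz, g9, -Finset.sum_boole]
  · rintro s₁ ⟨g0, g1, g2, g3, g4, g5, g6, js, hjs, g7, g8, g9⟩
    obtain ⟨k', hk', hmod, hzero, -⟩ := htr _ g5
    obtain ⟨h1, h2⟩ := hzero (by rw [g6] at hmod; exact_mod_cast hmod.symm)
    refine ⟨by simp [g1], js, hjs, ?_, ?_, by simpa using g9⟩
    · rw [h1] at g7; simpa [pathCode] using g7
    · rw [h2] at g8; simpa [pathCost] using g8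

end NFold.Solver

/-! ### Solutions as paths -/

namespace NFold

variable {n r t : ℕ}

theorem isFeasible_iff (I : NFold n r t) (x : Fin n × Fin t → ℤ) :
    I.IsFeasible x ↔ (∀ l, ∑ i, ∑ j, I.T i l j * x (i, j) = I.b (Sum.inl l)) ∧
      (∀ i, ∑ j, x (i, j) = I.b (Sum.inr i)) ∧ ∀ p, 0 ≤ x p := by
  rw [IsFeasible, funext_iff, Sum.forall, and_assoc]
  refine and_congr (forall_congr' fun l => ?_) (and_congr_left fun _ => forall_congr' fun i => ?_)
  · simp [matrix, Matrix.mulVec, dotProduct, Fintype.sum_prod_type]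
  · have : ∑ i', ∑ j, (if i = i' then x (i', j) else 0) = ∑ j, x (i, j) := by
      rw [Finset.sum_eq_single i (fun i' _ hi' => by simp [Ne.symm hi']) (by simp)]
      simp
    simp [matrix, Matrix.mulVec, dotProduct, Fintype.sum_prod_type, this]

theorem dotProduct_eq (I : NFold n r t) (x : Fin n × Fin t → ℤ) :
    I.c ⬝ᵥ x = ∑ i, ∑ j, I.c (i, j) * x (i, j) := by
  simp [dotProduct, Fintype.sum_prod_type]

theorem abs_T_le_maxEntry (I : NFold n r t) (i : Fin n) (l : Fin r) (j : Fin t) :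
    |I.T i l j| ≤ I.maxEntry := by
  have : (I.T i l j).natAbs ≤ I.maxEntry :=
    Finset.le_sup (f := fun p : (Fin r ⊕ Fin n) × (Fin n × Fin t) => (I.matrix p.1 p.2).natAbs)
      (Finset.mem_univ ((Sum.inl l : Fin r ⊕ Fin n), (i, j)))
  rw [Int.abs_eq_natAbs]
  exact_mod_cast this

theorem one_le_maxEntry (I : NFold n r t) (hn : 1 ≤ n) (ht : 1 ≤ t) : 1 ≤ I.maxEntry := by
  refine le_trans ?_ (Finset.le_sup (f := fun p => (I.matrix p.1 p.2).natAbs)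
    (Finset.mem_univ ((Sum.inr ⟨0, hn⟩ : Fin r ⊕ Fin n), ((⟨0, hn⟩ : Fin n), (⟨0, ht⟩ : Fin t)))))
  simp [matrix]

/-- The lower blocks contain only 0 and 1, and `hD` accounts for them. -/
theorem maxEntry_le (I : NFold n r t) {D : ℤ} (hD : 1 ≤ D) (h : ∀ i l j, |I.T i l j| ≤ D) :
    (I.maxEntry : ℤ) ≤ D := by
  have : I.maxEntry ≤ D.toNat := by
    refine Finset.sup_le ?_
    rintro ⟨l | i, i', j⟩ -
    · have := h i' l j
      rw [Int.abs_eq_natAbs] at this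
      simp [matrix]
      omega
    · simp only [matrix, Matrix.fromRows_apply_inr, Matrix.of_apply]
      split_ifs <;> simp
      omega
  omega

theorem mul_add_inj {t i i' j j' : ℕ} (hj : j < t) (hj' : j' < t) (h : i * t + j = i' * t + j') :
    i = i' ∧ j = j' := by
  have h1 : i = i' := by
    have := congrArg (· / t) h
    simpa [Nat.mul_add_div, mul_comm, Nat.div_eq_of_lt, hj, hj', (show 0 < t by omega)] using this
  subst h1
  exact ⟨rfl, by omega⟩

theorem extend_T_injective : Function.Injective
    (fun p : Fin n × Fin r × Fin t => (((p.1 : ℕ) * r + p.2.1) * t + p.2.2 : ℤ)) := by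
  rintro ⟨i, l, j⟩ ⟨i', l', j'⟩ h
  simp only at h
  have h' : ((i : ℕ) * r + l) * t + j = ((i' : ℕ) * r + l') * t + j' := by exact_mod_cast h
  obtain ⟨h1, h2⟩ := mul_add_inj j.2 j'.2 h'
  obtain ⟨h3, h4⟩ := mul_add_inj l.2 l'.2 h1
  simp [Fin.ext_iff, h2, h3, h4]

theorem input_T (I : NFold n r t) (i : Fin n) (l : Fin r) (j : Fin t) :
    I.input.arr 0 (((i : ℕ) * r + (l : ℕ)) * t + (j : ℕ)) = I.T i l j :=
  extend_T_injective.extend_apply (fun p : Fin n × Fin r × Fin t => I.T p.1 p.2.1 p.2.2) 0 (i, l, j)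

theorem abs_input_T_le (I : NFold n r t) (z : ℤ) : |I.input.arr 0 z| ≤ I.maxEntry := by
  by_cases h : ∃ p : Fin n × Fin r × Fin t, (((p.1 : ℕ) * r + p.2.1) * t + p.2.2 : ℤ) = z
  · obtain ⟨⟨i, l, j⟩, rfl⟩ := h
    rw [I.input_T]
    exact I.abs_T_le_maxEntry i l j
  · have : I.input.arr 0 z = 0 := 
      Function.extend_apply' (fun p : Fin n × Fin r × Fin t => I.T p.1 p.2.1 p.2.2) (0 : ℤ → ℤ) _ h
    simp [this]

theorem extend_b_injective : Function.Injective
    (Sum.elim (fun k : Fin r => ((k : ℕ) : ℤ)) (fun i : Fin n => (r + (i : ℕ) : ℤ))) := by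
  rintro (l | i) (l' | i') h <;> simp at h
  · simp [Fin.ext_iff, h]
  · omega
  · omega
  · simp [Fin.ext_iff, h]

theorem input_b_inl (I : NFold n r t) (l : Fin r) : I.input.arr 1 (l : ℕ) = I.b (Sum.inl l) :=
  extend_b_injective.extend_apply I.b 0 (Sum.inl l)

theorem input_b_inr (I : NFold n r t) (i : Fin n) :
    I.input.arr 1 (r + (i : ℕ)) = I.b (Sum.inr i) :=
  extend_b_injective.extend_apply I.b 0 (Sum.inr i)

theorem input_c (I : NFold n r t) (i : Fin n) (j : Fin t) :
    I.input.arr 2 ((i : ℕ) * t + (j : ℕ)) = I.c (i, j) := by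
  refine Function.Injective.extend_apply (f := fun p : Fin n × Fin t => ((p.1 : ℕ) * t + p.2 : ℤ))
    ?_ I.c 0 (i, j)
  rintro ⟨i, j⟩ ⟨i', j'⟩ h
  simp only at h
  obtain ⟨h1, h2⟩ := mul_add_inj (i := i) (i' := i') j.2 j'.2 (by exact_mod_cast h)
  simp [Fin.ext_iff, h1, h2]

theorem instance_input (I : NFold n r t) : Solver.Instance n r t (I.input.arr 0) (I.input.arr 1)
    (I.input.arr 2) I.input :=
  ⟨rfl, rfl, rfl, rfl, rfl, rfl⟩

theorem sum_input_b (I : NFold n r t) :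
    ∑ i ∈ Finset.range n, I.input.arr 1 (r + i) = I.localSum := by
  rw [localSum, ← Fin.sum_univ_eq_sum_range fun i : ℕ => I.input.arr 1 (r + i)]
  exact Finset.sum_congr rfl fun i _ => I.input_b_inr i

/-- Grouping the terms of a sum along a path by brick and column. -/
theorem sum_path {R : Type*} [CommSemiring R] (σ : ℕ → Fin n) (js : ℕ → Fin t) (q : ℕ)
    (f : Fin n → Fin t → R) : ∑ m ∈ Finset.range q, f (σ m) (js m)
      = ∑ i, ∑ j, f i j * ((Finset.range q).filter fun m => σ m = i ∧ js m = j).card := by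
  have : ∀ m, f (σ m) (js m) = ∑ i, ∑ j, if σ m = i ∧ js m = j then f i j else 0 := by
    intro m
    rw [Finset.sum_eq_single (σ m), Finset.sum_eq_single (js m)]
    · simp
    · intro j _ hj; simp [Ne.symm hj]
    · simp
    · intro i _ hi; simp [Ne.symm hi]
    · simp
  rw [Finset.sum_congr rfl fun m _ => this m, Finset.sum_comm]
  refine Finset.sum_congr rfl fun i _ => ?_
  rw [Finset.sum_comm]
  refine Finset.sum_congr rfl fun j _ => ?_
  rw [← Finset.sum_filter, Finset.sum_const, nsmul_eq_mul, mul_comm]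

/-- What the tables of the dynamic program satisfy for an instance: `σ` is the schedule, `G` holds
the codes of the columns and `L` those of the window. -/
structure Tables (I : NFold n r t) (q : ℕ) (M : ℤ) (A G P L : ℤ → ℤ) (len : ℕ)
    (σ : ℕ → Fin n) (mark val : ℤ → ℤ) : Prop where
  sum : ∑ i, I.b (Sum.inr i) = q
  nonneg : ∀ i, 0 ≤ I.b (Sum.inr i)
  radix : M = 2 * I.maxEntry * q + 1
  upper : ∀ l, |I.b (Sum.inl l)| ≤ I.maxEntry * q
  sched : ∀ m < q, A (m : ℕ) = (σ m : ℕ) * t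
  balanced : 0 < q → ∀ k ≤ q, ∀ i, q * (occ σ i k : ℤ) < k * I.b (Sum.inr i) + q
  code : ∀ i : Fin n, ∀ j : Fin t,
    G ((i : ℕ) * t + (j : ℕ)) = ∑ l : Fin r, I.T i l j * M ^ ((l : ℕ) + 1)
  pow : ∀ l < r, P (l : ℕ) = M ^ (l + 1)
  window : ∀ a : ℕ → ℕ, (∀ l < r, a l < 2 * (2 * I.maxEntry * (n * (r + 1) - 1)) + 1) →
    ∃ idx : ℕ, idx < len ∧ L idx = ∑ l ∈ Finset.range r,
      ((a l : ℤ) - (2 * I.maxEntry * (n * (r + 1) - 1) : ℕ)) * M ^ (l + 1)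
  covers : Covers t A G (I.input.arr 2) (Solver.centre r q (I.input.arr 1) P) L len q mark val

/-- The code of the target. -/
def target (I : NFold n r t) (q : ℕ) (M : ℤ) : ℤ :=
  q + ∑ l : Fin r, I.b (Sum.inl l) * M ^ ((l : ℕ) + 1)

section Tables

variable {I : NFold n r t} {q : ℕ} {M : ℤ} {A G P L : ℤ → ℤ} {len : ℕ} {σ : ℕ → Fin n}
  {mark val : ℤ → ℤ}

theorem Tables.pathCode_eq (h : Tables I q M A G P L len σ mark val) (js : ℕ → Fin t) {k : ℕ}
    (hk : k ≤ q) : pathCode A G (fun m => js m) k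
      = k + ∑ l : Fin r, (∑ m ∈ Finset.range k, I.T (σ m) l (js m)) * M ^ ((l : ℕ) + 1) := by
  rw [pathCode, Finset.sum_add_distrib, add_comm]
  congr 1
  · simp
  · simp only [Finset.sum_mul]
    rw [Finset.sum_comm]
    refine Finset.sum_congr rfl fun m hm => ?_
    rw [h.sched m (by have := Finset.mem_range.1 hm; omega), h.code]

theorem Tables.pathCost_eq (h : Tables I q M A G P L len σ mark val) (js : ℕ → Fin t) :
    pathCost A (I.input.arr 2) (fun m => js m) q = ∑ m ∈ Finset.range q, I.c (σ m, js m) :=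
  Finset.sum_congr rfl fun m hm => by
    rw [h.sched m (Finset.mem_range.1 hm), I.input_c]

theorem Tables.occ_eq (h : Tables I q M A G P L len σ mark val) (i : Fin n) :
    (occ σ i q : ℤ) = I.b (Sum.inr i) := by
  have hb : ∀ i, ((I.b (Sum.inr i)).toNat : ℤ) = I.b (Sum.inr i) :=
    fun i => Int.toNat_of_nonneg (h.nonneg i)
  have hsum : ∑ i, (I.b (Sum.inr i)).toNat = q := by
    zify
    rw [Finset.sum_congr rfl fun i _ => hb i, h.sum]
  rcases Nat.eq_zero_or_pos q with hq | hq
  · subst hq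
    have := (Finset.sum_eq_zero_iff_of_nonneg fun i _ => h.nonneg i).1 (by simpa using h.sum) i
      (Finset.mem_univ i)
    simp [this]
  · rw [occ_eq_of_balanced hsum (σ := σ) (fun i => ?_) i, hb]
    have := h.balanced hq q le_rfl i
    rw [← hb i] at this
    exact_mod_cast this

/-- Every feasible solution is found by the dynamic program. -/
theorem Tables.of_isFeasible [NeZero t] (hn : 1 ≤ n) (h : Tables I q M A G P L len σ mark val)
    {x : Fin n × Fin t → ℤ} (hx : I.IsFeasible x) :
    0 < mark (I.target q M) ∧ val (I.target q M) ≤ I.c ⬝ᵥ x := by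
  obtain ⟨hx1, hx2, hx0⟩ := (I.isFeasible_iff x).1 hx
  have hxy : ∀ i j, ((x (i, j)).toNat : ℤ) = x (i, j) := fun i j => Int.toNat_of_nonneg (hx0 _)
  have hrow : ∀ i, ((∑ j, (x (i, j)).toNat : ℕ) : ℤ) = I.b (Sum.inr i) := fun i => by
    push_cast
    rw [← hx2 i]
    exact Finset.sum_congr rfl fun j _ => hxy i j
  obtain ⟨js, hjs1, hjs2⟩ := exists_balanced_choice hn (fun i l j => I.T i l j)
    I.abs_T_le_maxEntry (fun i j => (x (i, j)).toNat) (q := q) (by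
      zify
      rw [← h.sum]
      exact Finset.sum_congr rfl fun i _ => by exact_mod_cast hrow i) (σ := σ) (fun hq k hk i => by
      have := h.balanced hq k hk i
      rw [← hrow i] at this
      exact_mod_cast this)
  have hup : ∀ l, ∑ i, ∑ j, I.T i l j * ((x (i, j)).toNat : ℤ) = I.b (Sum.inl l) := fun l => by
    rw [← hx1 l]
    exact Finset.sum_congr rfl fun i _ => Finset.sum_congr rfl fun j _ => by rw [hxy]
  simp only [hup] at hjs2
  have hend : pathCode A G (fun m => js m) q = I.target q M := by
    rw [h.pathCode_eq js le_rfl, target]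
    congr 1
    refine Finset.sum_congr rfl fun l _ => ?_
    rw [sum_path σ js q fun i j => I.T i l j]
    simp only [hjs1, hup]
  have hcost : pathCost A (I.input.arr 2) (fun m => js m) q = I.c ⬝ᵥ x := by
    rw [h.pathCost_eq, sum_path σ js q fun i j => I.c (i, j), dotProduct_eq]
    simp only [hjs1, hxy]
  rw [← hend, ← hcost]
  refine h.covers _ (fun m => (js m).2) fun k hk hkq => ?_
  have hq : (0:ℤ) < q := by exact_mod_cast (by omega : 0 < q)
  set ρ : ℕ := 2 * I.maxEntry * (n * (r + 1) - 1) with hρ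
  have hρ' : (ρ : ℤ) = 2 * I.maxEntry * (n * (r + 1) - 1) := by
    have : 1 ≤ n * (r + 1) := Nat.mul_pos (by omega) (by omega)
    rw [hρ]; push_cast [Nat.cast_sub this]; ring
  set V : Fin r → ℤ := fun l => ∑ m ∈ Finset.range k, I.T (σ m) l (js m) with hV
  set F : Fin r → ℤ := fun l => k * I.b (Sum.inl l) / q with hF
  -- V is within ρ of the rational point k·b/q. Replacing that point by its floor adds less than 1
  -- to the difference, and integrality removes this excess again.
  have hwin : ∀ l, 0 ≤ V l - F l + ρ ∧ V l - F l + ρ < 2 * ρ + 1 := by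
    intro l
    have h1 := abs_le.1 (hjs2 k hkq l)
    rw [← hρ'] at h1
    have h2 := Int.emod_add_mul_ediv (k * I.b (Sum.inl l)) q
    have h3 := Int.emod_nonneg (k * I.b (Sum.inl l)) hq.ne'
    have h4 := Int.emod_lt_of_pos (k * I.b (Sum.inl l)) hq
    constructor
    · by_contra hlt
      push Not at hlt
      have : q * (V l - F l + ρ) ≤ q * (-1) := mul_le_mul_of_nonneg_left (by omega) hq.le
      simp only [hV, hF] at this
      linarith
    · by_contra hlt
      push Not at hlt
      have : q * (2 * ρ + 1) ≤ q * (V l - F l + ρ) := mul_le_mul_of_nonneg_left hlt hq.le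
      simp only [hV, hF] at this
      linarith
  obtain ⟨idx, hidx, hLidx⟩ := h.window
    (fun l => if hl : l < r then (V ⟨l, hl⟩ - F ⟨l, hl⟩ + ρ).toNat else 0) (fun l hl => by
      have := hwin ⟨l, hl⟩
      simp only [hl, dif_pos]
      omega)
  refine ⟨idx, hidx, ?_⟩
  rw [hLidx, h.pathCode_eq js hkq, Solver.centre, add_assoc, ← Finset.sum_add_distrib,
    ← Fin.sum_univ_eq_sum_range (fun l => (k:ℤ) * I.input.arr 1 (l : ℕ) / q * P (l : ℕ) +
      (((if hl : l < r then (V ⟨l, hl⟩ - F ⟨l, hl⟩ + ρ).toNat else 0 : ℕ) : ℤ) - ρ) * M ^ (l + 1))]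
  congr 1
  refine Finset.sum_congr rfl fun l _ => ?_
  rw [h.pow l l.2, I.input_b_inl, dif_pos l.2, Int.toNat_of_nonneg (hwin l).1]
  simp only [hF, hV]
  ring

/-- A path to the target yields a feasible solution of the same cost. -/
theorem Tables.isFeasible (h : Tables I q M A G P L len σ mark val) {js : ℕ → ℕ}
    (hjs : ∀ m, js m < t) (hcode : pathCode A G js q = I.target q M)
    {x : Fin n × Fin t → ℤ} (hx : ∀ p, x p = ∑ m ∈ Finset.range q,
      if A m + js m = ((p.1 : ℕ) * t + (p.2 : ℕ) : ℤ) then 1 else 0) :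
    I.IsFeasible x ∧ I.c ⬝ᵥ x = pathCost A (I.input.arr 2) js q := by
  obtain ⟨js, rfl⟩ : ∃ js' : ℕ → Fin t, js = fun m => (js' m : ℕ) :=
    ⟨fun m => ⟨js m, hjs m⟩, rfl⟩
  have hxc : ∀ i j, x (i, j)
      = (((Finset.range q).filter fun m => σ m = i ∧ js m = j).card : ℤ) := by
    intro i j
    rw [hx, Finset.card_filter]
    push_cast
    refine Finset.sum_congr rfl fun m hm => ?_
    rw [h.sched m (Finset.mem_range.1 hm)]
    refine if_congr ⟨fun he => ?_, ?_⟩ rfl rfl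
    · obtain ⟨h1, h2⟩ := mul_add_inj (js m).2 j.2 (by exact_mod_cast he)
      exact ⟨Fin.ext h1, Fin.ext h2⟩
    · rintro ⟨rfl, rfl⟩; rfl
  refine ⟨(I.isFeasible_iff x).2 ⟨?_, fun i => ?_, fun ⟨i, j⟩ => ?_⟩, ?_⟩
  · rw [h.pathCode_eq js le_rfl, target] at hcode
    set V : Fin r → ℤ := fun l => ∑ m ∈ Finset.range q, I.T (σ m) l (js m) with hV
    have hsum : ∑ l : Fin r, (V l - I.b (Sum.inl l)) * M ^ ((l : ℕ) + 1) = 0 := by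
      simp only [sub_mul, Finset.sum_sub_distrib]
      linarith
    have hVb : ∀ l, |V l| ≤ I.maxEntry * q := fun l => by
      calc |V l| ≤ ∑ m ∈ Finset.range q, |I.T (σ m) l (js m)| := Finset.abs_sum_le_sum_abs _ _
        _ ≤ ∑ m ∈ Finset.range q, (I.maxEntry : ℤ) :=
          Finset.sum_le_sum fun m _ => I.abs_T_le_maxEntry _ _ _
        _ = _ := by simp [mul_comm]
    intro l
    -- Both vectors have entries at most Δq in absolute value, so each digit of the difference is at
    -- most 2Δq < M. This is where the size of the radix matters.
    have key := eq_zero_of_sum_mul_pow_eq_zero (M := M) (r := r)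
      (u := fun l => if hl : l < r then V ⟨l, hl⟩ - I.b (Sum.inl ⟨l, hl⟩) else 0) (fun l hl => by
        simp only [hl, dif_pos]
        have := abs_sub (V ⟨l, hl⟩) (I.b (Sum.inl ⟨l, hl⟩))
        have h1 := hVb ⟨l, hl⟩
        have h2 := h.upper ⟨l, hl⟩
        rw [h.radix]
        linarith) (by
        rw [← Fin.sum_univ_eq_sum_range (fun l => (if hl : l < r then
          V ⟨l, hl⟩ - I.b (Sum.inl ⟨l, hl⟩) else 0) * M ^ (l + 1)), ← hsum]
        exact Finset.sum_congr rfl fun l _ => by rw [dif_pos l.2]) l l.2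
    simp only [l.2, dif_pos] at key
    have hVl : V l = ∑ i, ∑ j, I.T i l j * x (i, j) := by
      simp only [hV, hxc]
      exact sum_path σ js q fun i j => I.T i l j
    rw [← hVl]
    exact sub_eq_zero.1 key
  · rw [← h.occ_eq i]
    -- A weight that ignores the column counts the visits to brick i, which the schedule fixes.
    have := sum_path σ js q fun i' _ => if i' = i then (1:ℤ) else 0
    rw [Finset.sum_eq_single i (fun i' _ hi' => by simp [hi']) (by simp)] at this
    simp only [if_true, one_mul] at this
    simp only [hxc]
    rw [← this, occ, Finset.card_filter]
    push_cast
    rfl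
  · rw [hxc]; positivity
  · rw [h.pathCost_eq, dotProduct_eq, sum_path σ js q fun i j => I.c (i, j)]
    simp only [hxc]

end Tables

end NFold

/-! ### The whole algorithm and its running time -/

namespace NFold.Solver

open RAM

variable {n r t : ℕ}

/-- The algorithm for instances that pass the check of the right-hand side. -/
def solveChecked : Program :=
  .seq setRadix <| .seq setColumns <| .seq setWindow <| .seq fillTables traceBack

/-- The whole algorithm. -/
def solve : Program :=
  .seq findMax <| .seq checkRhs <| .ifPos (.reg 5) (.assign 0 (.const 0)) solveChecked

theorem solveChecked_halts (I : NFold n r t) (hn : 1 ≤ n) (ht : 1 ≤ t) {s : Store}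
    (hs : Agree (.seq findMax checkRhs) I.input s) {Δ q ρ w : ℕ} (hΔI : Δ = I.maxEntry)
    (hqI : I.localSum = q) (hρ : ρ = 2 * Δ * (n * (r + 1) - 1)) (hw : w = 2 * ρ + 1)
    (hΔ : s.reg 3 = Δ) (hq : s.reg 4 = q) (hΔq : s.reg 13 = Δ * q)
    (hb0 : ∀ i, 0 ≤ I.b (Sum.inr i)) (hb : ∀ l, |I.b (Sum.inl l)| ≤ Δ * q) :
    Halts solveChecked s ((12 * n + 12 * Δ + 36 * (r * (Δ * q)) + 120 * r + 120)
      + (12 * r + n * (t * (r * (12 * Δ + 50) + 50) + 50) + 50) + (12 * ρ + 240 * w ^ r + 60)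
      + (q * (40 * n + r * (20 * Δ + 60) + w ^ r * (50 * t + 30) + 80) + 20) + (50 * q + 40))
      I.IsAnswer := by
  subst hΔI
  have : NeZero t := ⟨by omega⟩
  have h := I.instance_input.of_agree hs
  have hΔ1 := I.one_le_maxEntry hn ht
  have hbl : ∀ l < r, |I.input.arr 1 (l : ℕ)| ≤ I.maxEntry * q := fun l hl =>
    I.input_b_inl ⟨l, hl⟩ ▸ hb ⟨l, hl⟩
  have hpos : 1 ≤ n * (r + 1) := Nat.mul_pos hn (by omega)
  obtain ⟨M, hM⟩ : ∃ M : ℤ, M = 2 * I.maxEntry * q + 1 := ⟨_, rfl⟩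
  have hqM : q < M := by
    rw [hM]
    have : (1:ℤ) ≤ I.maxEntry := by exact_mod_cast hΔ1
    nlinarith [mul_le_mul_of_nonneg_right this (Nat.cast_nonneg (α := ℤ) q),
      Nat.cast_nonneg (α := ℤ) q]
  refine Halts.then (setRadix_halts h hΔ hq hΔq hbl hM) ?_ (by omega)
  rintro s₁ ag₁ ⟨a7, a8, a9, a15, a12, a4⟩
  replace h := h.of_agree ag₁
  refine Halts.then (setColumns_halts h I.abs_input_T_le a4) ?_ (by omega)
  intro s₂ ag₂ a5
  replace h := h.of_agree ag₂
  replace a4 : ∀ l < r, s₂.arr 4 (l : ℕ) = M ^ (l + 1) := by rwa [ag₂.arr 4 (by decide)]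
  have a7' : s₂.reg 7 = ρ := by
    rw [ag₂.reg 7 (by decide), a7, hρ]; push_cast [Nat.cast_sub hpos]; ring
  have a8' : s₂.reg 8 = w := by
    rw [ag₂.reg 8 (by decide), a8, ← ag₂.reg 7 (by decide), a7', hw]; push_cast; ring
  have hw2 : r = 0 ∨ 2 ≤ w := by
    rcases Nat.eq_zero_or_pos r with hr | hr
    · exact Or.inl hr
    · right
      have : 1 * 2 ≤ n * (r + 1) := Nat.mul_le_mul hn (by omega)
      have : 0 < ρ := by rw [hρ]; exact Nat.mul_pos (by omega) (by omega)
      omega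
  refine Halts.then (setWindow_halts h a7' a8' ((ag₂.reg 15 (by decide)).trans a15) hw2 a4) ?_
    (by omega)
  rintro s₃ ag₃ ⟨b10, b6, bwin⟩
  replace h := h.of_agree ag₃
  replace a4 : ∀ l < r, s₃.arr 4 (l : ℕ) = M ^ (l + 1) := by rwa [ag₃.arr 4 (by decide)]
  replace a5 : ∀ i < n, ∀ j < t, s₃.arr 5 ((i : ℕ) * t + (j : ℕ))
      = ∑ l ∈ Finset.range r, I.input.arr 0 ((i * r + l) * t + j) * M ^ (l + 1) := by
    rwa [ag₃.arr 5 (by decide)]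
  have hready : Ready n r t (I.input.arr 0) (I.input.arr 1) (I.input.arr 2) q (w ^ r)
      (s₃.arr 4) (s₃.arr 5) (s₃.arr 6) s₃ :=
    ⟨h, by rw [ag₃.reg 4 (by decide), ag₂.reg 4 (by decide), ag₁.reg 4 (by decide), hq], b10,
      rfl, rfl, rfl⟩
  have hzero : ∀ a, 3 ≤ a → a ∉ setWindow.arrs → a ∉ setColumns.arrs → a ∉ setRadix.arrs →
      a ∉ (Program.seq findMax checkRhs).arrs → s₃.arr a = 0 := fun a ha h1 h2 h3 h4 => by
    rw [ag₃.arr a h1, ag₂.arr a h2, ag₁.arr a h3, hs.arr a h4]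
    simp only [input]
    rw [if_neg (by omega), if_neg (by omega), if_neg (by omega)]
  have hdvd : ∀ l, M ∣ M ^ (l + 1) := fun l => dvd_pow_self M (by omega)
  have hG : ∀ i < n, ∀ j < t, M ∣ s₃.arr 5 ((i : ℕ) * t + (j : ℕ)) := fun i hi j hj => by
    rw [a5 i hi j hj]
    exact Finset.dvd_sum fun l _ => (hdvd l).mul_left _
  refine Halts.then (fillTables_halts hready ht hqM (I.sum_input_b.trans hqI)
    (fun i hi => I.input_b_inr ⟨i, hi⟩ ▸ hb0 ⟨i, hi⟩) hbl (fun l hl => by rw [a4 l hl]; exact hdvd l)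
    b6 hG (hzero 7 (by decide) (by decide) (by decide) (by decide) (by decide))
    (hzero 8 (by decide) (by decide) (by decide) (by decide) (by decide))
    (hzero 9 (by decide) (by decide) (by decide) (by decide) (by decide))
    (hzero 11 (by decide) (by decide) (by decide) (by decide) (by decide))) ?_ (by omega)
  rintro s₄ ag₄ ⟨c1, c2, c3, c4⟩
  replace hready := hready.of_agree ag₄
  -- Beyond step q the schedule is irrelevant; brick 0 serves as a default where the chosen index is
  -- out of range.
  obtain ⟨σ, hσ⟩ : ∃ σ : ℕ → Fin n, ∀ m < q, s₄.arr 10 (m : ℕ) = (σ m : ℕ) * t := by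
    choose! f hf1 hf2 using c1
    exact ⟨fun m => if hm : f m < n then ⟨f m, hm⟩ else ⟨0, hn⟩, fun m hm => by
      simp only [dif_pos (hf1 m hm)]; exact hf2 m hm⟩
  have htab : Tables I q M (s₄.arr 10) (s₃.arr 5) (s₃.arr 4) (s₃.arr 6) (w ^ r) σ (s₄.arr 7)
      (s₄.arr 8) := by
    refine ⟨hqI, hb0, hM, hb, hσ, fun hq k hk i => ?_, fun i j => ?_, a4, ?_, c4⟩
    · have := c2 hq k hk i i.2
      rw [I.input_b_inr] at this
      convert this using 3
      rw [occ, occ]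
      refine congrArg Finset.card (Finset.filter_congr fun m hm => ?_)
      rw [hσ m (by have := Finset.mem_range.1 hm; omega)]
      have ht0 : t ≠ 0 := by omega
      simp [ht0, Fin.ext_iff]
    · rw [a5 i i.2 j j.2, ← Fin.sum_univ_eq_sum_range
        (fun l => I.input.arr 0 (((i : ℕ) * r + (l : ℕ)) * t + (j : ℕ)) * M ^ (l + 1))]
      exact Finset.sum_congr rfl fun l _ => by rw [I.input_T]
    · rw [← hρ, ← hw]; exact bwin
  have hZ : s₄.reg 12 = I.target q M := by
    rw [ag₄.reg 12 (by decide), ag₃.reg 12 (by decide), ag₂.reg 12 (by decide), a12, target,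
      ← Fin.sum_univ_eq_sum_range (fun l => I.input.arr 1 (l : ℕ) * M ^ (l + 1))]
    congr 1
    exact Finset.sum_congr rfl fun l _ => by rw [I.input_b_inl]
  have hZM : I.target q M % M = q := by
    obtain ⟨y, hy⟩ : M ∣ ∑ l : Fin r, I.b (Sum.inl l) * M ^ ((l : ℕ) + 1) :=
      Finset.dvd_sum fun l _ => (hdvd l).mul_left _
    rw [target, hy, Int.add_mul_emod_self_left]
    exact Int.emod_eq_of_lt (by omega) hqM
  have h3 : s₄.arr 3 = 0 := by
    rw [ag₄.arr 3 (by decide)]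
    exact hzero 3 (by decide) (by decide) (by decide) (by decide) (by decide)
  refine (traceBack_halts hready ht hZ hZM hqM (fun m hm j hj => ?_) rfl h3 c3).mono (by omega) ?_
  · obtain ⟨i, hi, hi'⟩ := c1 m hm
    rw [hi']
    exact hG i hi j hj
  · rintro s₅ - (⟨g1, g2⟩ | ⟨g1, g2, js, g3, g4, g5, g6⟩)
    · exact Or.inl ⟨g1, fun ⟨x, hx⟩ => g2 (htab.of_isFeasible hn hx).1⟩
    · obtain ⟨h1, h2⟩ := htab.isFeasible g3 g4 (x := output n t s₅) fun p => g6 _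
      refine Or.inr ⟨g1, h1, fun y hy => ?_⟩
      rw [h2, g5]
      exact (htab.of_isFeasible hn hy).2

/-- An instance with a negative local right-hand side or a too large upper one is infeasible. -/
theorem not_isFeasible_of_bad (I : NFold n r t)
    (h : (∃ i, I.b (Sum.inr i) < 0) ∨ ∃ l, I.maxEntry * I.localSum < |I.b (Sum.inl l)|) :
    ¬ ∃ x, I.IsFeasible x := by
  rintro ⟨x, hx⟩
  obtain ⟨h1, h2, h3⟩ := (I.isFeasible_iff x).1 hx
  rcases h with ⟨i, hi⟩ | ⟨l, hl⟩
  · rw [← h2 i] at hi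
    exact absurd (Finset.sum_nonneg fun j _ => h3 (i, j)) (not_le.2 hi)
  · refine absurd hl (not_lt.2 ?_)
    calc |I.b (Sum.inl l)| = |∑ i, ∑ j, I.T i l j * x (i, j)| := by rw [h1]
      _ ≤ ∑ i, ∑ j, |I.T i l j * x (i, j)| := (Finset.abs_sum_le_sum_abs _ _).trans
        (Finset.sum_le_sum fun i _ => Finset.abs_sum_le_sum_abs _ _)
      _ ≤ ∑ i, ∑ j, I.maxEntry * x (i, j) :=
        Finset.sum_le_sum fun i _ => Finset.sum_le_sum fun j _ => by
          rw [abs_mul, abs_of_nonneg (h3 _)]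
          exact mul_le_mul_of_nonneg_right (I.abs_T_le_maxEntry i l j) (h3 _)
      _ = I.maxEntry * I.localSum := by
        simp only [← Finset.mul_sum]
        rw [localSum, Finset.sum_congr rfl fun i _ => h2 i]

theorem _root_.NFold.maxEntry_eq_one_of_zero (I : NFold n 0 t) (hn : 1 ≤ n) (ht : 1 ≤ t) : I.maxEntry = 1 :=
  le_antisymm (by exact_mod_cast I.maxEntry_le le_rfl fun _ l => l.elim0) (I.one_le_maxEntry hn ht)

/-- The number of window points and all parameters are bounded in terms of the claimed bound on
the number of states. -/
theorem state_bounds {Δ : ℕ} (hn : 1 ≤ n) (hΔ : 1 ≤ Δ) (hr : r = 0 → Δ = 1) :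
    let R := (n * Δ * (n + 1 + 4 * r)) ^ r
    1 ≤ R ∧ Δ ≤ R ∧ n * (r * Δ) ≤ R ∧ (2 * (2 * Δ * (n * (r + 1) - 1)) + 1) ^ r ≤ R := by
  intro R
  rcases Nat.eq_zero_or_pos r with h0 | h0
  -- For r = 0 the power R is 1, so Δ ≤ R needs Δ = 1.
  · have := hr h0
    subst h0
    simp [R, this]
  · set B := n * Δ * (n + 1 + 4 * r) with hB
    have hnΔ : 1 ≤ n * Δ := Nat.mul_pos hn hΔ
    have hBpos : 1 ≤ B := Nat.mul_pos hnΔ (by omega)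
    have hBR : B ≤ R := Nat.le_self_pow (by omega) B
    refine ⟨hBpos.trans hBR, le_trans ?_ hBR, le_trans ?_ hBR, Nat.pow_le_pow_left ?_ r⟩
    · calc Δ ≤ n * Δ := Nat.le_mul_of_pos_left _ hn
        _ ≤ B := Nat.le_mul_of_pos_right _ (by omega)
    · calc n * (r * Δ) = n * Δ * r := by ring
        _ ≤ B := Nat.mul_le_mul_left _ (by omega)
    · obtain ⟨x, hx⟩ : ∃ x, n * (r + 1) = x + 1 := ⟨n * (r + 1) - 1, by
        have : 1 ≤ n * (r + 1) := Nat.mul_pos hn (by omega)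
        omega⟩
      rw [hx, Nat.add_sub_cancel]
      zify at hx hn hΔ ⊢
      have hx' : (x:ℤ) = n * (r + 1) - 1 := by linarith
      rw [hx']
      -- After expansion the terms with r cancel, and what remains is 1 ≤ Δ((n-1)(n-2) + 2).
      have h1 : (1:ℤ) ≤ Δ * (n * (n + 1) - 4 * n + 4) := by
        have : (1:ℤ) ≤ n * (n + 1) - 4 * n + 4 := by
          rcases hn.eq_or_lt with h | h
          · rw [← h]; norm_num
          · nlinarith [mul_nonneg (show (0:ℤ) ≤ n - 2 by linarith) (show (0:ℤ) ≤ n - 1 by linarith)]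
        nlinarith
      nlinarith

theorem solve_halts (I : NFold n r t) (hn : 1 ≤ n) (ht : 1 ≤ t) :
    Halts solve I.input (10000 * (n * t * (n * I.maxEntry * (n + 1 + 4 * r)) ^ r
      * max 1 I.localSum.toNat)) I.IsAnswer := by
  have hΔ1 := I.one_le_maxEntry hn ht
  obtain ⟨hR1, hR2, hR3, hR4⟩ := state_bounds (r := r) hn hΔ1 fun h => by
    subst h; exact I.maxEntry_eq_one_of_zero hn ht
  set Δ := I.maxEntry with hΔ
  set R := (n * Δ * (n + 1 + 4 * r)) ^ r with hR
  set Q := max 1 I.localSum.toNat with hQ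
  set X := n * t * R * Q with hX
  have hQ1 : 1 ≤ Q := le_max_left _ _
  -- Every cost term is bounded through four factors below n, t, R and Q; a missing factor is
  -- replaced by 1.
  have mon : ∀ {a b c d : ℕ}, a ≤ n → b ≤ t → c ≤ R → d ≤ Q → a * b * c * d ≤ X :=
    fun ha hb hc hd => Nat.mul_le_mul (Nat.mul_le_mul (Nat.mul_le_mul ha hb) hc) hd
  have hrΔ : r * Δ ≤ R := (Nat.le_mul_of_pos_left _ hn).trans hR3
  have hr : r ≤ R := (Nat.le_mul_of_pos_right _ hΔ1).trans hrΔ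
  have m0 : 1 ≤ X := by simpa using mon hn ht hR1 hQ1
  have m1 : n ≤ X := by simpa using mon le_rfl ht hR1 hQ1
  have m2 : n * r ≤ X := by simpa using mon le_rfl ht hr hQ1
  have m3 : n * r * t ≤ X := by simpa [mul_right_comm] using mon le_rfl le_rfl hr hQ1
  have m4 : Δ ≤ X := by simpa using mon hn ht hR2 hQ1
  have m5 : r ≤ X := by simpa using mon hn ht hr hQ1
  refine Halts.then (findMax_halts I.instance_input hΔ1 I.abs_input_T_le fun D hD h => ?_) ?_
    (by omega)
  · refine I.maxEntry_le hD fun i l j => ?_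
    have hlt : ((i : ℕ) * r + l) * t + j < n * r * t := by
      calc ((i : ℕ) * r + l) * t + j < ((i : ℕ) * r + l) * t + t := by omega
        _ = ((i : ℕ) * r + (l + 1)) * t := by ring
        _ ≤ ((i : ℕ) * r + r) * t := Nat.mul_le_mul_right _ (by omega)
        _ = ((i + 1 : ℕ) * r) * t := by ring
        _ ≤ n * r * t := Nat.mul_le_mul_right _ (Nat.mul_le_mul_right _ i.2)
    have := h _ hlt
    push_cast at this
    rwa [I.input_T] at this
  intro s₁ ag₁ h3
  refine Halts.then (checkRhs_halts (I.instance_input.of_agree ag₁) h3) ?_ (by omega)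
  rintro s₂ ag₂ ⟨h4, h13, h5⟩
  replace h3 : s₂.reg 3 = Δ := (ag₂.reg 3 (by decide)).trans h3
  rw [I.sum_input_b] at h4
  rw [h13, h4] at h5
  replace h5 : 0 < s₂.reg 5 ↔ (∃ i, I.b (Sum.inr i) < 0) ∨
      ∃ l, Δ * I.localSum < |I.b (Sum.inl l)| := by
    rw [h5]
    refine or_congr ⟨?_, ?_⟩ ⟨?_, ?_⟩
    · rintro ⟨i, hi, h⟩; exact ⟨⟨i, hi⟩, I.input_b_inr ⟨i, hi⟩ ▸ h⟩
    · rintro ⟨i, h⟩; exact ⟨i, i.2, I.input_b_inr i ▸ h⟩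
    · rintro ⟨l, hl, h⟩; exact ⟨⟨l, hl⟩, I.input_b_inl ⟨l, hl⟩ ▸ h⟩
    · rintro ⟨l, h⟩; exact ⟨l, l.2, I.input_b_inl l ▸ h⟩
  refine Halts.ite (fun hp => Halts.assign (Or.inl ⟨by simp, ?_⟩)) (fun hp => ?_)
  · exact not_isFeasible_of_bad I (h5.1 (by simpa using hp))
  have hgood := mt h5.2 (by simpa using hp)
  push Not at hgood
  obtain ⟨hb0, hb⟩ := hgood
  obtain ⟨q, hq⟩ : ∃ q : ℕ, I.localSum = q :=
    ⟨I.localSum.toNat, (Int.toNat_of_nonneg (Finset.sum_nonneg fun i _ => hb0 i)).symm⟩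
  have hqQ : q ≤ Q := by rw [hQ, hq]; simp
  rw [hq] at hb h4
  rw [h4] at h13
  obtain ⟨ρ, hρ⟩ : ∃ ρ, ρ = 2 * Δ * (n * (r + 1) - 1) := ⟨_, rfl⟩
  refine (solveChecked_halts I hn ht ((ag₁.mono (by simp [Program.regs])
    (by simp [Program.arrs])).trans (ag₂.mono (by simp [Program.regs]) (by simp [Program.arrs])))
    hΔ hq hρ rfl h3 h4 h13 hb0 hb).mono ?_ fun _ _ h => h
  rw [← hρ] at hR4
  set W := (2 * ρ + 1) ^ r with hW
  have m6 : r * (Δ * q) ≤ X := by simpa [mul_assoc] using mon hn ht hrΔ hqQ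
  have m7 : n * t * (r * Δ) ≤ X := by simpa using mon le_rfl le_rfl hrΔ hQ1
  have m8 : n * t ≤ X := by simpa using mon le_rfl le_rfl hR1 hQ1
  have m9 : ρ ≤ 4 * X := by
    have h1 : n * (r * Δ) ≤ X := by simpa using mon hn ht hR3 hQ1
    have h2 : n * Δ ≤ X := by simpa using mon le_rfl ht hR2 hQ1
    calc ρ ≤ 2 * Δ * (n * (r + 1)) := hρ ▸ Nat.mul_le_mul_left _ (Nat.sub_le _ _)
      _ = 2 * (n * (r * Δ)) + 2 * (n * Δ) := by ring
      _ ≤ 4 * X := by omega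
  have m10 : W ≤ X := by simpa using mon hn ht hR4 hQ1
  have m11 : n * q ≤ X := by simpa using mon le_rfl ht hR1 hqQ
  have m12 : r * q ≤ X := by simpa using mon hn ht hr hqQ
  have m13 : t * W * q ≤ X := by simpa using mon hn le_rfl hR4 hqQ
  have m14 : W * q ≤ X := by simpa using mon hn ht hR4 hqQ
  have m15 : q ≤ X := by simpa using mon hn ht hR1 hqQ
  have e1 : n * (t * (r * (12 * Δ + 50) + 50) + 50)
      = 12 * (n * t * (r * Δ)) + 50 * (n * r * t) + 50 * (n * t) + 50 * n := by ring
  have e2 : q * (40 * n + r * (20 * Δ + 60) + W * (50 * t + 30) + 80)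
      = 40 * (n * q) + 20 * (r * (Δ * q)) + 60 * (r * q) + 50 * (t * W * q) + 30 * (W * q)
        + 80 * q := by ring
  rw [e1, e2]
  simp only [Term.cost]
  omega

end NFold.Solver

theorem theorem1 :
    ∃ (P : RAM.Program) (C : ℕ),
      ∀ (n r t : ℕ), 1 ≤ n → 1 ≤ t → ∀ I : NFold n r t,
        ∃ (k : ℕ) (s : RAM.Store),
          RAM.Runs P I.input k s ∧ I.IsAnswer s ∧
            k ≤ C * (n * t * (n * I.maxEntry * (n + 1 + 4 * r)) ^ r * max 1 I.localSum.toNat) := by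
  refine ⟨NFold.Solver.solve, 10000, fun n r t hn ht I => ?_⟩
  obtain ⟨k, s, h1, h2, h3⟩ := NFold.Solver.solve_halts I hn ht
  exact ⟨k, s, h1, h3, h2⟩
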